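/- Let $\varepsilon_1=\varepsilon_3=1$, $\varepsilon_2=-1$. Lamé's system of first order (Lamé's system together with the Guichard condition) is the following system for functions $l=(l_i)_{1\le i\le 3}$, $l_i\neq 0$, and $h=(h_{ij})_{i\ne j}$ of $x=(x_1,x_2,x_3)$, where $i,j,k\in\{1,2,3\}$ are distinct and $f_{,x_j}=\partial f/\partial x_j$: $$\varepsilon_i l_i^2+\varepsilon_j l_j^2+\varepsilon_k l_k^2=0,\qquad l_{i,x_j}-h_{ij}l_j=0,\qquad \varepsilon_i l_{i,x_i}+\varepsilon_j h_{ji}l_j+\varepsilon_k h_{ki}l_k=0,$$ $$h_{ij,x_k}-h_{ik}h_{kj}=0,\qquad h_{ij,x_j}+h_{ji,x_i}+h_{ik}h_{jk}=0,\qquad \varepsilon_i h_{ij,x_i}+\varepsilon_j h_{ji,x_j}+\varepsilon_k h_{ki}h_{kj}=0 .$$ A solution is a smooth $u=(l,h)$ on an open subset of $\mathbb R^3$ that satisfies these equations. A symmetry group of the system is a smooth local action of a finite-dimensional real Lie group $G$ on an open set $M$ of the space $\mathbb R^3\times\mathbb R^3\times\mathbb R^6$ of the variables $(x,l,h)$ such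 that, for every $g\in G$ and every solution $u$ whose graph lies in the domain of $g$, if $g$ maps this graph onto the graph of a smooth function $g\cdot u$ over an open set, then $g\cdot u$ is a solution. It is called connected if, for every $p\in M$, the set of those $g\in G$ for which $g\cdot p$ is defined is connected. The (connected) symmetry group of this system is given by the transformations 1. translations in the independent variables, $\tilde x_i=x_i+v_i$; 2. dilations in the independent variables, $\tilde x_i=\lambda x_i$ (under which $\tilde h_{ij}=\lambda^{-1}h_{ij}$); 3. dilations in the dependent variables, $\tilde l_i=\rho\, l_i$; where $v_i\in\mathbb R$, $\lambda,\rho\in\mathbb R\setminus\{0\}$, and the variables that are not mentioned stay fixed. Precisely: (i) the Lie group of all composites of these transformations, acting on $\mathbb R^3\times\mathbb R^3\times\mathbb R^6$, is a symmetry group of the system; (ii) conversely, for every connected symmetry group $G$ of the system and every $g\in G$, on each connected set $S$ of points $(x,l,h)$ in the domain of $g$ that satisfy $l_1^2-l_2^2+l_3^2=0$ and $l_1l_2l_3\ne0$, the transformation $g$ coincides with the composite of one translation 1, one dilation 2 and one dilation 3, with $v\in\mathbb R^3$ and $\lambda,\rho>0$ depending only on $g$ and $S$. -/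

import Mathlib

open Set
open scoped Manifold ContDiff

noncomputable section

namespace Lame

/-- Index set of the off-diagonal entries `h_{ij}`, `i ≠ j`, of a `3 × 3` matrix. -/
abbrev OffDiag : Type := {q : Fin 3 × Fin 3 // q.1 ≠ q.2}

/-- The space of the independent variables `x = (x₁, x₂, x₃)`. -/
abbrev Indep : Type := Fin 3 → ℝ

/-- The space of the dependent variables `(l, h)`. -/
abbrev Dep : Type := (Fin 3 → ℝ) × (OffDiag → ℝ)

/-- The space of all variables `(x, l, h)`. -/
abbrev Total : Type := Indep × Dep

/-- The signs of the Guichard condition, `ε₁ = ε₃ = 1` and `ε₂ = -1`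
(the indices `1, 2, 3` are written `0, 1, 2` here). -/
def eps (i : Fin 3) : ℝ := if i = 1 then -1 else 1

/-- The partial derivative `∂f/∂x_j` at `x`. -/
def pd (j : Fin 3) (f : Indep → ℝ) (x : Indep) : ℝ := fderiv ℝ f x (Pi.single j 1)

/-- The component `l_i` of `u = (l, h)`. -/
def lfun (u : Indep → Dep) (i : Fin 3) (x : Indep) : ℝ := (u x).1 i

/-- The component `h_{ij}` of `u = (l, h)`, for `i ≠ j`. -/
def hfun (u : Indep → Dep) (i j : Fin 3) (hij : i ≠ j) (x : Indep) : ℝ := (u x).2 ⟨(i, j), hij⟩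

/-- `u = (l, h)` is a smooth solution, on the open set `Ω`, of Lamé's system of first order
(with the Guichard condition); the functions `l_i` do not vanish, since Lamé's system
divides by them. -/
structure IsSolution (Ω : Set Indep) (u : Indep → Dep) : Prop where
  isOpen : IsOpen Ω
  smooth : ContDiffOn ℝ ∞ u Ω
  ne_zero : ∀ x ∈ Ω, ∀ i, lfun u i x ≠ 0
  guichard : ∀ x ∈ Ω, ∑ i, eps i * lfun u i x ^ 2 = 0
  l_off : ∀ x ∈ Ω, ∀ (i j : Fin 3) (hij : i ≠ j),
    pd j (lfun u i) x - hfun u i j hij x * lfun u j x = 0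
  l_diag : ∀ x ∈ Ω, ∀ (i j k : Fin 3) (hij : i ≠ j) (_ : j ≠ k) (hik : i ≠ k),
    eps i * pd i (lfun u i) x + eps j * hfun u j i hij.symm x * lfun u j x
      + eps k * hfun u k i hik.symm x * lfun u k x = 0
  h_off : ∀ x ∈ Ω, ∀ (i j k : Fin 3) (hij : i ≠ j) (hjk : j ≠ k) (hik : i ≠ k),
    pd k (hfun u i j hij) x - hfun u i k hik x * hfun u k j hjk.symm x = 0
  h_sum : ∀ x ∈ Ω, ∀ (i j k : Fin 3) (hij : i ≠ j) (hjk : j ≠ k) (hik : i ≠ k),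
    pd j (hfun u i j hij) x + pd i (hfun u j i hij.symm) x
      + hfun u i k hik x * hfun u j k hjk x = 0
  h_eps : ∀ x ∈ Ω, ∀ (i j k : Fin 3) (hij : i ≠ j) (hjk : j ≠ k) (hik : i ≠ k),
    eps i * pd i (hfun u i j hij) x + eps j * pd j (hfun u j i hij.symm) x
      + eps k * hfun u k i hik.symm x * hfun u k j hjk.symm x = 0

/-- The points `(x, l, h)` that satisfy the algebraic equation of the system (the Guichard
condition) and `l_i ≠ 0`; the graph of every solution lies in this set. -/
def guichardSet : Set Total :=
  {p | (∑ i, eps i * p.2.1 i ^ 2 = 0) ∧ ∀ i, p.2.1 i ≠ 0}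

/-- The point transformation `Φ`, defined on `D`, transforms solutions into solutions: whenever
`u` is a solution whose graph lies in `D` and the transformed function `Φ · u` is defined,
i.e. the image of the graph of `u` is the graph of a smooth function `u'` over an open set,
then `u'` is a solution. -/
def MapsSolutions (D : Set Total) (Φ : Total → Total) : Prop :=
  ∀ (Ω Ω' : Set Indep) (u u' : Indep → Dep),
    IsSolution Ω u → Ω.graphOn u ⊆ D →
    IsOpen Ω' → ContDiffOn ℝ ∞ u' Ω' → Φ '' (Ω.graphOn u) = Ω'.graphOn u' →
    IsSolution Ω' u'

section Action

variable {E H : Type*} [NormedAddCommGroup E] [NormedSpace ℝ E] [TopologicalSpace H]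
  (I : ModelWithCorners ℝ E H) {G : Type*} [TopologicalSpace G] [ChartedSpace H G] [Group G]

/-- A local group of transformations: a smooth local action of the Lie group `G` on the open set
`M` of the space of independent and dependent variables. `W` is the domain of definition and
`Ψ (g, p)` is the transformed point `g · p`. -/
structure IsLocalAction (M : Set Total) (W : Set (G × Total)) (Ψ : G × Total → Total) :
    Prop where
  isOpen_space : IsOpen M
  isOpen_dom : IsOpen W
  dom_subset : ∀ g p, (g, p) ∈ W → p ∈ M
  one_mem : ∀ p ∈ M, ((1 : G), p) ∈ W
  mapsTo : ∀ g p, (g, p) ∈ W → Ψ (g, p) ∈ M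
  smooth : ContMDiffOn (I.prod 𝓘(ℝ, Total)) 𝓘(ℝ, Total) ∞ Ψ W
  one_act : ∀ p ∈ M, Ψ (1, p) = p
  mul_act : ∀ g g' p, (g', p) ∈ W → (g, Ψ (g', p)) ∈ W → (g * g', p) ∈ W →
    Ψ (g, Ψ (g', p)) = Ψ (g * g', p)
  inv_mem : ∀ g p, (g, p) ∈ W → (g⁻¹, Ψ (g, p)) ∈ W
  inv_act : ∀ g p, (g, p) ∈ W → Ψ (g⁻¹, Ψ (g, p)) = p

/-- A (Lie point) symmetry group of Lamé's system: a local group of transformations each of which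
transforms solutions into solutions. -/
structure IsSymmetryGroup (M : Set Total) (W : Set (G × Total)) (Ψ : G × Total → Total) :
    Prop extends IsLocalAction I M W Ψ where
  mapsSolutions : ∀ g : G, MapsSolutions {p | (g, p) ∈ W} (fun p => Ψ (g, p))

/-- Connectedness of a local action: for every point `p`, the set of the group elements that are
defined at `p` is connected (it contains the identity as soon as `p ∈ M`). -/
def ConnectedDomains (M : Set Total) (W : Set (G × Total)) : Prop :=
  ∀ p ∈ M, IsConnected {g : G | (g, p) ∈ W}

end Action

/-- Translation in the independent variables: `x_i ↦ x_i + v_i`. -/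
def translate (v : Indep) (p : Total) : Total := (p.1 + v, p.2.1, p.2.2)

/-- Dilation in the independent variables: `x_i ↦ a x_i`. The auxiliary variables
`h_{ij} = l_{i,x_j} / l_j` are transformed accordingly. -/
def dilateIndep (a : ℝˣ) (p : Total) : Total :=
  ((a : ℝ) • p.1, p.2.1, (a : ℝ)⁻¹ • p.2.2)

/-- Dilation in the dependent variables: `l_i ↦ r l_i`. The auxiliary variables
`h_{ij} = l_{i,x_j} / l_j` do not change. -/
def dilateDep (r : ℝˣ) (p : Total) : Total := (p.1, (r : ℝ) • p.2.1, p.2.2)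

/-- The parameters `(v, a, r)` of the composite of a translation by `v`, a dilation by `a` in the
independent variables and a dilation by `r` in the dependent variables. -/
def Param : Type := Indep × ℝˣ × ℝˣ

namespace Param

/-- The translation vector. -/
def v (s : Param) : Indep := s.1

/-- The ratio of the dilation in the independent variables. -/
def a (s : Param) : ℝˣ := s.2.1

/-- The ratio of the dilation in the dependent variables. -/
def r (s : Param) : ℝˣ := s.2.2

/-- The transformation with given parameters. -/
def act (s : Param) (p : Total) : Total := translate s.v (dilateIndep s.a (dilateDep s.r p))

instance : TopologicalSpace Param := inferInstanceAs (TopologicalSpace (Indep × ℝˣ × ℝˣ))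

instance : ChartedSpace (ModelProd Indep (ModelProd ℝ ℝ)) Param :=
  inferInstanceAs (ChartedSpace (ModelProd Indep (ModelProd ℝ ℝ)) (Indep × ℝˣ × ℝˣ))

/-- The model with corners (without boundary) of the manifold `ℝ³ × ℝˣ × ℝˣ`. -/
abbrev model : ModelWithCorners ℝ (Indep × ℝ × ℝ) (ModelProd Indep (ModelProd ℝ ℝ)) :=
  𝓘(ℝ, Indep).prod (𝓘(ℝ, ℝ).prod 𝓘(ℝ, ℝ))

instance : Mul Param := ⟨fun s t => ((s.a : ℝ) • t.v + s.v, s.a * t.a, s.r * t.r)⟩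

instance : One Param := ⟨((0 : Indep), (1 : ℝˣ), (1 : ℝˣ))⟩

instance : Inv Param := ⟨fun s => (-(((s.a⁻¹ : ℝˣ) : ℝ) • s.v), s.a⁻¹, s.r⁻¹)⟩

@[simp] theorem mul_v (s t : Param) : (s * t).v = (s.a : ℝ) • t.v + s.v := rfl
@[simp] theorem mul_a (s t : Param) : (s * t).a = s.a * t.a := rfl
@[simp] theorem mul_r (s t : Param) : (s * t).r = s.r * t.r := rfl
@[simp] theorem one_v : (1 : Param).v = 0 := rfl
@[simp] theorem one_a : (1 : Param).a = 1 := rfl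
@[simp] theorem one_r : (1 : Param).r = 1 := rfl
@[simp] theorem inv_v (s : Param) : (s⁻¹).v = -(((s.a⁻¹ : ℝˣ) : ℝ) • s.v) := rfl
@[simp] theorem inv_a (s : Param) : (s⁻¹).a = s.a⁻¹ := rfl
@[simp] theorem inv_r (s : Param) : (s⁻¹).r = s.r⁻¹ := rfl

theorem ext' {s t : Param} (h₁ : s.v = t.v) (h₂ : s.a = t.a) (h₃ : s.r = t.r) : s = t :=
  Prod.ext h₁ (Prod.ext h₂ h₃)

/-- The group law is the composition of transformations (see `act_mul`). -/
instance : Group Param where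
  mul_assoc s t w := ext'
    (by simp [mul_smul, smul_add, add_assoc]) (by simp [mul_assoc]) (by simp [mul_assoc])
  one_mul s := ext' (by simp) (by simp) (by simp)
  mul_one s := ext' (by simp) (by simp) (by simp)
  inv_mul_cancel s := ext' (by simp) (by simp) (by simp)

/-- The parameters form a Lie group. -/
instance : LieGroup model ∞ Param := by
  have hM : IsManifold model ∞ Param :=
    inferInstanceAs (IsManifold model ∞ (Indep × ℝˣ × ℝˣ))
  have hv : ContMDiff model 𝓘(ℝ, Indep) ∞ v :=
    (contMDiff_fst : ContMDiff model 𝓘(ℝ, Indep) ∞ (Prod.fst : Indep × ℝˣ × ℝˣ → Indep))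
  have hs : ContMDiff model (𝓘(ℝ, ℝ).prod 𝓘(ℝ, ℝ)) ∞ (fun s : Param => (s.a, s.r)) :=
    (contMDiff_snd : ContMDiff model (𝓘(ℝ, ℝ).prod 𝓘(ℝ, ℝ)) ∞
      (Prod.snd : Indep × ℝˣ × ℝˣ → ℝˣ × ℝˣ))
  have ha : ContMDiff model 𝓘(ℝ, ℝ) ∞ a := contMDiff_fst.comp hs
  have hr : ContMDiff model 𝓘(ℝ, ℝ) ∞ r := contMDiff_snd.comp hs
  have hval : ContMDiff 𝓘(ℝ, ℝ) 𝓘(ℝ, ℝ) ∞ (Units.val : ℝˣ → ℝ) := Units.contMDiff_val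
  refine { hM with contMDiff_mul := ?_, contMDiff_inv := ?_ }
  · have h : ContMDiff (model.prod model) model ∞
        (fun p : Param × Param => (((p.1.a : ℝ) • p.2.v + p.1.v, p.1.a * p.2.a, p.1.r * p.2.r) :
          Indep × ℝˣ × ℝˣ)) :=
      (((hval.comp (ha.comp contMDiff_fst)).smul (hv.comp contMDiff_snd)).add
        (hv.comp contMDiff_fst)).prodMk
      (((ha.comp contMDiff_fst).mul (ha.comp contMDiff_snd)).prodMk
        ((hr.comp contMDiff_fst).mul (hr.comp contMDiff_snd)))
    exact h
  · have h : ContMDiff model model ∞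
        (fun s : Param => ((-(((s.a⁻¹ : ℝˣ) : ℝ) • s.v), s.a⁻¹, s.r⁻¹) : Indep × ℝˣ × ℝˣ)) :=
      (((hval.comp ha.inv).smul hv).neg).prodMk (ha.inv.prodMk hr.inv)
    exact h

theorem act_one (p : Total) : act 1 p = p := by
  simp [act, translate, dilateIndep, dilateDep]

theorem act_mul (s t : Param) (p : Total) : act (s * t) p = act s (act t p) := by
  simp only [act, translate, dilateIndep, dilateDep, mul_v, mul_a, mul_r, Units.val_mul]
  refine Prod.ext ?_ (Prod.ext ?_ ?_)
  · simp [mul_smul, smul_add, add_assoc]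
  · simp [mul_smul]
  · simp [mul_smul, mul_comm]

end Param

end Lame

end

/-!
The indices `1, 2, 3` are written `0, 1, 2`, and `L` stands for the Guichard cone
`∑ ε_i l_i² = 0`, `l_i ≠ 0`.

Translations and dilations map solutions to solutions by the chain rule
(`isSymmetryGroup_param`). The converse is Lie's method: the infinitesimal symmetries are
determined, and the result is integrated along the group. Three points need care.

*There are enough solutions.* The system leaves six of the eighteen first derivatives of `h` free;
the linearized equations can be split into coefficients only if these six can be prescribed at a
point. Instead of prescribing them, the proof uses an explicit family of solutions. If `h` is
required to be invariant under translations in a direction `c` off finitely many cones, all first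
derivatives become quadratic polynomials in `(l, h)` and the resulting total system is integrable.
It has a solution through every point over `L` (`exists_isSolution`), by Frobenius' theorem, which
for commuting quadratic vector fields is a consequence of the implicit function theorem
(`exists_solution_of_commuting_quadratic`). For generic `h` the constant `1` and the six free
derivatives, as functions of `c`, are linearly independent (`coeff_eq_zero_of_forall_admissible`),
and this family may take the place of all solutions.

*The determining equations.* If all members of a one-parameter family of transformations through the
identity map solutions to solutions, the prolonged generator satisfies the linearized system at the
1-jet of every solution (`linFirstOrder_generator`). Write the generator, restricted to `L`, as
`∑ ξ_n ∂/∂x_n + ∑ η_i ∂/∂l_i + ∑ ζ_{ij} ∂/∂h_{ij}`. The equations for `l` show that `ξ` and `η` do not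
depend on `h` (`Determining.xi_eh`, `Determining.eta_eh_zero`); the equations
`h_{ij,x_k} = h_{ik} h_{kj}` show that `ξ_i` depends on `x_i` only (`Determining.fderiv_xi`) and
that `ζ_{ij} = c_{ij} h_{ij}` with a linear relation between the `c_{ij}` and `∂ξ_k/∂x_k`
(`Determining.coeff_relation`); the remaining two equations for `h` show that `∂ξ_i/∂x_i` is a common
constant `g` and `c_{ij} = -g`; finally `η` is a constant multiple of `l`. Hence
`ξ = g x + v`, `η = ρ l`, `ζ = -g h` on `L` (`Determining.exists_eq`).

*Integration.* A path in the group and a curve in the flow of the corresponding time-dependent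
combination of these generators compensate each other (`hasDerivAt_inv_act`), so that group
elements near the identity act near a point over `L` by translations and dilations
(`exists_local_act`). For fixed `p` over `L`, the set of all `g` that act near `p` in this way is
open and closed in the connected set of all `g` that are defined at `p` (`actsByParam`). For
closedness it has to be excluded that a limit leaves `L`, that is, that the ratio `r` of the dilation
of `l` tends to zero; but `r` is, up to the factor `l`, the derivative of the transformation in the
direction of the dilation, and the limit transformation has an invertible derivative
(`mem_guichardSet_of_frequently`). Since the parameters of a translation and two dilations can be
read off on any open piece of `L` (`act_inj`), they are locally constant on `S`.
-/

noncomputable section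

namespace Lame

open Filter Topology

/-! ### Commuting quadratic vector fields -/

section Quadratic

variable {V : Type*} [NormedAddCommGroup V] [NormedSpace ℝ V]

/-- The Volterra operator `y ↦ (s ↦ ∫₀ˢ y)` on continuous functions on the unit interval. -/
def volterra (V : Type*) [NormedAddCommGroup V] [NormedSpace ℝ V] :
    C(unitInterval, V) →L[ℝ] C(unitInterval, V) :=
  LinearMap.mkContinuous
    { toFun := fun y => ⟨fun s => ∫ τ in (0 : ℝ)..s, y (projIcc 0 1 zero_le_one τ), by
        have h : Continuous fun τ : ℝ => y (projIcc 0 1 zero_le_one τ) := by fun_prop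
        exact (intervalIntegral.continuous_primitive
          (fun a b => h.intervalIntegrable a b) 0).comp continuous_subtype_val⟩
      map_add' := fun y z => by
        ext s
        have h (w : C(unitInterval, V)) :
            Continuous fun τ : ℝ => w (projIcc 0 1 zero_le_one τ) := by fun_prop
        exact intervalIntegral.integral_add ((h y).intervalIntegrable _ _)
          ((h z).intervalIntegrable _ _)
      map_smul' := fun c y => by
        ext s
        exact intervalIntegral.integral_smul c _ } 1 (fun y => by
      rw [one_mul, ContinuousMap.norm_le _ (norm_nonneg _)]
      intro s
      refine (intervalIntegral.norm_integral_le_of_norm_le_const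
        (C := ‖y‖) fun τ _ => y.norm_coe_le_norm _).trans ?_
      rw [sub_zero, abs_of_nonneg s.2.1]
      exact mul_le_of_le_one_right (norm_nonneg _) s.2.2)

theorem volterra_apply (y : C(unitInterval, V)) (s : unitInterval) :
    volterra V y s = ∫ τ in (0 : ℝ)..s, y (projIcc 0 1 zero_le_one τ) := rfl

/-- The pointwise extension of a bilinear map to continuous functions on the unit interval. -/
def pointwise (b : V →L[ℝ] V →L[ℝ] V) :
    C(unitInterval, V) →L[ℝ] C(unitInterval, V) →L[ℝ] C(unitInterval, V) :=
  LinearMap.mkContinuous₂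
    (LinearMap.mk₂ ℝ (fun y z => (⟨fun s => b (y s) (z s), by fun_prop⟩ : C(unitInterval, V)))
      (fun _ _ _ => by ext; simp) (fun _ _ _ => by ext; simp)
      (fun _ _ _ => by ext; simp) (fun _ _ _ => by ext; simp)) ‖b‖ (fun y z => by
      rw [ContinuousMap.norm_le _ (by positivity)]
      intro s
      refine (b.le_opNorm₂ _ _).trans ?_
      gcongr
      · exact y.norm_coe_le_norm s
      · exact z.norm_coe_le_norm s)

theorem pointwise_apply (b : V →L[ℝ] V →L[ℝ] V) (y z : C(unitInterval, V)) (s : unitInterval) :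
    pointwise b y z s = b (y s) (z s) := rfl

variable {ι : Type*} [Fintype ι]

/-- A solution `φ` of `φ(s) = y₀ + ∫₀ˢ Σ xⱼ Qⱼ(φ)` satisfies, when the fields `Qⱼ(y) = bⱼ(y, y)`
commute, the variational equation with `v(s) = s Q_i(φ(s))` as variation: this is the derivative
of the solution with respect to the parameter `x_i`. -/
theorem variation_eq [CompleteSpace V] (b : ι → V →L[ℝ] V →L[ℝ] V)
    (hb : ∀ i j y, b i (b j y y) y + b i y (b j y y) = b j (b i y y) y + b j y (b i y y))
    (y₀ : V) (x : ι → ℝ) (φ S : C(unitInterval, V))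
    (hS : ∀ s, S s = ∑ j, x j • b j (φ s) (φ s))
    (hφ : φ = ContinuousMap.const _ y₀ + volterra V S) (i : ι) (v T : C(unitInterval, V))
    (hv : ∀ s : unitInterval, v s = (s : ℝ) • b i (φ s) (φ s))
    (hT : ∀ s : unitInterval, T s = b i (φ s) (φ s)
      + ∑ j, x j • (b j (v s) (φ s) + b j (φ s) (v s))) :
    v = volterra V T := by
  set f : ℝ → V := fun t => y₀ + ∫ τ in (0 : ℝ)..t, S (projIcc 0 1 zero_le_one τ) with hf
  have hfφ : ∀ s : unitInterval, f s = φ s := fun s => by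
    conv_rhs => rw [hφ]
    simp [hf, volterra_apply]
  have hfd : ∀ t ∈ Icc (0 : ℝ) 1, HasDerivAt f (∑ j, x j • b j (f t) (f t)) t := by
    intro t ht
    have hc : Continuous fun τ : ℝ => S (projIcc 0 1 zero_le_one τ) := by fun_prop
    have h := (intervalIntegral.integral_hasDerivAt_right (hc.intervalIntegrable 0 t)
      hc.aestronglyMeasurable.stronglyMeasurableAtFilter hc.continuousAt).const_add y₀
    convert h using 1
    rw [projIcc_of_mem zero_le_one ht, hS, ← hfφ ⟨t, ht⟩]
  ext s
  rw [volterra_apply, hv, ← hfφ]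
  have key : ∀ t ∈ uIcc (0 : ℝ) s, HasDerivAt (fun t => t • b i (f t) (f t))
      (T (projIcc 0 1 zero_le_one t)) t := by
    intro t ht
    rw [uIcc_of_le s.2.1] at ht
    have ht' : t ∈ Icc (0 : ℝ) 1 := ⟨ht.1, ht.2.trans s.2.2⟩
    have hd := hfd t ht'
    have h2 := (((b i).hasFDerivAt.comp_hasDerivAt t hd)).clm_apply hd
    have h3 := (hasDerivAt_id t).smul h2
    refine HasDerivAt.congr_deriv (f := fun t => t • b i (f t) (f t)) h3 ?_
    rw [projIcc_of_mem zero_le_one ht', hT, hv, ← hfφ ⟨t, ht'⟩]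
    simp only [Function.comp_apply, id, one_smul, map_sum, map_smul, sum_apply, smul_apply]
    rw [add_comm, ← Finset.sum_add_distrib, Finset.smul_sum]
    congr 1
    refine Finset.sum_congr rfl fun j _ => ?_
    have hij := hb i j (f t)
    simp only [← smul_add, smul_comm t (x j)]
    rw [← hij]
  rw [intervalIntegral.integral_eq_sub_of_hasDerivAt key]
  · simp
  · exact Continuous.intervalIntegrable (by fun_prop) _ _

/-- The fixed points of `y ↦ κ + Σ x_j G_j(y, y)` near `κ` depend analytically on the small
parameter `x`, and their partial derivatives are the only solutions of the differentiated
equation. -/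
theorem exists_analytic_fixedPoint {X : Type*} [NormedAddCommGroup X] [NormedSpace ℝ X]
    [CompleteSpace X] [DecidableEq ι] (G : ι → X →L[ℝ] X →L[ℝ] X) (κ : X) :
    ∃ φ : (ι → ℝ) → X, ContDiffAt ℝ ω φ 0 ∧ φ 0 = κ ∧ ∀ᶠ x in 𝓝 (0 : ι → ℝ),
      ContDiffAt ℝ ω φ x ∧ φ x = κ + ∑ j, x j • G j (φ x) (φ x) ∧
      ∀ i v, v = G i (φ x) (φ x) + ∑ j, x j • (G j v (φ x) + G j (φ x) v) →
        fderiv ℝ φ x (Pi.single i 1) = v := by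
  set F : (ι → ℝ) × X → X := fun p => p.2 - κ - ∑ j, p.1 j • G j p.2 p.2 with hF
  have hFd : ContDiff ℝ ω F := by
    refine (contDiff_snd.sub contDiff_const).sub (ContDiff.sum fun j _ => ?_)
    refine ContDiff.smul ?_ ?_
    · exact ((ContinuousLinearMap.proj (R := ℝ) (φ := fun _ : ι => ℝ) j).contDiff).comp
        contDiff_fst
    · exact ((G j).contDiff.comp contDiff_snd).clm_apply contDiff_snd
  have hF' : fderiv ℝ F (0, κ) ∘L .inr ℝ (ι → ℝ) X = ContinuousLinearMap.id ℝ X := by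
    have h1 : HasFDerivAt (fun y : X => F (0, y))
        (fderiv ℝ F (0, κ) ∘L .inr ℝ (ι → ℝ) X) κ :=
      HasFDerivAt.comp (g := F) κ
        (hFd.differentiable (by simp)).differentiableAt.hasFDerivAt
        (hasFDerivAt_prodMk_right (0 : ι → ℝ) κ)
    have h2 : (fun y : X => F (0, y)) = fun y => y - κ := by
      ext1 y; simp [hF]
    rw [h2] at h1
    exact h1.unique ((hasFDerivAt_id κ).sub_const κ)
  have hinv : (fderiv ℝ F (0, κ) ∘L .inr ℝ (ι → ℝ) X).IsInvertible := by
    rw [hF']; exact ⟨ContinuousLinearEquiv.refl ℝ X, rfl⟩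
  have hFat : ContDiffAt ℝ ω F (0, κ) := hFd.contDiffAt
  set φ := hFat.implicitFunction (by simp) hinv with hφdef
  have hφ0 : φ 0 = κ := hFat.implicitFunction_apply_self (by simp) hinv
  have hφd : ContDiffAt ℝ ω φ 0 := hFat.contDiffAt_implicitFunction (by simp) hinv
  have hφeq : ∀ᶠ x in 𝓝 (0 : ι → ℝ), φ x = κ + ∑ j, x j • G j (φ x) (φ x) := by
    filter_upwards [hFat.eventually_apply_implicitFunction (by simp) hinv] with x hx
    have h0 : F (0, κ) = 0 := by simp [hF]
    rw [h0] at hx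
    have : φ x - κ - ∑ j, x j • G j (φ x) (φ x) = 0 := hx
    rw [sub_sub, sub_eq_zero] at this
    exact this
  have hφD : ∀ᶠ x in 𝓝 (0 : ι → ℝ), ContDiffAt ℝ ω φ x :=
    hφd.eventually (by simp)
  -- the differentiated equation has at most one solution when `x` is small
  have hsmall : ∀ᶠ x in 𝓝 (0 : ι → ℝ), ∑ j, |x j| * (2 * ‖G j‖ * ‖φ x‖) < 1 := by
    have hc : ContinuousAt (fun x : ι → ℝ => ∑ j, |x j| * (2 * ‖G j‖ * ‖φ x‖)) 0 := by
      refine tendsto_finsetSum _ fun j _ => ?_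
      refine Tendsto.mul ?_ (hφd.continuousAt.norm.const_mul _)
      exact (continuous_abs.comp (continuous_apply j)).continuousAt
    refine hc.eventually (gt_mem_nhds ?_)
    simp
  refine ⟨φ, hφd, hφ0, ?_⟩
  filter_upwards [hφeq.eventually_nhds, hφD, hsmall] with x hx hxD hxs
  refine ⟨hxD, hx.self_of_nhds, fun i v h5 => ?_⟩
  have hd : HasFDerivAt φ (fderiv ℝ φ x) x := (hxD.differentiableAt (by simp)).hasFDerivAt
  have h1 : HasFDerivAt (fun x : ι → ℝ => κ + ∑ j, x j • G j (φ x) (φ x))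
      (∑ j, (x j • ((G j (φ x)).comp (fderiv ℝ φ x)
        + ((G j).flip (φ x)).comp (fderiv ℝ φ x))
        + (ContinuousLinearMap.proj (R := ℝ) (φ := fun _ : ι => ℝ) j).smulRight
            (G j (φ x) (φ x)))) x := by
    refine HasFDerivAt.const_add _ (HasFDerivAt.fun_sum fun j _ => ?_)
    have h2 : HasFDerivAt (fun x => G j (φ x) (φ x)) ((G j (φ x)).comp (fderiv ℝ φ x)
        + ((G j).flip (φ x)).comp (fderiv ℝ φ x)) x :=
      HasFDerivAt.clm_apply (c := fun x => G j (φ x)) ((G j).hasFDerivAt.comp x hd) hd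
    exact ((ContinuousLinearMap.proj (R := ℝ) (φ := fun _ : ι => ℝ) j).hasFDerivAt).smul h2
  have h3 := hd.unique (h1.congr_of_eventuallyEq hx)
  set w := fderiv ℝ φ x (Pi.single i 1) with hw
  have h4 : w = G i (φ x) (φ x) + ∑ j, x j • (G j w (φ x) + G j (φ x) w) := by
    conv_lhs => rw [hw, h3]
    simp only [sum_apply, add_apply, smul_apply, ContinuousLinearMap.comp_apply,
      ContinuousLinearMap.flip_apply, ContinuousLinearMap.smulRight_apply,
      ContinuousLinearMap.proj_apply, ← hw, Finset.sum_add_distrib]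
    rw [add_comm]
    congr 1
    · rw [Finset.sum_eq_single i] <;> simp +contextual
    · exact Finset.sum_congr rfl fun j _ => by rw [add_comm]
  have h6 : w - v = ∑ j, x j • (G j (w - v) (φ x) + G j (φ x) (w - v)) := by
    conv_lhs => rw [h4, h5]
    rw [add_sub_add_left_eq_sub, ← Finset.sum_sub_distrib]
    refine Finset.sum_congr rfl fun j _ => ?_
    simp only [map_sub, sub_apply, ← smul_sub]
    congr 1; abel
  have h7 : ‖w - v‖ ≤ (∑ j, |x j| * (2 * ‖G j‖ * ‖φ x‖)) * ‖w - v‖ := by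
    conv_lhs => rw [h6]
    refine (norm_sum_le _ _).trans ?_
    rw [Finset.sum_mul]
    refine Finset.sum_le_sum fun j _ => ?_
    rw [norm_smul, Real.norm_eq_abs, mul_assoc]
    gcongr
    refine (norm_add_le _ _).trans ?_
    have e1 := (G j).le_opNorm₂ (w - v) (φ x)
    have e2 := (G j).le_opNorm₂ (φ x) (w - v)
    calc _ ≤ _ := add_le_add e1 e2
      _ = _ := by ring
  have h8 : ‖w - v‖ = 0 := by nlinarith [norm_nonneg (w - v)]
  exact sub_eq_zero.1 (norm_eq_zero.1 h8)

/-- Frobenius' theorem for quadratic vector fields `Q_i(y) = b_i(y, y)` that commute pairwise: the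
system `∂u/∂x_i = Q_i(u)` has an analytic solution near the origin with prescribed initial value.
The solution is `u(x) = φ_x(1)`, where `φ_x` solves the integral equation
`φ(s) = y₀ + ∫₀ˢ Σ x_i Q_i(φ)`; it depends analytically on `x` by the implicit function theorem in
the space of continuous functions. -/
theorem exists_solution_of_commuting_quadratic [CompleteSpace V] (b : ι → V →L[ℝ] V →L[ℝ] V)
    (hb : ∀ i j y, b i (b j y y) y + b i y (b j y y) = b j (b i y y) y + b j y (b i y y))
    (y₀ : V) [DecidableEq ι] :
    ∃ u : (ι → ℝ) → V, ContDiffAt ℝ ω u 0 ∧ u 0 = y₀ ∧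
      ∀ᶠ x in 𝓝 (0 : ι → ℝ), ∀ i, fderiv ℝ u x (Pi.single i 1) = b i (u x) (u x) := by
  obtain ⟨φ, hφd, hφ0, hφ⟩ := exists_analytic_fixedPoint (ι := ι)
    (fun j => (ContinuousLinearMap.compL ℝ _ _ _ (volterra V)).comp (pointwise (b j)))
    (ContinuousMap.const _ y₀)
  have hev (y : C(unitInterval, V)) :
      ContinuousMap.evalCLM ℝ (1 : unitInterval) y = y 1 := rfl
  set ev : C(unitInterval, V) →L[ℝ] V := ContinuousMap.evalCLM ℝ (1 : unitInterval)
  refine ⟨fun x => ev (φ x), ev.contDiff.contDiffAt.comp _ hφd, by simp [hφ0, hev], ?_⟩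
  filter_upwards [hφ] with x ⟨hxD, hxφ, hxu⟩ i
  have h1 : HasFDerivAt (fun x => ev (φ x)) (ev.comp (fderiv ℝ φ x)) x :=
    ev.hasFDerivAt.comp x (hxD.differentiableAt (by simp)).hasFDerivAt
  have h2 := hxu i ⟨fun s => (s : ℝ) • b i (φ x s) (φ x s), by fun_prop⟩ (by
    have h := variation_eq b hb y₀ x (φ x) (∑ j, x j • pointwise (b j) (φ x) (φ x))
      (fun s => by simp [pointwise_apply])
      (by rw [map_sum]; simp only [map_smul]; exact hxφ) i
      ⟨fun s => (s : ℝ) • b i (φ x s) (φ x s), by fun_prop⟩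
      (pointwise (b i) (φ x) (φ x) + ∑ j, x j •
        (pointwise (b j) ⟨fun s => (s : ℝ) • b i (φ x s) (φ x s), by fun_prop⟩ (φ x)
        + pointwise (b j) (φ x) ⟨fun s => (s : ℝ) • b i (φ x s) (φ x s), by fun_prop⟩))
      (fun s => rfl) (fun s => by simp [pointwise_apply])
    rw [map_add, map_sum] at h
    simp only [map_smul, map_add] at h
    exact h)
  rw [h1.fderiv, ContinuousLinearMap.comp_apply, h2, hev, hev]
  simp

end Quadratic

/-! ### Solutions for which `h` is invariant under a translation -/

/-- The entry `h_{ij}` of the matrix `h`, with zeros on the diagonal. -/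
def hh (h : OffDiag → ℝ) (i j : Fin 3) : ℝ := if hij : i ≠ j then h ⟨(i, j), hij⟩ else 0

theorem hh_of_ne (h : OffDiag → ℝ) {i j : Fin 3} (hij : i ≠ j) : hh h i j = h ⟨(i, j), hij⟩ :=
  dif_pos hij

@[simp] theorem hh_self (h : OffDiag → ℝ) (i : Fin 3) : hh h i i = 0 := by simp [hh]

theorem hh_add (h h' : OffDiag → ℝ) (i j : Fin 3) : hh (h + h') i j = hh h i j + hh h' i j := by
  by_cases hij : i = j <;> simp [hh, hij]

theorem hh_smul (a : ℝ) (h : OffDiag → ℝ) (i j : Fin 3) : hh (a • h) i j = a * hh h i j := by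
  by_cases hij : i = j <;> simp [hh, hij]

/-- The index different from two distinct indices in `{0, 1, 2}`. -/
def third (i j : Fin 3) : Fin 3 := -(i + j)

theorem third_eq {i j k : Fin 3} (hij : i ≠ j) (hjk : j ≠ k) (hik : i ≠ k) : third i j = k := by
  revert i j k; decide

/-- The derivative `l_{i,x_n}` that the system prescribes in terms of `l` and `h`. -/
def dl (l : Fin 3 → ℝ) (h : OffDiag → ℝ) (i n : Fin 3) : ℝ :=
  if i = n then -(eps i * ∑ m, eps m * hh h m i * l m) else hh h i n * l n

/-- The derivative `h_{ij,x_i}` of a solution whose component `h` is invariant under translations in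
the direction of `c`, as a quadratic form in `h`, written as a bilinear form; `k` is the third index. -/
def dhRow (c : Fin 3 → ℝ) (h h' : OffDiag → ℝ) (i j k : Fin 3) : ℝ :=
  (-(c i * c k * (hh h i k * hh h' k j)) - c j * c k * (hh h j k * hh h' k i)
    + c i * c j * (hh h i k * hh h' j k) + eps j * eps k * c j ^ 2 * (hh h k i * hh h' k j))
    / (c i ^ 2 - eps i * eps j * c j ^ 2)

/-- The derivative `h_{ij,x_j}` of a solution whose component `h` is invariant under translations in
the direction of `c`, as a quadratic form in `h`, written as a bilinear form; `k` is the third index. -/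
def dhCol (c : Fin 3 → ℝ) (h h' : OffDiag → ℝ) (i j k : Fin 3) : ℝ :=
  (c i * c k * (hh h j k * hh h' k i) + eps i * eps j * c j * c k * (hh h i k * hh h' k j)
    - c i ^ 2 * (hh h i k * hh h' j k) - eps j * eps k * c i * c j * (hh h k i * hh h' k j))
    / (c i ^ 2 - eps i * eps j * c j ^ 2)

/-- The derivative `h_{ij,x_n}` of a solution whose component `h` is invariant under translations in
the direction of `c`, as a bilinear form in `h`. -/
def dhForm (c : Fin 3 → ℝ) (n : Fin 3) (h h' : OffDiag → ℝ) (q : OffDiag) : ℝ :=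
  if n = q.1.1 then dhRow c h h' q.1.1 q.1.2 (third q.1.1 q.1.2)
  else if n = q.1.2 then dhCol c h h' q.1.1 q.1.2 (third q.1.1 q.1.2)
  else hh h q.1.1 n * hh h' n q.1.2

/-- The directions `c` for which the derivatives of a solution are determined by its values if `h` is
invariant under translations in the direction of `c`. -/
def Admissible (c : Fin 3 → ℝ) : Prop :=
  ∀ i j : Fin 3, i ≠ j → c i ^ 2 - eps i * eps j * c j ^ 2 ≠ 0

/-- The bilinear map whose quadratic form is the right-hand side of the total system
`u_{,x_n} = Q_n(u)` for solutions whose component `h` is invariant in the direction of `c`. -/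
def totalForm (c : Fin 3 → ℝ) (n : Fin 3) : Dep →ₗ[ℝ] Dep →ₗ[ℝ] Dep :=
  LinearMap.mk₂ ℝ (fun y z => (fun i => dl z.1 y.2 i n, dhForm c n y.2 z.2))
    (fun y y' z => by
      ext i
      · simp only [dl, hh_add, Prod.snd_add, Prod.fst_add, Pi.add_apply, Fin.sum_univ_three]
        split_ifs <;> ring
      · simp only [dhForm, dhRow, dhCol, hh_add, Prod.snd_add, Pi.add_apply]
        split_ifs <;> ring)
    (fun a y z => by
      ext i
      · simp only [dl, hh_smul, Prod.smul_snd, Prod.smul_fst, Pi.smul_apply, smul_eq_mul,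
          Fin.sum_univ_three]
        split_ifs <;> ring
      · simp only [dhForm, dhRow, dhCol, hh_smul, Prod.smul_snd, Pi.smul_apply, smul_eq_mul]
        split_ifs <;> ring)
    (fun y z z' => by
      ext i
      · simp only [dl, Prod.fst_add, Pi.add_apply, Fin.sum_univ_three]
        split_ifs <;> ring
      · simp only [dhForm, dhRow, dhCol, hh_add, Prod.snd_add, Pi.add_apply]
        split_ifs <;> ring)
    (fun a y z => by
      ext i
      · simp only [dl, Prod.smul_fst, Pi.smul_apply, smul_eq_mul, Fin.sum_univ_three]
        split_ifs <;> ring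
      · simp only [dhForm, dhRow, dhCol, hh_smul, Prod.smul_snd, Pi.smul_apply, smul_eq_mul]
        split_ifs <;> ring)

theorem totalForm_apply (c : Fin 3 → ℝ) (n : Fin 3) (y z : Dep) :
    totalForm c n y z = (fun i => dl z.1 y.2 i n, dhForm c n y.2 z.2) := rfl

theorem hh_dhForm (c : Fin 3 → ℝ) (n : Fin 3) (h h' : OffDiag → ℝ) {i j : Fin 3} (hij : i ≠ j) :
    hh (dhForm c n h h') i j =
      if n = i then dhRow c h h' i j (third i j)
      else if n = j then dhCol c h h' i j (third i j)
      else hh h i n * hh h' n j := by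
  rw [hh_of_ne _ hij]; rfl

theorem eps_zero : eps 0 = 1 := by simp [eps]
theorem eps_one : eps 1 = -1 := by simp [eps]
theorem eps_two : eps 2 = 1 := by simp [eps]

theorem totalForm_comm_h {c : Fin 3 → ℝ} (hc : Admissible c) (n m : Fin 3) (h : OffDiag → ℝ)
    (i j : Fin 3) (hij : i ≠ j) (hnm : n < m) :
    hh (dhForm c n (dhForm c m h h) h) i j + hh (dhForm c n h (dhForm c m h h)) i j =
    hh (dhForm c m (dhForm c n h h) h) i j + hh (dhForm c m h (dhForm c n h h)) i j := by
  have h01 := hc 0 1 (by decide)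
  have h10 := hc 1 0 (by decide)
  have h02 := hc 0 2 (by decide)
  have h20 := hc 2 0 (by decide)
  have h12 := hc 1 2 (by decide)
  have h21 := hc 2 1 (by decide)
  simp only [eps_zero, eps_one, eps_two, mul_one, one_mul, mul_neg, neg_mul,
    sub_neg_eq_add] at h01 h10 h02 h20 h12 h21
  have e01 : third 0 1 = 2 := rfl
  have e10 : third 1 0 = 2 := rfl
  have e02 : third 0 2 = 1 := rfl
  have e20 : third 2 0 = 1 := rfl
  have e12 : third 1 2 = 0 := rfl
  have e21 : third 2 1 = 0 := rfl
  rw [hh_dhForm _ _ _ _ hij, hh_dhForm _ _ _ _ hij, hh_dhForm _ _ _ _ hij,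
    hh_dhForm _ _ _ _ hij]
  fin_cases i <;> fin_cases j <;> (first | exact absurd rfl hij | skip) <;>
  fin_cases n <;> fin_cases m <;> (first | exact absurd hnm (by decide) | skip) <;>
  simp [dhRow, dhCol, hh_dhForm, e01, e10, e02, e20, e12, e21, eps_zero, eps_one, eps_two] <;>
  field_simp <;> ring

theorem totalForm_comm_l (c : Fin 3 → ℝ) (n m : Fin 3) (l : Fin 3 → ℝ) (h : OffDiag → ℝ)
    (hc : Admissible c) (i : Fin 3) (hnm : n < m) :
    dl l (dhForm c m h h) i n + dl (fun i => dl l h i m) h i n =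
    dl l (dhForm c n h h) i m + dl (fun i => dl l h i n) h i m := by
  have h01 := hc 0 1 (by decide)
  have h10 := hc 1 0 (by decide)
  have h02 := hc 0 2 (by decide)
  have h20 := hc 2 0 (by decide)
  have h12 := hc 1 2 (by decide)
  have h21 := hc 2 1 (by decide)
  simp only [eps_zero, eps_one, eps_two, mul_one, one_mul, mul_neg, neg_mul,
    sub_neg_eq_add] at h01 h10 h02 h20 h12 h21
  have e01 : third 0 1 = 2 := rfl
  have e10 : third 1 0 = 2 := rfl
  have e02 : third 0 2 = 1 := rfl
  have e20 : third 2 0 = 1 := rfl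
  have e12 : third 1 2 = 0 := rfl
  have e21 : third 2 1 = 0 := rfl
  fin_cases i <;>
  fin_cases n <;> fin_cases m <;> (first | exact absurd hnm (by decide) | skip) <;>
  simp [dl, Fin.sum_univ_three, dhRow, hh_dhForm, e01, e10, e02, e20, e12, e21, eps_zero,
    eps_one, eps_two] <;>
  field_simp <;> ring

theorem totalForm_comm {c : Fin 3 → ℝ} (hc : Admissible c) (n m : Fin 3) (y : Dep) :
    totalForm c n (totalForm c m y y) y + totalForm c n y (totalForm c m y y) =
    totalForm c m (totalForm c n y y) y + totalForm c m y (totalForm c n y y) := by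
  have key : ∀ n m : Fin 3, n < m →
      totalForm c n (totalForm c m y y) y + totalForm c n y (totalForm c m y y) =
      totalForm c m (totalForm c n y y) y + totalForm c m y (totalForm c n y y) := by
    intro n m hnm
    ext q
    · exact totalForm_comm_l c n m y.1 y.2 hc q hnm
    · obtain ⟨⟨i, j⟩, hij⟩ := q
      have := totalForm_comm_h hc n m y.2 i j hij hnm
      rw [hh_of_ne _ hij, hh_of_ne _ hij, hh_of_ne _ hij, hh_of_ne _ hij] at this
      exact this
  rcases lt_trichotomy n m with h | rfl | h
  · exact key n m h
  · rfl
  · exact (key m n h).symm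

/-- The differential equations of the system as conditions on the value `y = u(x)` and the partial
derivatives `J n = ∂u/∂x_n` of `u` at a point. -/
structure FirstOrder (y : Dep) (J : Fin 3 → Dep) : Prop where
  l_off : ∀ i j : Fin 3, i ≠ j → (J j).1 i - hh y.2 i j * y.1 j = 0
  l_diag : ∀ i j k : Fin 3, i ≠ j → j ≠ k → i ≠ k →
    eps i * (J i).1 i + eps j * hh y.2 j i * y.1 j + eps k * hh y.2 k i * y.1 k = 0
  h_off : ∀ i j k : Fin 3, i ≠ j → j ≠ k → i ≠ k →
    hh (J k).2 i j - hh y.2 i k * hh y.2 k j = 0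
  h_sum : ∀ i j k : Fin 3, i ≠ j → j ≠ k → i ≠ k →
    hh (J j).2 i j + hh (J i).2 j i + hh y.2 i k * hh y.2 j k = 0
  h_eps : ∀ i j k : Fin 3, i ≠ j → j ≠ k → i ≠ k →
    eps i * hh (J i).2 i j + eps j * hh (J j).2 j i + eps k * hh y.2 k i * hh y.2 k j = 0

theorem pd_lfun {u : Indep → Dep} {x : Indep} (hu : DifferentiableAt ℝ u x) (n i : Fin 3) :
    pd n (lfun u i) x = (fderiv ℝ u x (Pi.single n 1)).1 i := by
  have h := (((ContinuousLinearMap.proj (R := ℝ) (φ := fun _ : Fin 3 => ℝ) i).comp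
    (ContinuousLinearMap.fst ℝ (Fin 3 → ℝ) (OffDiag → ℝ))).hasFDerivAt.comp x hu.hasFDerivAt)
  exact congrArg (fun L : Indep →L[ℝ] ℝ => L (Pi.single n 1)) h.fderiv

theorem pd_hfun {u : Indep → Dep} {x : Indep} (hu : DifferentiableAt ℝ u x) (n : Fin 3)
    {i j : Fin 3} (hij : i ≠ j) :
    pd n (hfun u i j hij) x = hh (fderiv ℝ u x (Pi.single n 1)).2 i j := by
  have h := (((ContinuousLinearMap.proj (R := ℝ) (φ := fun _ : OffDiag => ℝ) ⟨(i, j), hij⟩).comp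
    (ContinuousLinearMap.snd ℝ (Fin 3 → ℝ) (OffDiag → ℝ))).hasFDerivAt.comp x hu.hasFDerivAt)
  rw [hh_of_ne _ hij]
  exact congrArg (fun L : Indep →L[ℝ] ℝ => L (Pi.single n 1)) h.fderiv

theorem isSolution_iff {Ω : Set Indep} {u : Indep → Dep} :
    IsSolution Ω u ↔ IsOpen Ω ∧ ContDiffOn ℝ ∞ u Ω ∧ ∀ x ∈ Ω, (∀ i, (u x).1 i ≠ 0) ∧
      ∑ i, eps i * (u x).1 i ^ 2 = 0 ∧
      FirstOrder (u x) fun n => fderiv ℝ u x (Pi.single n 1) := by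
  have hh' (x : Indep) {i j : Fin 3} (hij : i ≠ j) : hfun u i j hij x = hh (u x).2 i j :=
    (hh_of_ne _ hij).symm
  constructor
  · intro hu
    refine ⟨hu.isOpen, hu.smooth, fun x hx => ⟨hu.ne_zero x hx, hu.guichard x hx, ?_⟩⟩
    have hd : DifferentiableAt ℝ u x :=
      (hu.smooth.contDiffAt (hu.isOpen.mem_nhds hx)).differentiableAt (by simp)
    constructor
    · intro i j hij
      rw [← pd_lfun hd, ← hh' x hij]; exact hu.l_off x hx i j hij
    · intro i j k hij hjk hik
      rw [← pd_lfun hd, ← hh' x hij.symm, ← hh' x hik.symm]; exact hu.l_diag x hx i j k hij hjk hik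
    · intro i j k hij hjk hik
      rw [← pd_hfun hd _ hij, ← hh' x hik, ← hh' x hjk.symm]; exact hu.h_off x hx i j k hij hjk hik
    · intro i j k hij hjk hik
      rw [← pd_hfun hd _ hij, ← pd_hfun hd _ hij.symm, ← hh' x hik, ← hh' x hjk]
      exact hu.h_sum x hx i j k hij hjk hik
    · intro i j k hij hjk hik
      rw [← pd_hfun hd _ hij, ← pd_hfun hd _ hij.symm, ← hh' x hik.symm, ← hh' x hjk.symm]
      exact hu.h_eps x hx i j k hij hjk hik
  · rintro ⟨ho, hs, H⟩
    have hd : ∀ x ∈ Ω, DifferentiableAt ℝ u x := fun x hx =>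
      (hs.contDiffAt (ho.mem_nhds hx)).differentiableAt (by simp)
    refine ⟨ho, hs, fun x hx => (H x hx).1, fun x hx => (H x hx).2.1, ?_, ?_, ?_, ?_, ?_⟩
    · intro x hx i j hij
      rw [pd_lfun (hd x hx), hh' x hij]; exact (H x hx).2.2.l_off i j hij
    · intro x hx i j k hij hjk hik
      rw [pd_lfun (hd x hx), hh' x hij.symm, hh' x hik.symm]
      exact (H x hx).2.2.l_diag i j k hij hjk hik
    · intro x hx i j k hij hjk hik
      rw [pd_hfun (hd x hx) _ hij, hh' x hik, hh' x hjk.symm]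
      exact (H x hx).2.2.h_off i j k hij hjk hik
    · intro x hx i j k hij hjk hik
      rw [pd_hfun (hd x hx) _ hij, pd_hfun (hd x hx) _ hij.symm, hh' x hik, hh' x hjk]
      exact (H x hx).2.2.h_sum i j k hij hjk hik
    · intro x hx i j k hij hjk hik
      rw [pd_hfun (hd x hx) _ hij, pd_hfun (hd x hx) _ hij.symm, hh' x hik.symm, hh' x hjk.symm]
      exact (H x hx).2.2.h_eps i j k hij hjk hik

theorem eps_mul_self (i : Fin 3) : eps i * eps i = 1 := by
  fin_cases i <;> simp [eps]

theorem firstOrder_totalForm {c : Fin 3 → ℝ} (hc : Admissible c) (y : Dep) :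
    FirstOrder y fun n => totalForm c n y y := by
  simp only [totalForm_apply]
  constructor
  · intro i j hij
    simp [dl, hij]
  · intro i j k hij hjk hik
    have hs : ∑ m, eps m * hh y.2 m i * y.1 m
        = eps j * hh y.2 j i * y.1 j + eps k * hh y.2 k i * y.1 k := by
      revert hij hjk hik
      fin_cases i <;> fin_cases j <;> fin_cases k <;> simp [Fin.sum_univ_three] <;> ring
    simp only [dl, if_true, hs]
    linear_combination
      (-(eps j * hh y.2 j i * y.1 j + eps k * hh y.2 k i * y.1 k)) * eps_mul_self i
  · intro i j k hij hjk hik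
    simp [hh_dhForm _ _ _ _ hij, hik.symm, hjk.symm]
  · intro i j k hij hjk hik
    have h1 := hc i j hij
    have h2 := hc j i hij.symm
    simp only [hh_dhForm _ _ _ _ hij, hh_dhForm _ _ _ _ hij.symm, hij, hij.symm, if_true, if_false,
      third_eq hij hjk hik, third_eq hij.symm hik hjk, dhCol]
    rcases eq_or_ne i 1 with rfl | hi <;> rcases eq_or_ne j 1 with rfl | hj <;>
      rcases eq_or_ne k 1 with rfl | hk <;>
    simp_all [eps] <;> field_simp <;> ring
  · intro i j k hij hjk hik
    have h1 := hc i j hij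
    have h2 := hc j i hij.symm
    simp only [hh_dhForm _ _ _ _ hij, hh_dhForm _ _ _ _ hij.symm, hij, hij.symm, if_true, if_false,
      third_eq hij hjk hik, third_eq hij.symm hik hjk, dhRow]
    rcases eq_or_ne i 1 with rfl | hi <;> rcases eq_or_ne j 1 with rfl | hj <;>
      rcases eq_or_ne k 1 with rfl | hk <;>
    simp_all [eps] <;> field_simp <;> ring

/-- Through every point `(x₀, y₀)` of the Guichard cone with `l_i ≠ 0` passes a solution for
which `h` is invariant under translations in a given admissible direction. -/
theorem exists_isSolution {c : Fin 3 → ℝ} (hc : Admissible c) (x₀ : Indep) (y₀ : Dep)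
    (hg : ∑ i, eps i * y₀.1 i ^ 2 = 0) (hl : ∀ i, y₀.1 i ≠ 0) :
    ∃ (Ω : Set Indep) (u : Indep → Dep), x₀ ∈ Ω ∧ IsSolution Ω u ∧ u x₀ = y₀ ∧
      ∀ n, fderiv ℝ u x₀ (Pi.single n 1) = totalForm c n y₀ y₀ := by
  obtain ⟨w, hw, hw0, hwd⟩ := exists_solution_of_commuting_quadratic
    (fun n => (totalForm c n).toContinuousBilinearMap)
    (fun n m y => totalForm_comm hc n m y) y₀
  simp only [LinearMap.toContinuousBilinearMap_apply] at hwd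
  have hne : ∀ᶠ x in 𝓝 (0 : Indep), ∀ i, (w x).1 i ≠ 0 := by
    refine eventually_all.2 fun i => ?_
    have hcont : ContinuousAt (fun x => (w x).1 i) 0 :=
      (continuous_apply i).continuousAt.comp hw.continuousAt.fst
    refine hcont.eventually_ne ?_
    rw [hw0]; exact hl i
  obtain ⟨δ, hδ, hball⟩ := Metric.eventually_nhds_iff_ball.1
    (((hw.eventually (by simp)).and hwd).and hne)
  set B := Metric.ball (0 : Indep) δ
  have hwD : ∀ x ∈ B, DifferentiableAt ℝ w x := fun x hx =>
    (hball x hx).1.1.differentiableAt (by simp)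
  have hguich : ∀ x ∈ B, ∑ i, eps i * (w x).1 i ^ 2 = 0 := by
    have hder : ∀ x ∈ B, HasFDerivAt (fun x => ∑ i, eps i * (w x).1 i ^ 2)
        (0 : Indep →L[ℝ] ℝ) x := by
      intro x hx
      have h1 : ∀ i, HasFDerivAt (fun x => (w x).1 i)
          (((ContinuousLinearMap.proj (R := ℝ) (φ := fun _ : Fin 3 => ℝ) i).comp
            (ContinuousLinearMap.fst ℝ (Fin 3 → ℝ) (OffDiag → ℝ))).comp (fderiv ℝ w x)) x :=
        fun i => ((ContinuousLinearMap.proj (R := ℝ) (φ := fun _ : Fin 3 => ℝ) i).comp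
          (ContinuousLinearMap.fst ℝ (Fin 3 → ℝ) (OffDiag → ℝ))).hasFDerivAt.comp x
            (hwD x hx).hasFDerivAt
      have h2 := HasFDerivAt.fun_sum (u := Finset.univ)
        fun i _ => ((h1 i).pow 2).const_mul (eps i)
      refine h2.congr_fderiv ?_
      refine ContinuousLinearMap.coe_injective (LinearMap.pi_ext' fun n => LinearMap.ext_ring ?_)
      have h3 := (hball x hx).1.2 n
      simp only [LinearMap.comp_apply, LinearMap.single_apply, ContinuousLinearMap.coe_coe,
        sum_apply, smul_apply, ContinuousLinearMap.comp_apply, h3, ContinuousLinearMap.proj_apply,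
        ContinuousLinearMap.coe_fst', totalForm_apply]
      fin_cases n <;> simp [Fin.sum_univ_three, dl, eps] <;> ring
    intro x hx
    have := (convex_ball (0 : Indep) δ).is_const_of_fderivWithin_eq_zero (𝕜 := ℝ)
      (f := fun x => ∑ i, eps i * (w x).1 i ^ 2)
      (fun x hx => (hder x hx).differentiableAt.differentiableWithinAt)
      (fun x hx => ((hder x hx).hasFDerivWithinAt).fderivWithin
        (Metric.isOpen_ball.uniqueDiffWithinAt hx)) hx (Metric.mem_ball_self hδ)
    exact this.trans (by simp only [hw0, hg])
  have hfd : ∀ x, fderiv ℝ (fun x => w (x - x₀)) x = fderiv ℝ w (x - x₀) := fun x =>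
    fderiv_comp_sub x₀
  have hmem : ∀ x ∈ Metric.ball x₀ δ, x - x₀ ∈ B := fun x hx => by
    simpa [B, dist_eq_norm] using hx
  refine ⟨Metric.ball x₀ δ, fun x => w (x - x₀), Metric.mem_ball_self hδ,
    isSolution_iff.2 ⟨Metric.isOpen_ball, ?_, ?_⟩, by simp [hw0], ?_⟩
  · intro x hx
    have h1 : ContDiffAt ℝ ω w (x - x₀) := (hball _ (hmem x hx)).1.1
    exact (((h1.of_le le_top).comp x (contDiff_id.sub contDiff_const).contDiffAt)).contDiffWithinAt
  · intro x hx
    have h1 := hball _ (hmem x hx)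
    refine ⟨h1.2, hguich _ (hmem x hx), ?_⟩
    simp only [hfd, h1.1.2]
    exact firstOrder_totalForm hc _
  · intro n
    rw [hfd, sub_self, (hball 0 (Metric.mem_ball_self hδ)).1.2 n, hw0]

theorem IsSolution.mono {Ω Ω' : Set Indep} {u : Indep → Dep} (hu : IsSolution Ω u)
    (hΩ' : IsOpen Ω') (h : Ω' ⊆ Ω) : IsSolution Ω' u := by
  obtain ⟨-, h2, h3⟩ := isSolution_iff.1 hu
  exact isSolution_iff.2 ⟨hΩ', h2.mono h, fun x hx => h3 x (h hx)⟩

/-! ### Independence of the free first derivatives -/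

/-- A quantity that vanishes exactly where the derivatives `h_{ij,x_i}` and `h_{ij,x_j}`
of the solutions with translation-invariant `h` fail to be in general position. -/
def discr (h : OffDiag → ℝ) (i j : Fin 3) : ℝ :=
  (hh h i (third i j) * hh h (third i j) j) ^ 2
    - eps i * eps j * (hh h j (third i j) * hh h (third i j) i) ^ 2

/-- The matrices `h` for which the first derivatives of the solutions with translation-invariant `h`
are in general position. -/
def Generic (h : OffDiag → ℝ) : Prop := ∀ i j : Fin 3, i ≠ j → discr h i j ≠ 0

theorem analyticAt_hh (i j : Fin 3) (h : OffDiag → ℝ) :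
    AnalyticAt ℝ (fun h : OffDiag → ℝ => hh h i j) h := by
  by_cases hij : i = j
  · simp only [hij, hh_self]; exact analyticAt_const
  · simp only [hh_of_ne _ hij]
    exact (ContinuousLinearMap.proj (R := ℝ) (φ := fun _ : OffDiag => ℝ) _).analyticAt _

theorem dense_ne_zero_of_analytic {E : Type*} [NormedAddCommGroup E] [NormedSpace ℝ E]
    {f : E → ℝ} (hf : ∀ x, AnalyticAt ℝ f x) {x₁ : E} (hx₁ : f x₁ ≠ 0) :
    Dense {x | f x ≠ 0} := by
  intro x₀
  set g : ℝ → ℝ := fun t => f (x₀ + t • (x₁ - x₀)) with hg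
  have hline : ∀ t : ℝ, AnalyticAt ℝ (fun t : ℝ => x₀ + t • (x₁ - x₀)) t := fun t => by fun_prop
  have hga : AnalyticOnNhd ℝ g univ := fun t _ => (hf _).comp (hline t)
  have hne : ∃ᶠ t in 𝓝 (0 : ℝ), g t ≠ 0 := by
    intro h
    have h0 : g =ᶠ[𝓝 0] 0 := by filter_upwards [h] with t ht using not_not.1 ht
    have := hga.eqOn_zero_of_preconnected_of_eventuallyEq_zero isPreconnected_univ (mem_univ 0) h0
      (mem_univ 1)
    simp [hg] at this
    exact hx₁ this
  rw [mem_closure_iff_frequently]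
  have ht : Tendsto (fun t : ℝ => x₀ + t • (x₁ - x₀)) (𝓝 0) (𝓝 x₀) := by
    have := (hline 0).continuousAt.tendsto
    simpa using this
  exact ht.frequently hne

theorem dense_generic : Dense {h : OffDiag → ℝ | Generic h} := by
  set f : (OffDiag → ℝ) → ℝ := fun h => ∏ i, ∏ j, if i = j then 1 else discr h i j with hf
  have hfg : {h : OffDiag → ℝ | Generic h} = {h | f h ≠ 0} := by
    ext h
    simp only [mem_ofPred_eq, hf, Finset.prod_ne_zero_iff, Finset.mem_univ, true_implies, Generic]
    refine forall₂_congr fun i j => ?_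
    by_cases hij : i = j <;> simp [hij]
  rw [hfg]
  refine dense_ne_zero_of_analytic (fun h => ?_)
    (x₁ := fun q => if q.1 = (0, 1) then 2 else 1) ?_
  · refine Finset.analyticAt_fun_prod _ fun i _ => Finset.analyticAt_fun_prod _ fun j _ => ?_
    by_cases hij : i = j
    · simp only [hij, if_true]; exact analyticAt_const
    · simp only [hij, if_false, discr]
      have := fun i j => analyticAt_hh i j h
      exact (((this _ _).mul (this _ _)).pow 2).sub
        (analyticAt_const.mul (((this _ _).mul (this _ _)).pow 2))
  · have e01 : third 0 1 = 2 := rfl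
    have e10 : third 1 0 = 2 := rfl
    have e02 : third 0 2 = 1 := rfl
    have e20 : third 2 0 = 1 := rfl
    have e12 : third 1 2 = 0 := rfl
    have e21 : third 2 1 = 0 := rfl
    simp only [hf, Finset.prod_ne_zero_iff, Finset.mem_univ, true_implies]
    intro i j
    fin_cases i <;> fin_cases j <;> simp [discr, e01, e10, e02, e20, e12, e21, hh, eps] <;> norm_num

theorem eps_sq_cases (i j : Fin 3) : eps i * eps j = 1 ∨ eps i * eps j = -1 := by
  simp only [eps]; split_ifs <;> norm_num

/-- Partial fractions: the functions `γ`, `1/γ`, `1` and the multiples of `1/(1 ∓ γ²)` by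
quadratic polynomials are independent enough to isolate the coefficients of `γ` and `1/γ`. -/
theorem coeff_eq_zero_of_partial_fractions {e U X₀ X₁ X₂ Z K : ℝ} (he : e = 1 ∨ e = -1)
    (H : ∀ γ : ℝ, γ ≠ 0 → γ ^ 2 ≠ 1 →
      γ * U + (X₀ + γ * X₁ + γ ^ 2 * X₂) / (1 - e * γ ^ 2) + Z / γ + K = 0) : U = 0 ∧ Z = 0 := by
  have h2 := H 2 (by norm_num) (by norm_num)
  have h3 := H 3 (by norm_num) (by norm_num)
  have h4 := H 4 (by norm_num) (by norm_num)
  have g2 := H (-2) (by norm_num) (by norm_num)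
  have g3 := H (-3) (by norm_num) (by norm_num)
  have g4 := H (-4) (by norm_num) (by norm_num)
  rcases he with rfl | rfl <;> norm_num at h2 h3 h4 g2 g3 g4 <;> constructor <;> linarith

theorem eq_zero_of_discr_ne_zero {e A B α β : ℝ}
    (hd : α ^ 2 - e * β ^ 2 ≠ 0) (h1 : -(A * α) + B * β = 0) (h2 : e * (A * β) - B * α = 0) :
    A = 0 ∧ B = 0 := by
  have hA : (α ^ 2 - e * β ^ 2) * A = 0 := by linear_combination (-α) * h1 - β * h2
  have hB : (α ^ 2 - e * β ^ 2) * B = 0 := by linear_combination (-e * β) * h1 - α * h2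
  exact ⟨(mul_eq_zero.1 hA).resolve_left hd, (mul_eq_zero.1 hB).resolve_left hd⟩

theorem eps_eq_one_or (i : Fin 3) : eps i = 1 ∨ eps i = -1 := by
  simp only [eps]; split_ifs <;> norm_num

theorem one_sub_mul_sq_ne_zero {e γ : ℝ} (he : e = 1 ∨ e = -1) (h1 : γ ^ 2 ≠ 1) :
    1 - e * γ ^ 2 ≠ 0 := by
  rcases he with rfl | rfl <;> intro h2
  · exact h1 (by linarith)
  · nlinarith [sq_nonneg γ]

/-- For generic `h`, a constant and the six free first derivatives, as functions of the admissible
direction `c`, are linearly independent. It suffices to take `c` in the coordinate planes. -/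
theorem coeff_eq_zero_of_forall_admissible {h : OffDiag → ℝ} (hgen : Generic h) {i j k : Fin 3}
    (hij : i ≠ j) (hjk : j ≠ k) (hik : i ≠ k) {A₁ B₁ A₂ B₂ A₃ B₃ C : ℝ}
    (H : ∀ c, Admissible c →
      A₁ * dhRow c h h i j k + B₁ * dhCol c h h i j k
      + (A₂ * dhRow c h h i k j + B₂ * dhCol c h h i k j)
      + (A₃ * dhRow c h h j k i + B₃ * dhCol c h h j k i) + C = 0) :
    A₁ = 0 ∧ B₁ = 0 ∧ A₂ = 0 ∧ B₂ = 0 ∧ A₃ = 0 ∧ B₃ = 0 := by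
  -- an admissible direction with prescribed components
  have hvec : ∀ x y z : ℝ, x ^ 2 - eps i * eps j * y ^ 2 ≠ 0 → x ^ 2 - eps i * eps k * z ^ 2 ≠ 0 →
      y ^ 2 - eps j * eps k * z ^ 2 ≠ 0 →
      ∃ c : Fin 3 → ℝ, Admissible c ∧ c i = x ∧ c j = y ∧ c k = z := by
    intro x y z h1 h2 h3
    obtain ⟨c, ci, cj, ck⟩ : ∃ c : Fin 3 → ℝ, c i = x ∧ c j = y ∧ c k = z :=
      ⟨fun n => if n = i then x else if n = j then y else z, by simp, by simp [hij.symm],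
        by simp [hik.symm, hjk.symm]⟩
    refine ⟨c, ?_, ci, cj, ck⟩
    rw [← ci, ← cj] at h1
    rw [← ci, ← ck] at h2
    rw [← cj, ← ck] at h3
    have hall : ∀ n : Fin 3, n = i ∨ n = j ∨ n = k := by
      clear * - hij hjk hik
      revert i j k; decide
    have hsw : ∀ a b : Fin 3, c a ^ 2 - eps a * eps b * c b ^ 2 ≠ 0 →
        c b ^ 2 - eps b * eps a * c a ^ 2 ≠ 0 := by
      intro a b hab h0
      apply hab
      linear_combination (-(eps a * eps b)) * h0
        + (-(eps b ^ 2 * c a ^ 2)) * eps_mul_self a - c a ^ 2 * eps_mul_self b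
    intro a b hab
    rcases hall a with rfl | rfl | rfl <;> rcases hall b with rfl | rfl | rfl <;>
      first | exact absurd rfl hab | assumption | (apply hsw; assumption)
  have eij := eps_sq_cases i j
  have eik := eps_sq_cases i k
  have ejk := eps_sq_cases j k
  have dij := hgen i j hij
  have dik := hgen i k hik
  have djk := hgen j k hjk
  simp only [discr, third_eq hij hjk hik, third_eq hik hjk.symm hij, third_eq hjk hik.symm hij.symm]
    at dij dik djk
  have hmul : ∀ {e γ : ℝ}, (e = 1 ∨ e = -1) → γ ≠ 0 → (0 : ℝ) ^ 2 - e * γ ^ 2 ≠ 0 := by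
    intro e γ he h0
    rcases he with rfl | rfl <;> simpa using h0
  obtain ⟨u1, z1⟩ := coeff_eq_zero_of_partial_fractions (e := eps i * eps k)
    (U := -(A₁ * (hh h i k * hh h k j)) + B₁ * (hh h j k * hh h k i))
    (X₀ := -(B₂ * (hh h i j * hh h k j)))
    (X₁ := A₂ * (hh h i j * hh h k j) - B₂ * (eps k * eps j * (hh h j i * hh h j k)))
    (X₂ := A₂ * (eps k * eps j * (hh h j i * hh h j k)))
    (Z := eps j * eps k * (A₃ * (hh h k i * hh h i j)) - B₃ * (hh h j i * hh h i k))
    (K := -(B₁ * (hh h i k * hh h j k)) - eps i * eps j * (A₃ * (hh h i j * hh h i k)) + C) eik (by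
    intro γ h0 h1
    have hD := one_sub_mul_sq_ne_zero eik h1
    obtain ⟨c, hc, ci, cj, ck⟩ := hvec 1 0 γ (by simp) (by simpa using hD) (hmul ejk h0)
    rw [← H c hc]
    simp only [dhRow, dhCol, ci, cj, ck]
    clear * - h0 hD
    rcases eps_eq_one_or i with ei | ei <;> rcases eps_eq_one_or j with ej | ej <;>
      rcases eps_eq_one_or k with ek | ek <;> simp only [ei, ej, ek] at hD ⊢ <;>
      norm_num at hD ⊢ <;> field_simp <;> ring)
  obtain ⟨u2, z2⟩ := coeff_eq_zero_of_partial_fractions (e := eps j * eps k)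
    (U := eps i * eps j * (A₁ * (hh h j k * hh h k i)) - B₁ * (hh h i k * hh h k j))
    (X₀ := -(B₃ * (hh h j i * hh h k i)))
    (X₁ := A₃ * (hh h j i * hh h k i) - B₃ * (eps k * eps i * (hh h i j * hh h i k)))
    (X₂ := A₃ * (eps k * eps i * (hh h i j * hh h i k)))
    (Z := eps i * eps k * (A₂ * (hh h k j * hh h j i)) - B₂ * (hh h i j * hh h j k))
    (K := -(eps i * eps k * (A₁ * (hh h k i * hh h k j)))
      - eps i * eps j * (A₂ * (hh h j i * hh h j k)) + C) ejk (by
    intro γ h0 h1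
    have hD := one_sub_mul_sq_ne_zero ejk h1
    obtain ⟨c, hc, ci, cj, ck⟩ := hvec 0 1 γ (hmul eij one_ne_zero) (hmul eik h0) (by simpa using hD)
    rw [← H c hc]
    simp only [dhRow, dhCol, ci, cj, ck]
    clear * - h0 hD
    rcases eps_eq_one_or i with ei | ei <;> rcases eps_eq_one_or j with ej | ej <;>
      rcases eps_eq_one_or k with ek | ek <;> simp only [ei, ej, ek] at hD ⊢ <;>
      norm_num at hD ⊢ <;> field_simp <;> ring)
  obtain ⟨u3, z3⟩ := coeff_eq_zero_of_partial_fractions (e := eps i * eps j)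
    (U := -(A₂ * (hh h i j * hh h j k)) + B₂ * (hh h k j * hh h j i))
    (X₀ := -(B₁ * (hh h i k * hh h j k)))
    (X₁ := A₁ * (hh h i k * hh h j k) - B₁ * (eps j * eps k * (hh h k i * hh h k j)))
    (X₂ := A₁ * (eps j * eps k * (hh h k i * hh h k j)))
    (Z := -(A₃ * (hh h j i * hh h i k)) + B₃ * (hh h k i * hh h i j))
    (K := -(B₂ * (hh h i j * hh h k j)) - B₃ * (hh h j i * hh h k i) + C) eij (by
    intro γ h0 h1
    have hD := one_sub_mul_sq_ne_zero eij h1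
    obtain ⟨c, hc, ci, cj, ck⟩ := hvec 1 γ 0 (by simpa using hD) (by simp) (by simpa using h0)
    rw [← H c hc]
    simp only [dhRow, dhCol, ci, cj, ck]
    clear * - h0 hD
    rcases eps_eq_one_or i with ei | ei <;> rcases eps_eq_one_or j with ej | ej <;>
      rcases eps_eq_one_or k with ek | ek <;> simp only [ei, ej, ek] at hD ⊢ <;>
      norm_num at hD ⊢ <;> field_simp <;> ring)
  obtain ⟨a1, b1⟩ := eq_zero_of_discr_ne_zero dij u1 u2
  obtain ⟨a2, b2⟩ := eq_zero_of_discr_ne_zero dik u3 z2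
  obtain ⟨a3, b3⟩ := eq_zero_of_discr_ne_zero djk z3 z1
  exact ⟨a1, b1, a2, b2, a3, b3⟩

/-! ### Coordinates on the Guichard cone and the determining equations -/

/-- Coordinates `(x, (l_0, l_2), h)` on one sheet of the Guichard cone. -/
abbrev Coord : Type := Indep × (ℝ × ℝ) × (OffDiag → ℝ)

/-- The vector `l` on the Guichard cone with given `l_0, l_2` for which `l_1` has the sign `σ`. -/
def cone (σ : ℝ) (q : Coord) : Fin 3 → ℝ :=
  ![q.2.1.1, σ * √(q.2.1.1 ^ 2 + q.2.1.2 ^ 2), q.2.1.2]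

/-- The coordinate vector `∂/∂x_n`. -/
def ex (n : Fin 3) : Coord := (Pi.single n 1, 0, 0)

/-- The matrix with one entry `1`, at the place `(i, j)`. -/
def unitH (i j : Fin 3) : OffDiag → ℝ := fun q => if q.1 = (i, j) then 1 else 0

/-- The coordinate vector `∂/∂h_{ij}`. -/
def eh (i j : Fin 3) : Coord := (0, 0, unitH i j)

/-- The tangent vector `l_n ∂/∂l_a - ε_a ε_n l_a ∂/∂l_n` of the Guichard cone, in coordinates. -/
def rot (l : Fin 3 → ℝ) (a n : Fin 3) : Coord :=
  (0, ((if 0 = a then l n else 0) - (if 0 = n then eps a * eps n * l a else 0),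
    (if 2 = a then l n else 0) - (if 2 = n then eps a * eps n * l a else 0)), 0)

/-- The derivative of `(x, l)` in the direction of `x_n` along the graph of a solution. -/
def baseDir (l : Fin 3 → ℝ) (h : OffDiag → ℝ) (n : Fin 3) : Coord :=
  (Pi.single n 1, (dl l h 0 n, dl l h 2 n), 0)

/-- The derivative of `(x, l, h)` in the direction of `x_n` along the graph of a solution for
which `h` is invariant under translations in the direction of `c`. -/
def jetDir (c : Fin 3 → ℝ) (l : Fin 3 → ℝ) (h : OffDiag → ℝ) (n : Fin 3) : Coord :=
  (Pi.single n 1, (dl l h 0 n, dl l h 2 n), dhForm c n h h)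

theorem hh_unitH {i j : Fin 3} (a b : Fin 3) (hij : i ≠ j) :
    hh (unitH i j) a b = if a = i ∧ b = j then 1 else 0 := by
  by_cases hab : a = b
  · subst hab
    rw [hh_self, if_neg]
    rintro ⟨rfl, rfl⟩
    exact hij rfl
  · rw [hh_of_ne _ hab, unitH]; simp [Prod.ext_iff]

theorem dl_eq_sum (l : Fin 3 → ℝ) (h : OffDiag → ℝ) {i j k : Fin 3} (hij : i ≠ j) (hjk : j ≠ k)
    (hik : i ≠ k) :
    dl l h i i = -(eps i * (eps j * hh h j i * l j + eps k * hh h k i * l k)) := by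
  have hs : ∑ m, eps m * hh h m i * l m = eps j * hh h j i * l j + eps k * hh h k i * l k := by
    revert hij hjk hik
    fin_cases i <;> fin_cases j <;> fin_cases k <;> simp [Fin.sum_univ_three] <;> ring
  rw [dl, if_pos rfl, hs]

theorem dl_of_ne (l : Fin 3 → ℝ) (h : OffDiag → ℝ) {i n : Fin 3} (hin : i ≠ n) :
    dl l h i n = hh h i n * l n := by rw [dl, if_neg hin]

theorem baseDir_eq (l : Fin 3 → ℝ) (h : OffDiag → ℝ) {i j k : Fin 3} (hij : i ≠ j) (hjk : j ≠ k)
    (hik : i ≠ k) : baseDir l h i = ex i + hh h j i • rot l j i + hh h k i • rot l k i := by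
  have h1 := dl_eq_sum l h hij hjk hik
  have h2 := dl_of_ne l h hij.symm
  have h3 := dl_of_ne l h hik.symm
  revert hij hjk hik h1 h2 h3
  fin_cases i <;> fin_cases j <;> fin_cases k <;> intro hij hjk hik h1 h2 h3 <;>
    simp_all [baseDir, ex, rot, Prod.ext_iff, eps] <;> ring

theorem eq_sum_unitH (w : OffDiag → ℝ) {i j k : Fin 3} (hij : i ≠ j) (hjk : j ≠ k) (hik : i ≠ k) :
    w = hh w i j • unitH i j + hh w j i • unitH j i + hh w i k • unitH i k + hh w k i • unitH k i
      + hh w j k • unitH j k + hh w k j • unitH k j := by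
  ext ⟨⟨a, b⟩, hab⟩
  rw [← hh_of_ne w hab]
  have h0 : ∀ i j : Fin 3, unitH i j ⟨(a, b), hab⟩ = if a = i ∧ b = j then 1 else 0 := fun i j => by
    simp [unitH, Prod.ext_iff]
  simp only [Pi.add_apply, Pi.smul_apply, h0, smul_eq_mul]
  revert hij hjk hik hab
  fin_cases i <;> fin_cases j <;> fin_cases k <;> intro hij hjk hik <;>
    (first | (exact absurd rfl hij) | (exact absurd rfl hjk) | (exact absurd rfl hik) | skip) <;>
    fin_cases a <;> fin_cases b <;> intro hab h0 <;> simp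

theorem dhCol_add_dhCol {c : Fin 3 → ℝ} (hc : Admissible c) (h : OffDiag → ℝ) {i j k : Fin 3}
    (hij : i ≠ j) (hjk : j ≠ k) (hik : i ≠ k) :
    dhCol c h h j i k = -dhCol c h h i j k - hh h i k * hh h j k := by
  have := (firstOrder_totalForm hc (0, h)).h_sum i j k hij hjk hik
  simp only [totalForm_apply, hh_dhForm _ _ _ _ hij, hh_dhForm _ _ _ _ hij.symm, hij, hij.symm,
    if_true, if_false, third_eq hij hjk hik, third_eq hij.symm hik hjk] at this
  linarith

theorem dhRow_add_dhRow {c : Fin 3 → ℝ} (hc : Admissible c) (h : OffDiag → ℝ) {i j k : Fin 3}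
    (hij : i ≠ j) (hjk : j ≠ k) (hik : i ≠ k) :
    eps j * dhRow c h h j i k = -(eps i * dhRow c h h i j k) - eps k * hh h k i * hh h k j := by
  have := (firstOrder_totalForm hc (0, h)).h_eps i j k hij hjk hik
  simp only [totalForm_apply, hh_dhForm _ _ _ _ hij, hh_dhForm _ _ _ _ hij.symm, hij, hij.symm,
    if_true, if_false, third_eq hij hjk hik, third_eq hij.symm hik hjk] at this
  linarith

theorem jetDir_eq {c : Fin 3 → ℝ} (hc : Admissible c) (l : Fin 3 → ℝ) (h : OffDiag → ℝ)
    {i j k : Fin 3} (hij : i ≠ j) (hjk : j ≠ k) (hik : i ≠ k) :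
    jetDir c l h i = baseDir l h i + dhRow c h h i j k • eh i j
      - (dhCol c h h i j k + hh h i k * hh h j k) • eh j i
      + dhRow c h h i k j • eh i k - (dhCol c h h i k j + hh h i j * hh h k j) • eh k i
      + (hh h j i * hh h i k) • eh j k + (hh h k i * hh h i j) • eh k j := by
  have h1 := eq_sum_unitH (dhForm c i h h) hij hjk hik
  simp only [hh_dhForm _ _ _ _ hij, hh_dhForm _ _ _ _ hij.symm, hh_dhForm _ _ _ _ hik,
    hh_dhForm _ _ _ _ hik.symm, hh_dhForm _ _ _ _ hjk, hh_dhForm _ _ _ _ hjk.symm, hij, hik,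
    if_true, if_false, third_eq hij hjk hik, third_eq hik hjk.symm hij,
    third_eq hij.symm hik hjk, third_eq hik.symm hij hjk.symm,
    dhCol_add_dhCol hc h hij hjk hik, dhCol_add_dhCol hc h hik hjk.symm hij] at h1
  refine Prod.ext ?_ (Prod.ext ?_ ?_)
  · simp [jetDir, baseDir, eh]
  · simp [jetDir, baseDir, eh]
  · simp only [jetDir, h1, baseDir, eh, Prod.snd_add, Prod.smul_snd, Prod.snd_sub]
    module

/-- The determining equations, in coordinates on the Guichard cone, of an infinitesimal symmetry
`Σ ξ_n ∂/∂x_n + Σ η_i ∂/∂l_i + Σ ζ_{ij} ∂/∂h_{ij}`: the linearized system along the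
solutions with translation-invariant `h`. -/
structure Determining (σ : ℝ) (B : Set Coord) (ξ η : Fin 3 → Coord → ℝ)
    (ζ : Fin 3 → Fin 3 → Coord → ℝ) : Prop where
  isOpen : IsOpen B
  convex : Convex ℝ B
  smooth_ξ : ∀ n, ContDiffOn ℝ ∞ (ξ n) B
  smooth_η : ∀ i, ContDiffOn ℝ ∞ (η i) B
  smooth_ζ : ∀ i j, ContDiffOn ℝ ∞ (ζ i j) B
  cone_ne : ∀ q ∈ B, ∀ i, cone σ q i ≠ 0
  l_off : ∀ q ∈ B, ∀ c, Admissible c → ∀ i j : Fin 3, i ≠ j →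
    fderiv ℝ (η i) q (jetDir c (cone σ q) q.2.2 j)
      - ∑ m, fderiv ℝ (ξ m) q (jetDir c (cone σ q) q.2.2 j) * dl (cone σ q) q.2.2 i m
      = ζ i j q * cone σ q j + hh q.2.2 i j * η j q
  l_diag : ∀ q ∈ B, ∀ c, Admissible c → ∀ i j k : Fin 3, i ≠ j → j ≠ k → i ≠ k →
    eps i * (fderiv ℝ (η i) q (jetDir c (cone σ q) q.2.2 i)
      - ∑ m, fderiv ℝ (ξ m) q (jetDir c (cone σ q) q.2.2 i) * dl (cone σ q) q.2.2 i m)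
      + eps j * (ζ j i q * cone σ q j + hh q.2.2 j i * η j q)
      + eps k * (ζ k i q * cone σ q k + hh q.2.2 k i * η k q) = 0
  h_off : ∀ q ∈ B, ∀ c, Admissible c → ∀ i j k : Fin 3, i ≠ j → j ≠ k → i ≠ k →
    fderiv ℝ (ζ i j) q (jetDir c (cone σ q) q.2.2 k)
      - ∑ m, fderiv ℝ (ξ m) q (jetDir c (cone σ q) q.2.2 k) * hh (dhForm c m q.2.2 q.2.2) i j
      = ζ i k q * hh q.2.2 k j + hh q.2.2 i k * ζ k j q
  h_sum : ∀ q ∈ B, ∀ c, Admissible c → ∀ i j k : Fin 3, i ≠ j → j ≠ k → i ≠ k →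
    (fderiv ℝ (ζ i j) q (jetDir c (cone σ q) q.2.2 j)
      - ∑ m, fderiv ℝ (ξ m) q (jetDir c (cone σ q) q.2.2 j) * hh (dhForm c m q.2.2 q.2.2) i j)
      + (fderiv ℝ (ζ j i) q (jetDir c (cone σ q) q.2.2 i)
      - ∑ m, fderiv ℝ (ξ m) q (jetDir c (cone σ q) q.2.2 i) * hh (dhForm c m q.2.2 q.2.2) j i)
      + (ζ i k q * hh q.2.2 j k + hh q.2.2 i k * ζ j k q) = 0
  h_eps : ∀ q ∈ B, ∀ c, Admissible c → ∀ i j k : Fin 3, i ≠ j → j ≠ k → i ≠ k →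
    eps i * (fderiv ℝ (ζ i j) q (jetDir c (cone σ q) q.2.2 i)
      - ∑ m, fderiv ℝ (ξ m) q (jetDir c (cone σ q) q.2.2 i) * hh (dhForm c m q.2.2 q.2.2) i j)
      + eps j * (fderiv ℝ (ζ j i) q (jetDir c (cone σ q) q.2.2 j)
      - ∑ m, fderiv ℝ (ξ m) q (jetDir c (cone σ q) q.2.2 j) * hh (dhForm c m q.2.2 q.2.2) j i)
      + eps k * (ζ k i q * hh q.2.2 k j + hh q.2.2 k i * ζ k j q) = 0

theorem cone_add_h (σ : ℝ) (q : Coord) (w : OffDiag → ℝ) : cone σ (q + (0, 0, w)) = cone σ q := by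
  simp [cone]

/-! ### Functions that do not depend on some of the coordinates -/

section Translation

variable {E : Type*} [NormedAddCommGroup E] [NormedSpace ℝ E] {B : Set E} {f : E → ℝ}

/-- On an open convex set, a function whose derivative in the direction `τ` vanishes is invariant,
together with its differential, under translation by `τ`. -/
theorem eq_of_fderiv_apply_eq_zero (hB : IsOpen B) (hconv : Convex ℝ B)
    (hf : DifferentiableOn ℝ f B) {τ : E} (hτ : ∀ q ∈ B, fderiv ℝ f q τ = 0) {q : E} (hq : q ∈ B)
    (hqτ : q + τ ∈ B) : f (q + τ) = f q ∧ fderiv ℝ f (q + τ) = fderiv ℝ f q := by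
  have key : ∀ p ∈ B, p + τ ∈ B → f (p + τ) = f p := by
    intro p hp hpτ
    have hseg : ∀ t ∈ Icc (0 : ℝ) 1, p + t • τ ∈ B := fun t ht => by
      have := hconv.add_smul_sub_mem hp hpτ ht
      simpa using this
    have hd : ∀ t ∈ Icc (0 : ℝ) 1, HasDerivAt (fun t : ℝ => f (p + t • τ)) 0 t := by
      intro t ht
      have h1 := (hf.differentiableAt (hB.mem_nhds (hseg t ht))).hasFDerivAt
      have h2 : HasDerivAt (fun t : ℝ => p + t • τ) τ t := by
        simpa using ((hasDerivAt_id t).smul_const τ).const_add p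
      have h3 := h1.comp_hasDerivAt t h2
      rwa [hτ _ (hseg t ht)] at h3
    have := constant_of_has_deriv_right_zero
      (fun t ht => (hd t ht).continuousAt.continuousWithinAt)
      (fun t ht => (hd t ⟨ht.1, ht.2.le⟩).hasDerivWithinAt) 1 (right_mem_Icc.2 zero_le_one)
    simpa using this
  refine ⟨key q hq hqτ, ?_⟩
  rw [← fderiv_comp_add_right]
  refine Filter.EventuallyEq.fderiv_eq ?_
  have hc : ContinuousAt (fun p => p + τ) q := by fun_prop
  filter_upwards [hB.mem_nhds hq, hc.preimage_mem_nhds (hB.mem_nhds hqτ)] with p hp hpτ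
    using key p hp hpτ

theorem exists_add_smul_mem (hB : IsOpen B) {q : E} (hq : q ∈ B) (τ : E) :
    ∃ δ : ℝ, δ ≠ 0 ∧ q + δ • τ ∈ B := by
  have hc : ContinuousAt (fun t : ℝ => q + t • τ) 0 := by fun_prop
  have h0 : ∀ᶠ t : ℝ in 𝓝 0, q + t • τ ∈ B :=
    hc.eventually_mem (hB.mem_nhds (by simpa using hq))
  obtain ⟨δ, h1, h2⟩ := ((h0.filter_mono nhdsWithin_le_nhds).and
    (self_mem_nhdsWithin : {(0 : ℝ)}ᶜ ∈ 𝓝[≠] (0 : ℝ))).exists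
  exact ⟨δ, h2, h1⟩

/-- A function that is affine along a line has the slope as directional derivative. -/
theorem fderiv_apply_of_affine (hB : IsOpen B) {q : E} (hq : q ∈ B)
    (hf : DifferentiableOn ℝ f B) {τ : E} {s : ℝ}
    (h : ∀ t : ℝ, q + t • τ ∈ B → f (q + t • τ) = f q + t * s) : fderiv ℝ f q τ = s := by
  have hc : ContinuousAt (fun t : ℝ => q + t • τ) 0 := by fun_prop
  have h0 : ∀ᶠ t : ℝ in 𝓝 0, q + t • τ ∈ B :=
    hc.eventually_mem (hB.mem_nhds (by simpa using hq))
  have h1 : HasDerivAt (fun t : ℝ => f (q + t • τ)) (fderiv ℝ f q τ) 0 := by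
    have h1 : HasFDerivAt f (fderiv ℝ f q) (q + (0 : ℝ) • τ) := by
      simpa using (hf.differentiableAt (hB.mem_nhds hq)).hasFDerivAt
    have h2 : HasDerivAt (fun t : ℝ => q + t • τ) τ 0 := by
      simpa using ((hasDerivAt_id (0 : ℝ)).smul_const τ).const_add q
    exact h1.comp_hasDerivAt 0 h2
  have h2 : HasDerivAt (fun t : ℝ => f q + t * s) s 0 := by
    simpa using ((hasDerivAt_id (0 : ℝ)).mul_const s).const_add (f q)
  exact h1.unique (h2.congr_of_eventuallyEq (h0.mono fun t ht => h t ht))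

end Translation

/-- A continuous function on an open set of coordinates vanishes if it vanishes at the points with
generic `h`. -/
theorem eq_zero_of_generic {B : Set Coord} (hB : IsOpen B) {f : Coord → ℝ} (hf : ContinuousOn f B)
    (h : ∀ q ∈ B, Generic q.2.2 → f q = 0) : ∀ q ∈ B, f q = 0 := by
  intro q hq
  have hd : Dense {q : Coord | Generic q.2.2} :=
    dense_generic.preimage (isOpenMap_snd.comp isOpenMap_snd)
  by_contra hne
  have h1 : ∀ᶠ p in 𝓝 q, f p ≠ 0 ∧ p ∈ B :=
    ((hf.continuousAt (hB.mem_nhds hq)).eventually_ne hne).and (hB.mem_nhds hq)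
  obtain ⟨p, hp, hpB⟩ := ((mem_closure_iff_frequently.1 (hd q)).and_eventually h1).exists
  exact hpB.1 (h p hpB.2 hp)

/-! ### Solution of the determining equations -/

theorem admissible_one_one_zero : Admissible ![1, 1, 0] := by
  intro i j hij
  fin_cases i <;> fin_cases j <;> simp_all [eps]

theorem exists_third {i j : Fin 3} (hij : i ≠ j) : ∃ k, j ≠ k ∧ i ≠ k := by
  revert i j; decide

theorem sum_eq_of_distinct {i j k : Fin 3} (hij : i ≠ j) (hjk : j ≠ k) (hik : i ≠ k)
    (f : Fin 3 → ℝ) : ∑ m, f m = f i + f j + f k := by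
  revert hij hjk hik
  fin_cases i <;> fin_cases j <;> fin_cases k <;> simp [Fin.sum_univ_three] <;> ring

theorem sum_dl_unitH (l u : Fin 3 → ℝ) (i : Fin 3) {c d : Fin 3} (hcd : c ≠ d) :
    ∑ m, dl l (unitH c d) i m * u m = ((if i = c then l d else 0)
      - (if i = d then eps d * eps c * l c else 0)) * u d := by
  simp only [dl, hh_unitH _ _ hcd, Fin.sum_univ_three]
  fin_cases i <;> fin_cases c <;> fin_cases d <;> simp_all [mul_assoc]

theorem dl_add_smul (l : Fin 3 → ℝ) (h w : OffDiag → ℝ) (t : ℝ) (i m : Fin 3) :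
    dl l (h + t • w) i m = dl l h i m + t * dl l w i m := by
  simp only [dl, hh_add, hh_smul, Fin.sum_univ_three]
  split_ifs <;> ring

theorem continuous_hh (i j : Fin 3) : Continuous fun q : Coord => hh q.2.2 i j := by
  by_cases hij : i = j
  · simp only [hij, hh_self]; exact continuous_const
  · simp only [hh_of_ne _ hij]; fun_prop

theorem continuous_cone (σ : ℝ) (i : Fin 3) : Continuous fun q : Coord => cone σ q i := by
  fin_cases i <;> simp only [cone] <;> fun_prop

theorem continuous_dl (σ : ℝ) (i m : Fin 3) :
    Continuous fun q : Coord => dl (cone σ q) q.2.2 i m := by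
  have h1 := continuous_hh
  have h2 := continuous_cone σ
  by_cases him : i = m
  · simp only [dl, him, if_true]
    exact (continuous_const.mul (continuous_finsetSum _ fun a _ =>
      (continuous_const.mul (h1 _ _)).mul (h2 _))).neg
  · simp only [dl, him, if_false]
    exact (h1 _ _).mul (h2 _)

theorem continuous_baseDir (σ : ℝ) (n : Fin 3) :
    Continuous fun q : Coord => baseDir (cone σ q) q.2.2 n :=
  continuous_const.prodMk (((continuous_dl σ 0 n).prodMk (continuous_dl σ 2 n)).prodMk
    continuous_const)

theorem linear_eh_eq_zero {W : Coord →L[ℝ] ℝ} (h : ∀ i j, i ≠ j → W (eh i j) = 0)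
    (w : OffDiag → ℝ) : W (0, 0, w) = 0 := by
  have h1 : ((0, 0, w) : Coord) = hh w 0 1 • eh 0 1 + hh w 1 0 • eh 1 0 + hh w 0 2 • eh 0 2
      + hh w 2 0 • eh 2 0 + hh w 1 2 • eh 1 2 + hh w 2 1 • eh 2 1 := by
    refine Prod.ext (by simp [eh]) (Prod.ext (by simp [eh]) ?_)
    exact eq_sum_unitH w (by decide) (by decide) (by decide)
  rw [h1]
  simp only [map_add, map_smul]
  simp [h 0 1 (by decide), h 1 0 (by decide), h 0 2 (by decide), h 2 0 (by decide),
    h 1 2 (by decide), h 2 1 (by decide)]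

/-- At generic points, a linear form whose value on the jets does not depend on the direction of
invariance of `h` does not depend on `h`. -/
theorem linear_eh_of_jetDir {W : Coord →L[ℝ] ℝ} {l : Fin 3 → ℝ} {h : OffDiag → ℝ}
    (hgen : Generic h) {K : ℝ} {i j k : Fin 3} (hij : i ≠ j) (hjk : j ≠ k) (hik : i ≠ k)
    (hW : ∀ c, Admissible c → W (jetDir c l h i) = K) :
    W (eh i j) = 0 ∧ W (eh j i) = 0 := by
  have := coeff_eq_zero_of_forall_admissible hgen hij hjk hik (A₁ := W (eh i j))
    (B₁ := -W (eh j i)) (A₂ := W (eh i k)) (B₂ := -W (eh k i)) (A₃ := 0) (B₃ := 0)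
    (C := W (baseDir l h i) - hh h i k * hh h j k * W (eh j i)
      - hh h i j * hh h k j * W (eh k i)
      + hh h j i * hh h i k * W (eh j k) + hh h k i * hh h i j * W (eh k j) - K) (by
    intro c hc
    have h1 := hW c hc
    rw [jetDir_eq hc l h hij hjk hik] at h1
    simp only [map_add, map_sub, map_smul, smul_eq_mul] at h1
    linear_combination h1)
  exact ⟨this.1, neg_eq_zero.1 this.2.1⟩

namespace Determining

variable {σ : ℝ} {B : Set Coord} {ξ η : Fin 3 → Coord → ℝ} {ζ : Fin 3 → Fin 3 → Coord → ℝ}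

theorem diff_ξ (D : Determining σ B ξ η ζ) (n : Fin 3) : DifferentiableOn ℝ (ξ n) B :=
  (D.smooth_ξ n).differentiableOn (by simp)

theorem diff_η (D : Determining σ B ξ η ζ) (n : Fin 3) : DifferentiableOn ℝ (η n) B :=
  (D.smooth_η n).differentiableOn (by simp)

theorem diff_ζ (D : Determining σ B ξ η ζ) (i j : Fin 3) : DifferentiableOn ℝ (ζ i j) B :=
  (D.smooth_ζ i j).differentiableOn (by simp)

theorem cont_fderiv (D : Determining σ B ξ η ζ) {f : Coord → ℝ} (hf : ContDiffOn ℝ ∞ f B) :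
    ContinuousOn (fun q => fderiv ℝ f q) B :=
  hf.continuousOn_fderiv_of_isOpen D.isOpen (by simp)

/-- The `l`-equations of the system force `∂η_i/∂h = Σ l_{i,n} ∂ξ_n/∂h`. -/
theorem eta_eh (D : Determining σ B ξ η ζ) (i : Fin 3) {a b : Fin 3} (hab : a ≠ b) :
    ∀ q ∈ B, fderiv ℝ (η i) q (eh a b)
      = ∑ m, dl (cone σ q) q.2.2 i m * fderiv ℝ (ξ m) q (eh a b) := by
  have key : ∀ q ∈ B, fderiv ℝ (η i) q (eh a b)
      - ∑ m, dl (cone σ q) q.2.2 i m * fderiv ℝ (ξ m) q (eh a b) = 0 := by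
    refine eq_zero_of_generic D.isOpen ?_ ?_
    · refine ((D.cont_fderiv (D.smooth_η i)).clm_apply continuousOn_const).sub
        (continuousOn_finsetSum _ fun m _ => ?_)
      exact (continuous_dl σ i m).continuousOn.mul
        ((D.cont_fderiv (D.smooth_ξ m)).clm_apply continuousOn_const)
    · intro q hq hgen
      set W : Coord →L[ℝ] ℝ := fderiv ℝ (η i) q
        - ∑ m, dl (cone σ q) q.2.2 i m • fderiv ℝ (ξ m) q with hW
      have hWa : ∀ v, W v = fderiv ℝ (η i) q v
          - ∑ m, fderiv ℝ (ξ m) q v * dl (cone σ q) q.2.2 i m := fun v => by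
        simp [hW, mul_comm]
      obtain ⟨c, hbc, hac⟩ := exists_third hab
      have hK : ∃ K, ∀ c, Admissible c → W (jetDir c (cone σ q) q.2.2 a) = K := by
        by_cases hia : i = a
        · subst hia
          refine ⟨-(eps i * (eps b * (ζ b i q * cone σ q b + hh q.2.2 b i * η b q)
            + eps c * (ζ c i q * cone σ q c + hh q.2.2 c i * η c q))), fun e he => ?_⟩
          have := D.l_diag q hq e he i b c hab hbc hac
          rw [← hWa] at this
          linear_combination eps i * this - W (jetDir e (cone σ q) q.2.2 i) * eps_mul_self i
        · exact ⟨_, fun e he => (hWa _).trans (D.l_off q hq e he i a hia)⟩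
      obtain ⟨K, hK⟩ := hK
      have h1 := (linear_eh_of_jetDir hgen hab hbc hac hK).1
      rw [hWa] at h1
      rw [← h1]
      simp [mul_comm]
  intro q hq
  exact sub_eq_zero.1 (key q hq)

theorem hasDerivAt_fderiv_line (D : Determining σ B ξ η ζ) {f : Coord → ℝ}
    (hf : ContDiffOn ℝ ∞ f B) {q : Coord} (hq : q ∈ B) (v w : Coord) :
    HasDerivAt (fun t : ℝ => fderiv ℝ f (q + t • w) v) (fderiv ℝ (fderiv ℝ f) q w v) 0 := by
  have h1 : ContDiffAt ℝ ∞ f q := hf.contDiffAt (D.isOpen.mem_nhds hq)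
  have h2 : HasFDerivAt (fderiv ℝ f) (fderiv ℝ (fderiv ℝ f) q) (q + (0 : ℝ) • w) := by
    have : DifferentiableAt ℝ (fderiv ℝ f) q :=
      (h1.fderiv_right (m := 1) (by norm_cast)).differentiableAt (by simp)
    simpa using this.hasFDerivAt
  have h3 : HasDerivAt (fun t : ℝ => q + t • w) w 0 := by
    simpa using ((hasDerivAt_id (0 : ℝ)).smul_const w).const_add q
  have h4 : HasDerivAt (fun t : ℝ => fderiv ℝ f (q + t • w)) (fderiv ℝ (fderiv ℝ f) q w) 0 :=
    h2.comp_hasDerivAt 0 h3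
  exact (ContinuousLinearMap.apply ℝ ℝ v).hasFDerivAt.comp_hasDerivAt (0 : ℝ) h4

theorem fderiv_symm (D : Determining σ B ξ η ζ) {f : Coord → ℝ}
    (hf : ContDiffOn ℝ ∞ f B) {q : Coord} (hq : q ∈ B) (v w : Coord) :
    fderiv ℝ (fderiv ℝ f) q v w = fderiv ℝ (fderiv ℝ f) q w v :=
  ((hf.contDiffAt (D.isOpen.mem_nhds hq)).isSymmSndFDerivAt (by
    rw [minSmoothness_of_isRCLikeNormedField]
    exact WithTop.coe_le_coe.2 (le_top : (2 : ℕ∞) ≤ ⊤))) v w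

/-- Equality of the mixed second derivatives of `η_i` with respect to `h`. -/
theorem cross_xi (D : Determining σ B ξ η ζ) {a b c d : Fin 3} (hab : a ≠ b) (hcd : c ≠ d)
    (i : Fin 3) {q : Coord} (hq : q ∈ B) :
    ∑ m, dl (cone σ q) (unitH c d) i m * fderiv ℝ (ξ m) q (eh a b)
      = ∑ m, dl (cone σ q) (unitH a b) i m * fderiv ℝ (ξ m) q (eh c d) := by
  have key : ∀ {a b c d : Fin 3}, a ≠ b → c ≠ d →
      fderiv ℝ (fderiv ℝ (η i)) q (eh c d) (eh a b)
      = ∑ m, (dl (cone σ q) (unitH c d) i m * fderiv ℝ (ξ m) q (eh a b)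
        + dl (cone σ q) q.2.2 i m * fderiv ℝ (fderiv ℝ (ξ m)) q (eh c d) (eh a b)) := by
    intro a b c d hab hcd
    have h1 := D.hasDerivAt_fderiv_line (D.smooth_η i) hq (eh a b) (eh c d)
    have h2 : HasDerivAt (fun t : ℝ => ∑ m, (dl (cone σ q) q.2.2 i m
        + t * dl (cone σ q) (unitH c d) i m) * fderiv ℝ (ξ m) (q + t • eh c d) (eh a b))
        (∑ m, (dl (cone σ q) (unitH c d) i m * fderiv ℝ (ξ m) q (eh a b)
        + dl (cone σ q) q.2.2 i m * fderiv ℝ (fderiv ℝ (ξ m)) q (eh c d) (eh a b))) 0 := by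
      refine HasDerivAt.fun_sum fun m _ => ?_
      have h3 := D.hasDerivAt_fderiv_line (D.smooth_ξ m) hq (eh a b) (eh c d)
      have h4 : HasDerivAt (fun t : ℝ => dl (cone σ q) q.2.2 i m
          + t * dl (cone σ q) (unitH c d) i m) (dl (cone σ q) (unitH c d) i m) 0 := by
        simpa using ((hasDerivAt_id (0 : ℝ)).mul_const _).const_add (dl (cone σ q) q.2.2 i m)
      simpa using h4.fun_mul h3
    refine h1.unique (h2.congr_of_eventuallyEq ?_)
    have hc : ContinuousAt (fun t : ℝ => q + t • eh c d) 0 := by fun_prop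
    filter_upwards [hc.eventually_mem (D.isOpen.mem_nhds (by simpa using hq))] with t ht
    rw [D.eta_eh i hab _ ht]
    refine Finset.sum_congr rfl fun m _ => ?_
    have e1 : q + t • eh c d = q + (0, 0, t • unitH c d) := by simp [eh]
    have e2 : (q + (0, 0, t • unitH c d) : Coord).2.2 = q.2.2 + t • unitH c d := rfl
    rw [e1, cone_add_h, e2, dl_add_smul]
  have h1 := key hab hcd
  have h2 := key hcd hab
  rw [D.fderiv_symm (D.smooth_η i) hq, h2] at h1
  simp only [Finset.sum_add_distrib] at h1
  have h3 : ∀ m, fderiv ℝ (fderiv ℝ (ξ m)) q (eh c d) (eh a b)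
      = fderiv ℝ (fderiv ℝ (ξ m)) q (eh a b) (eh c d) := fun m =>
    D.fderiv_symm (D.smooth_ξ m) hq _ _
  simp only [h3] at h1
  linarith

/-- `ξ` does not depend on `h`: for suitable indices one side of `cross_xi` is zero and the other one
is the product of `∂ξ_m/∂h_{ab}` and a nonzero multiple of some `l_i`. -/
theorem xi_eh (D : Determining σ B ξ η ζ) (m : Fin 3) {a b : Fin 3} (hab : a ≠ b) {q : Coord}
    (hq : q ∈ B) : fderiv ℝ (ξ m) q (eh a b) = 0 := by
  obtain ⟨k, hbk, hak⟩ := exists_third hab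
  have hne := D.cone_ne q hq
  have key : ∀ c d : Fin 3, c ≠ d → ((k = c ∧ k ≠ d) ∨ (k = d ∧ k ≠ c)) →
      fderiv ℝ (ξ d) q (eh a b) = 0 := by
    intro c d hcd hk
    have h := D.cross_xi hab hcd k hq
    rw [sum_dl_unitH _ (fun m => fderiv ℝ (ξ m) q (eh a b)) k hcd,
      sum_dl_unitH _ (fun m => fderiv ℝ (ξ m) q (eh c d)) k hab, if_neg hak.symm,
      if_neg hbk.symm] at h
    rcases hk with ⟨h1, h2⟩ | ⟨h1, h2⟩
    · rw [if_pos h1, if_neg h2] at h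
      simp only [sub_zero, zero_mul] at h
      exact (mul_eq_zero.1 h).resolve_left (hne d)
    · rw [if_neg h2, if_pos h1] at h
      simp only [zero_sub, sub_zero, zero_mul] at h
      refine (mul_eq_zero.1 h).resolve_left (neg_ne_zero.2 (mul_ne_zero ?_ (hne c)))
      rcases eps_sq_cases d c with e | e <;> rw [e] <;> norm_num
  have hall : m = a ∨ m = b ∨ m = k := by
    clear * - hab hbk hak
    revert a b k m; decide
  rcases hall with rfl | rfl | rfl
  · exact key k m hak.symm (Or.inl ⟨rfl, hak.symm⟩)
  · exact key k m hbk.symm (Or.inl ⟨rfl, hbk.symm⟩)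
  · exact key a m hak (Or.inr ⟨rfl, hak.symm⟩)

theorem eta_eh_zero (D : Determining σ B ξ η ζ) (i : Fin 3) {a b : Fin 3} (hab : a ≠ b) {q : Coord}
    (hq : q ∈ B) : fderiv ℝ (η i) q (eh a b) = 0 := by
  rw [D.eta_eh i hab q hq]
  exact Finset.sum_eq_zero fun m _ => by rw [D.xi_eh m hab hq, mul_zero]

theorem fderiv_xi_jetDir (D : Determining σ B ξ η ζ) (m n : Fin 3) {q : Coord} (hq : q ∈ B)
    {c : Fin 3 → ℝ} (l : Fin 3 → ℝ) (h : OffDiag → ℝ) :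
    fderiv ℝ (ξ m) q (jetDir c l h n) = fderiv ℝ (ξ m) q (baseDir l h n) := by
  have h1 : jetDir c l h n = baseDir l h n + (0, 0, dhForm c n h h) := by
    simp [jetDir, baseDir]
  rw [h1, map_add, linear_eh_eq_zero (fun i j hij => D.xi_eh m hij hq), add_zero]

theorem fderiv_eta_jetDir (D : Determining σ B ξ η ζ) (m n : Fin 3) {q : Coord} (hq : q ∈ B)
    {c : Fin 3 → ℝ} (l : Fin 3 → ℝ) (h : OffDiag → ℝ) :
    fderiv ℝ (η m) q (jetDir c l h n) = fderiv ℝ (η m) q (baseDir l h n) := by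
  have h1 : jetDir c l h n = baseDir l h n + (0, 0, dhForm c n h h) := by
    simp [jetDir, baseDir]
  rw [h1, map_add, linear_eh_eq_zero (fun i j hij => D.eta_eh_zero m hij hq), add_zero]

/-- The coefficients of the free derivatives in the equations `h_{ij,x_k} = h_{ik} h_{kj}`. -/
theorem coeff_h_off (D : Determining σ B ξ η ζ) {i j k : Fin 3} (hij : i ≠ j) (hjk : j ≠ k)
    (hik : i ≠ k) :
    (∀ q ∈ B, fderiv ℝ (ξ i) q (baseDir (cone σ q) q.2.2 k) = 0) ∧
    (∀ q ∈ B, fderiv ℝ (ζ i j) q (eh k i) = 0) ∧ (∀ q ∈ B, fderiv ℝ (ζ i j) q (eh i k) = 0) ∧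
    (∀ q ∈ B, fderiv ℝ (ζ i j) q (eh k j) = 0) ∧ (∀ q ∈ B, fderiv ℝ (ζ i j) q (eh j k) = 0) := by
  have key : ∀ q ∈ B, Generic q.2.2 → fderiv ℝ (ξ i) q (baseDir (cone σ q) q.2.2 k) = 0 ∧
      fderiv ℝ (ζ i j) q (eh k i) = 0 ∧ fderiv ℝ (ζ i j) q (eh i k) = 0 ∧
      fderiv ℝ (ζ i j) q (eh k j) = 0 ∧ fderiv ℝ (ζ i j) q (eh j k) = 0 := by
    intro q hq hgen
    set h := q.2.2 with hh_def
    set l := cone σ q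
    set W := fderiv ℝ (ζ i j) q with hWdef
    have := coeff_eq_zero_of_forall_admissible hgen hik.symm hij hjk.symm (A₁ := W (eh k i))
      (B₁ := -W (eh i k)) (A₂ := W (eh k j)) (B₂ := -W (eh j k))
      (A₃ := -fderiv ℝ (ξ i) q (baseDir l h k)) (B₃ := -fderiv ℝ (ξ j) q (baseDir l h k))
      (C := W (baseDir l h k) - hh h k j * hh h i j * W (eh i k) - hh h k i * hh h j i * W (eh j k)
        + hh h i k * hh h k j * W (eh i j) + hh h j k * hh h k i * W (eh j i)
        - fderiv ℝ (ξ k) q (baseDir l h k) * (hh h i k * hh h k j)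
        - (ζ i k q * hh h k j + hh h i k * ζ k j q)) (by
      intro c hc
      have h1 := D.h_off q hq c hc i j k hij hjk hik
      rw [← hWdef, sum_eq_of_distinct hij hjk hik] at h1
      simp only [D.fderiv_xi_jetDir _ _ hq] at h1
      rw [jetDir_eq hc _ _ hik.symm hij hjk.symm] at h1
      simp only [map_add, map_sub, map_smul, smul_eq_mul, hh_dhForm _ _ _ _ hij, hij.symm, hik.symm,
        hjk.symm, if_true, if_false, third_eq hij hjk hik] at h1
      linear_combination h1)
    refine ⟨neg_eq_zero.1 this.2.2.2.2.1, this.1, neg_eq_zero.1 this.2.1, this.2.2.1,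
      neg_eq_zero.1 this.2.2.2.1⟩
  have cζ : ∀ v, ContinuousOn (fun q => fderiv ℝ (ζ i j) q v) B := fun v =>
    (D.cont_fderiv (D.smooth_ζ i j)).clm_apply continuousOn_const
  exact ⟨eq_zero_of_generic D.isOpen ((D.cont_fderiv (D.smooth_ξ i)).clm_apply
      (continuous_baseDir σ k).continuousOn) fun q hq hg => (key q hq hg).1,
    eq_zero_of_generic D.isOpen (cζ _) fun q hq hg => (key q hq hg).2.1,
    eq_zero_of_generic D.isOpen (cζ _) fun q hq hg => (key q hq hg).2.2.1,
    eq_zero_of_generic D.isOpen (cζ _) fun q hq hg => (key q hq hg).2.2.2.1,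
    eq_zero_of_generic D.isOpen (cζ _) fun q hq hg => (key q hq hg).2.2.2.2⟩

end Determining

theorem baseDir_add_smul (l : Fin 3 → ℝ) (h w : OffDiag → ℝ) (t : ℝ) {i j k : Fin 3} (hij : i ≠ j)
    (hjk : j ≠ k) (hik : i ≠ k) : baseDir l (h + t • w) i = baseDir l h i
      + t • (hh w j i • rot l j i + hh w k i • rot l k i) := by
  rw [baseDir_eq l _ hij hjk hik, baseDir_eq l h hij hjk hik]
  simp only [hh_add, hh_smul]
  module

theorem add_smul_eh (q : Coord) (t : ℝ) (a b : Fin 3) :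
    (q + t • eh a b).2.2 = q.2.2 + t • unitH a b := rfl

theorem cone_add_smul_eh (σ : ℝ) (q : Coord) (t : ℝ) (a b : Fin 3) :
    cone σ (q + t • eh a b) = cone σ q := by
  have : q + t • eh a b = q + (0, 0, t • unitH a b) := by simp [eh]
  rw [this, cone_add_h]

theorem eq_sum_basis (v : Coord) :
    v = ∑ n, v.1 n • ex n + (0, v.2.1, 0) + (0, 0, v.2.2) := by
  refine Prod.ext ?_ (Prod.ext ?_ ?_)
  · ext i; fin_cases i <;> simp [Fin.sum_univ_three, ex]
  · simp [Fin.sum_univ_three, ex]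
  · simp [Fin.sum_univ_three, ex]

/-- The vectors `rot l a 1`, for `a = 0, 2`, span the tangent space of the Guichard cone. -/
theorem rot_span {l : Fin 3 → ℝ} (hl : l 1 ≠ 0) (s t : ℝ) :
    ((0, (s, t), 0) : Coord) = (s / l 1) • rot l 0 1 + (t / l 1) • rot l 2 1 := by
  refine Prod.ext ?_ (Prod.ext (Prod.ext ?_ ?_) ?_) <;> simp [rot, hl]

theorem rot_symm (l : Fin 3 → ℝ) {a n : Fin 3} (han : a ≠ n) :
    rot l n a = (-(eps a * eps n)) • rot l a n := by
  refine Prod.ext (by simp [rot]) (Prod.ext (Prod.ext ?_ ?_) (by simp [rot]))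
  · fin_cases a <;> fin_cases n <;> simp_all [rot, eps]
  · fin_cases a <;> fin_cases n <;> simp_all [rot, eps]

theorem rot_relation (l : Fin 3 → ℝ) {i j k : Fin 3} (hij : i ≠ j) (hjk : j ≠ k) (hik : i ≠ k) :
    l k • rot l i j - l j • rot l i k = (eps i * eps k * l i) • rot l k j := by
  refine Prod.ext (by simp [rot]) (Prod.ext (Prod.ext ?_ ?_) (by simp [rot]))
  · revert hij hjk hik
    fin_cases i <;> fin_cases j <;> fin_cases k <;> simp [rot, eps] <;> ring
  · revert hij hjk hik
    fin_cases i <;> fin_cases j <;> fin_cases k <;> simp [rot, eps] <;> ring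

namespace Determining

variable {σ : ℝ} {B : Set Coord} {ξ η : Fin 3 → Coord → ℝ} {ζ : Fin 3 → Fin 3 → Coord → ℝ}

/-- `ξ` is invariant, with its differential, when one entry of `h` changes. -/
theorem xi_add_smul_eh (D : Determining σ B ξ η ζ) (m : Fin 3) {a b : Fin 3} (hab : a ≠ b)
    {q : Coord} (hq : q ∈ B) {t : ℝ} (ht : q + t • eh a b ∈ B) :
    fderiv ℝ (ξ m) (q + t • eh a b) = fderiv ℝ (ξ m) q :=
  (eq_of_fderiv_apply_eq_zero D.isOpen D.convex (D.diff_ξ m)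
    (fun p hp => by rw [map_smul, D.xi_eh m hab hp, smul_zero]) hq ht).2

theorem eta_add_smul_eh (D : Determining σ B ξ η ζ) (m : Fin 3) {a b : Fin 3} (hab : a ≠ b)
    {q : Coord} (hq : q ∈ B) {t : ℝ} (ht : q + t • eh a b ∈ B) :
    η m (q + t • eh a b) = η m q ∧ fderiv ℝ (η m) (q + t • eh a b) = fderiv ℝ (η m) q :=
  eq_of_fderiv_apply_eq_zero D.isOpen D.convex (D.diff_η m)
    (fun p hp => by rw [map_smul, D.eta_eh_zero m hab hp, smul_zero]) hq ht

/-- The derivative of `ξ_i` along solutions in the direction of `x_k` vanishes identically in `h`, and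
in it `h_{ak}` multiplies the derivative along `rot l a k`. -/
theorem xi_rot (D : Determining σ B ξ η ζ) {i k a : Fin 3} (hik : i ≠ k) (hak : a ≠ k) {q : Coord}
    (hq : q ∈ B) : fderiv ℝ (ξ i) q (rot (cone σ q) a k) = 0 := by
  obtain ⟨b, hkb, hab⟩ := exists_third hak
  have hX : ∀ q ∈ B, fderiv ℝ (ξ i) q (baseDir (cone σ q) q.2.2 k) = 0 := by
    obtain ⟨j, hkj, hij⟩ := exists_third hik
    exact (D.coeff_h_off hij hkj.symm hik).1
  obtain ⟨δ, hδ, hδB⟩ := exists_add_smul_mem D.isOpen hq (eh a k)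
  have h1 := hX _ hδB
  rw [D.xi_add_smul_eh i hak hq hδB, cone_add_smul_eh, add_smul_eh,
    baseDir_add_smul _ _ _ _ hak.symm hab hkb, map_add, hX q hq,
    hh_unitH _ _ hak, hh_unitH _ _ hak] at h1
  simpa [hab.symm, hδ] using h1

theorem xi_ex (D : Determining σ B ξ η ζ) {i k : Fin 3} (hik : i ≠ k) {q : Coord} (hq : q ∈ B) :
    fderiv ℝ (ξ i) q (ex k) = 0 := by
  obtain ⟨j, hkj, hij⟩ := exists_third hik
  have h1 := (D.coeff_h_off hij hkj.symm hik).1 q hq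
  rw [baseDir_eq _ _ hik.symm hij hkj] at h1
  simpa [D.xi_rot hik hik hq, D.xi_rot hik hkj.symm hq] using h1

/-- `ξ_i` depends on `x_i` only. -/
theorem fderiv_xi (D : Determining σ B ξ η ζ) (i : Fin 3) {q : Coord} (hq : q ∈ B) (v : Coord) :
    fderiv ℝ (ξ i) q v = v.1 i * fderiv ℝ (ξ i) q (ex i) := by
  have hrot : ∀ a : Fin 3, a ≠ 1 → fderiv ℝ (ξ i) q (rot (cone σ q) a 1) = 0 := by
    intro a ha
    by_cases hi : i = 1
    · subst hi
      rw [rot_symm _ ha.symm, map_smul, D.xi_rot ha.symm ha.symm hq, smul_zero]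
    · exact D.xi_rot hi ha hq
  have hl : fderiv ℝ (ξ i) q (0, v.2.1, 0) = 0 := by
    have := rot_span (D.cone_ne q hq 1) v.2.1.1 v.2.1.2
    rw [show ((0, v.2.1, 0) : Coord) = (0, (v.2.1.1, v.2.1.2), 0) from rfl, this, map_add, map_smul,
      map_smul, hrot 0 (by decide), hrot 2 (by decide), smul_zero, smul_zero, add_zero]
  conv_lhs => rw [eq_sum_basis v]
  rw [map_add, map_add, hl, linear_eh_eq_zero (fun a b hab => D.xi_eh i hab hq), map_sum,
    Finset.sum_eq_single i]
  · simp
  · intro k _ hk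
    rw [map_smul, D.xi_ex hk.symm hq, smul_zero]
  · simp

/-- The `l`-equations determine `ζ`. -/
theorem zeta_mul_cone (D : Determining σ B ξ η ζ) {i j k : Fin 3} (hij : i ≠ j) (hjk : j ≠ k)
    (hik : i ≠ k) {q : Coord} (hq : q ∈ B) :
    ζ i j q * cone σ q j = fderiv ℝ (η i) q (ex j)
      + hh q.2.2 i j * (fderiv ℝ (η i) q (rot (cone σ q) i j)
        - fderiv ℝ (ξ j) q (ex j) * cone σ q j - η j q)
      + hh q.2.2 k j * fderiv ℝ (η i) q (rot (cone σ q) k j) := by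
  have h1 := D.l_off q hq _ admissible_one_one_zero i j hij
  rw [D.fderiv_eta_jetDir _ _ hq, sum_eq_of_distinct hij hjk hik] at h1
  simp only [D.fderiv_xi_jetDir _ _ hq] at h1
  rw [D.fderiv_xi i hq, D.fderiv_xi j hq, D.fderiv_xi k hq,
    baseDir_eq _ _ hij.symm hik hjk] at h1
  simp only [map_add, map_smul, smul_eq_mul, ex, rot, dl_of_ne _ _ hij] at h1 ⊢
  simp [hij, hjk.symm] at h1
  linear_combination -h1

/-- From `zeta_mul_cone`, by varying `h_{kj}`, on which `ζ_{ij}` does not depend. -/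
theorem eta_rot_zero (D : Determining σ B ξ η ζ) {i j k : Fin 3} (hij : i ≠ j) (hjk : j ≠ k)
    (hik : i ≠ k) {q : Coord} (hq : q ∈ B) : fderiv ℝ (η i) q (rot (cone σ q) k j) = 0 := by
  obtain ⟨δ, hδ, hδB⟩ := exists_add_smul_mem D.isOpen hq (eh k j)
  have hζ : ζ i j (q + δ • eh k j) = ζ i j q :=
    (eq_of_fderiv_apply_eq_zero D.isOpen D.convex (D.diff_ζ i j) (fun p hp => by
      rw [map_smul, (D.coeff_h_off hij hjk hik).2.2.2.1 p hp, smul_zero]) hq hδB).1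
  have h1 := D.zeta_mul_cone hij hjk hik hq
  have h2 := D.zeta_mul_cone hij hjk hik hδB
  rw [hζ, cone_add_smul_eh, (D.eta_add_smul_eh i hjk.symm hq hδB).2,
    D.xi_add_smul_eh j hjk.symm hq hδB, (D.eta_add_smul_eh j hjk.symm hq hδB).1, add_smul_eh,
    hh_add, hh_add, hh_smul, hh_smul, hh_unitH _ _ hjk.symm, hh_unitH _ _ hjk.symm, h1] at h2
  simp only [hik, false_and, and_self, if_true, if_false, mul_one, mul_zero, add_zero] at h2
  have h3 : δ * fderiv ℝ (η i) q (rot (cone σ q) k j) = 0 := by linear_combination -h2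
  exact (mul_eq_zero.1 h3).resolve_left hδ

/-- `ζ_{ij}` is an affine function of `h_{ij}` with coefficients that do not depend on `h`. -/
theorem zeta_eq (D : Determining σ B ξ η ζ) {i j : Fin 3} (hij : i ≠ j) {q : Coord} (hq : q ∈ B) :
    ζ i j q * cone σ q j = fderiv ℝ (η i) q (ex j)
      + hh q.2.2 i j * (fderiv ℝ (η i) q (rot (cone σ q) i j)
        - fderiv ℝ (ξ j) q (ex j) * cone σ q j - η j q) := by
  obtain ⟨k, hjk, hik⟩ := exists_third hij
  rw [D.zeta_mul_cone hij hjk hik hq, D.eta_rot_zero hij hjk hik hq, mul_zero, add_zero]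

theorem zeta_line (D : Determining σ B ξ η ζ) {i j : Fin 3} (hij : i ≠ j) {a b : Fin 3}
    (hab : a ≠ b) {q : Coord} (hq : q ∈ B) {t : ℝ} (ht : q + t • eh a b ∈ B) :
    ζ i j (q + t • eh a b) * cone σ q j = ζ i j q * cone σ q j
      + t * (if i = a ∧ j = b then (fderiv ℝ (η i) q (rot (cone σ q) i j)
        - fderiv ℝ (ξ j) q (ex j) * cone σ q j - η j q) else 0) := by
  have h1 := D.zeta_eq hij hq
  have h2 := D.zeta_eq hij ht
  rw [cone_add_smul_eh, (D.eta_add_smul_eh i hab hq ht).2,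
    D.xi_add_smul_eh j hab hq ht, (D.eta_add_smul_eh j hab hq ht).1, add_smul_eh,
    hh_add, hh_smul, hh_unitH _ _ hab] at h2
  rw [h2, h1]
  split_ifs <;> ring

theorem zeta_eh (D : Determining σ B ξ η ζ) {i j : Fin 3} (hij : i ≠ j) {a b : Fin 3}
    (hab : a ≠ b) {q : Coord} (hq : q ∈ B) :
    fderiv ℝ (ζ i j) q (eh a b) = if i = a ∧ j = b then
      (fderiv ℝ (η i) q (rot (cone σ q) i j) - η j q) / cone σ q j
        - fderiv ℝ (ξ j) q (ex j) else 0 := by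
  have hl := D.cone_ne q hq j
  refine fderiv_apply_of_affine D.isOpen hq (D.diff_ζ i j) fun t ht => ?_
  have := D.zeta_line hij hab hq ht
  rw [← mul_left_inj' hl, this]
  split_ifs
  · field_simp
    ring
  · ring

theorem zeta_add_smul_eh (D : Determining σ B ξ η ζ) {i j : Fin 3} (hij : i ≠ j) {a b : Fin 3}
    (hab : a ≠ b) {q : Coord} (hq : q ∈ B) {t : ℝ} (ht : q + t • eh a b ∈ B) :
    ζ i j (q + t • eh a b) = ζ i j q + t * fderiv ℝ (ζ i j) q (eh a b) := by
  have hl := D.cone_ne q hq j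
  have := D.zeta_line hij hab hq ht
  rw [← mul_left_inj' hl, this, D.zeta_eh hij hab hq]
  split_ifs
  · field_simp
    ring
  · ring

theorem coeff_add_smul_eh (D : Determining σ B ξ η ζ) {i j : Fin 3} (hij : i ≠ j) {a b : Fin 3}
    (hab : a ≠ b) {q : Coord} (hq : q ∈ B) {t : ℝ} (ht : q + t • eh a b ∈ B) :
    fderiv ℝ (ζ i j) (q + t • eh a b) (eh i j) = fderiv ℝ (ζ i j) q (eh i j) := by
  rw [D.zeta_eh hij hij hq, D.zeta_eh hij hij ht, cone_add_smul_eh,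
    (D.eta_add_smul_eh i hab hq ht).2, D.xi_add_smul_eh j hab hq ht,
    (D.eta_add_smul_eh j hab hq ht).1]

/-- The equations `h_{ij,x_k} = h_{ik} h_{kj}`, after the terms with free derivatives are gone. -/
theorem h_off_reduced (D : Determining σ B ξ η ζ) {i j k : Fin 3} (hij : i ≠ j) (hjk : j ≠ k)
    (hik : i ≠ k) {q : Coord} (hq : q ∈ B) :
    fderiv ℝ (ζ i j) q (baseDir (cone σ q) q.2.2 k)
      + hh q.2.2 i k * hh q.2.2 k j * (fderiv ℝ (ζ i j) q (eh i j) - fderiv ℝ (ξ k) q (ex k))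
      = ζ i k q * hh q.2.2 k j + hh q.2.2 i k * ζ k j q := by
  have h1 := D.h_off q hq _ admissible_one_one_zero i j k hij hjk hik
  rw [sum_eq_of_distinct hij hjk hik] at h1
  simp only [D.fderiv_xi_jetDir _ _ hq] at h1
  rw [D.fderiv_xi i hq, D.fderiv_xi j hq, D.fderiv_xi k hq,
    jetDir_eq admissible_one_one_zero _ _ hik.symm hij hjk.symm] at h1
  simp only [map_add, map_sub, map_smul, smul_eq_mul, hh_dhForm _ _ _ _ hij, hik.symm,
    hjk.symm, if_false, D.zeta_eh hij hik.symm hq, D.zeta_eh hij hik hq,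
    D.zeta_eh hij hjk hq, D.zeta_eh hij hjk.symm hq, D.zeta_eh hij hij.symm hq, hik, hjk, hij,
    false_and, and_false, mul_zero] at h1
  simp [baseDir, hik, hjk] at h1
  simp only [baseDir]
  linear_combination h1

/-- The relation between the coefficients of `ζ`, from varying `h_{kj}`. -/
theorem zeta_eq_mul (D : Determining σ B ξ η ζ) {i j k : Fin 3} (hij : i ≠ j) (hjk : j ≠ k)
    (hik : i ≠ k) {q : Coord} (hq : q ∈ B) :
    ζ i k q = hh q.2.2 i k * (fderiv ℝ (ζ i j) q (eh i j) - fderiv ℝ (ξ k) q (ex k)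
      - fderiv ℝ (ζ k j) q (eh k j)) := by
  obtain ⟨δ, hδ, hδB⟩ := exists_add_smul_mem D.isOpen hq (eh k j)
  have hζ : fderiv ℝ (ζ i j) (q + δ • eh k j) = fderiv ℝ (ζ i j) q :=
    (eq_of_fderiv_apply_eq_zero D.isOpen D.convex (D.diff_ζ i j) (fun p hp => by
      rw [map_smul, (D.coeff_h_off hij hjk hik).2.2.2.1 p hp, smul_zero]) hq hδB).2
  have h1 := D.h_off_reduced hij hjk hik hq
  have h2 := D.h_off_reduced hij hjk hik hδB
  rw [hζ, cone_add_smul_eh, D.xi_add_smul_eh k hjk.symm hq hδB,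
    D.zeta_add_smul_eh hik hjk.symm hq hδB, D.zeta_add_smul_eh hjk.symm hjk.symm hq hδB,
    D.zeta_eh hik hjk.symm hq, add_smul_eh, baseDir_add_smul _ _ _ _ hik.symm hij hjk.symm] at h2
  simp only [hh_add, hh_smul, hh_unitH _ _ hjk.symm, hik, hjk, false_and, and_self, if_true,
    if_false, mul_one, mul_zero, add_zero, zero_smul, smul_zero] at h2
  have h3 : δ * (ζ i k q - hh q.2.2 i k * (fderiv ℝ (ζ i j) q (eh i j) - fderiv ℝ (ξ k) q (ex k)
      - fderiv ℝ (ζ k j) q (eh k j))) = 0 := by linear_combination h1 - h2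
  exact sub_eq_zero.1 ((mul_eq_zero.1 h3).resolve_left hδ)

/-- `ζ_{ik} = c_{ik} h_{ik}`, where the coefficients satisfy a linear relation. -/
theorem coeff_relation (D : Determining σ B ξ η ζ) {i j k : Fin 3} (hij : i ≠ j) (hjk : j ≠ k)
    (hik : i ≠ k) {q : Coord} (hq : q ∈ B) :
    fderiv ℝ (ζ i k) q (eh i k) = fderiv ℝ (ζ i j) q (eh i j) - fderiv ℝ (ξ k) q (ex k)
      - fderiv ℝ (ζ k j) q (eh k j) := by
  refine fderiv_apply_of_affine D.isOpen hq (D.diff_ζ i k) fun t ht => ?_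
  rw [D.zeta_eq_mul hij hjk hik hq, D.zeta_eq_mul hij hjk hik ht, D.xi_add_smul_eh k hik hq ht,
    D.coeff_add_smul_eh hij hik hq ht, D.coeff_add_smul_eh hjk.symm hik hq ht, add_smul_eh,
    hh_add, hh_smul, hh_unitH _ _ hik]
  simp only [and_self, if_true]
  ring

theorem zeta_eq_coeff_mul (D : Determining σ B ξ η ζ) {i k : Fin 3} (hik : i ≠ k) {q : Coord}
    (hq : q ∈ B) : ζ i k q = hh q.2.2 i k * fderiv ℝ (ζ i k) q (eh i k) := by
  obtain ⟨j, hkj, hij⟩ := exists_third hik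
  rw [D.zeta_eq_mul hij hkj.symm hik hq, D.coeff_relation hij hkj.symm hik hq]

/-- The term of `ζ_{ik}` that does not depend on `h` vanishes. -/
theorem eta_ex (D : Determining σ B ξ η ζ) {i k : Fin 3} (hik : i ≠ k) {q : Coord} (hq : q ∈ B) :
    fderiv ℝ (η i) q (ex k) = 0 := by
  have h1 := D.zeta_eq hik hq
  rw [D.zeta_eq_coeff_mul hik hq, D.zeta_eh hik hik hq] at h1
  have hl := D.cone_ne q hq k
  simp only [and_self, if_true] at h1
  field_simp at h1
  linear_combination -h1

/-- The coefficients of the free derivative `h_{ij,x_j}` in the equation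
`h_{ij,x_j} + h_{ji,x_i} + h_{ik} h_{jk} = 0`. -/
theorem coeff_h_sum (D : Determining σ B ξ η ζ) {i j : Fin 3} (hij : i ≠ j) {q : Coord}
    (hq : q ∈ B) : fderiv ℝ (ζ i j) q (eh i j) - fderiv ℝ (ζ j i) q (eh j i)
      = fderiv ℝ (ξ j) q (ex j) - fderiv ℝ (ξ i) q (ex i) := by
  have cζ : ∀ i j v, ContinuousOn (fun q => fderiv ℝ (ζ i j) q v) B := fun i j v =>
    (D.cont_fderiv (D.smooth_ζ i j)).clm_apply continuousOn_const
  have cξ : ∀ i v, ContinuousOn (fun q => fderiv ℝ (ξ i) q v) B := fun i v =>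
    (D.cont_fderiv (D.smooth_ξ i)).clm_apply continuousOn_const
  obtain ⟨k, hjk, hik⟩ := exists_third hij
  have key := eq_zero_of_generic (f := fun q => fderiv ℝ (ζ i j) q (eh i j)
    - fderiv ℝ (ζ j i) q (eh j i) - (fderiv ℝ (ξ j) q (ex j) - fderiv ℝ (ξ i) q (ex i))) D.isOpen
    (((cζ _ _ _).sub (cζ _ _ _)).sub ((cξ _ _).sub (cξ _ _))) (fun q hq hgen => by
      have hu := fun c (hc : Admissible c) => D.h_sum q hq c hc i j k hij hjk hik
      refine (coeff_eq_zero_of_forall_admissible hgen hij hjk hik (A₁ := 0) (A₂ := 0) (B₂ := 0)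
        (A₃ := 0) (B₃ := 0) (B₁ := fderiv ℝ (ζ i j) q (eh i j)
          - fderiv ℝ (ζ j i) q (eh j i) - (fderiv ℝ (ξ j) q (ex j) - fderiv ℝ (ξ i) q (ex i)))
        (C := fderiv ℝ (ζ i j) q (baseDir (cone σ q) q.2.2 j)
          + fderiv ℝ (ζ j i) q (baseDir (cone σ q) q.2.2 i)
          - hh q.2.2 i k * hh q.2.2 j k * fderiv ℝ (ζ j i) q (eh j i)
          + hh q.2.2 i k * hh q.2.2 j k * fderiv ℝ (ξ i) q (ex i)
          + (ζ i k q * hh q.2.2 j k + hh q.2.2 i k * ζ j k q)) ?_).2.1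
      intro c hc
      have h1 := hu c hc
      rw [sum_eq_of_distinct hij hjk hik, sum_eq_of_distinct hij hjk hik] at h1
      simp only [D.fderiv_xi_jetDir _ _ hq] at h1
      rw [D.fderiv_xi i hq, D.fderiv_xi j hq, D.fderiv_xi k hq, D.fderiv_xi i hq (baseDir _ _ i),
        D.fderiv_xi j hq (baseDir _ _ i), D.fderiv_xi k hq (baseDir _ _ i),
        jetDir_eq hc _ _ hij hjk hik, jetDir_eq hc _ _ hij.symm hik hjk] at h1
      simp only [map_add, map_sub, map_smul, smul_eq_mul, D.zeta_eh hij hik.symm hq,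
        D.zeta_eh hij hik hq, D.zeta_eh hij hjk hq, D.zeta_eh hij hjk.symm hq,
        D.zeta_eh hij hij.symm hq, D.zeta_eh hij.symm hik.symm hq, D.zeta_eh hij.symm hik hq,
        D.zeta_eh hij.symm hjk hq, D.zeta_eh hij.symm hjk.symm hq, D.zeta_eh hij.symm hij hq,
        hik, hjk, hij, hij.symm, false_and, and_false, if_false, mul_zero] at h1
      simp [baseDir, hik.symm, hjk.symm, hij, hij.symm, hh_dhForm _ _ _ _ hij,
        hh_dhForm _ _ _ _ hij.symm, third_eq hij hjk hik, third_eq hij.symm hik hjk,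
        dhCol_add_dhCol hc q.2.2 hij hjk hik] at h1
      simp only [baseDir]
      linear_combination h1)
  exact sub_eq_zero.1 (key q hq)

/-- The coefficients of the free derivative `h_{ij,x_i}` in the equation
`ε_i h_{ij,x_i} + ε_j h_{ji,x_j} + ε_k h_{ki} h_{kj} = 0`. -/
theorem coeff_h_eps (D : Determining σ B ξ η ζ) {i j : Fin 3} (hij : i ≠ j) {q : Coord}
    (hq : q ∈ B) : fderiv ℝ (ζ i j) q (eh i j) - fderiv ℝ (ζ j i) q (eh j i)
      = fderiv ℝ (ξ i) q (ex i) - fderiv ℝ (ξ j) q (ex j) := by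
  have cζ : ∀ i j v, ContinuousOn (fun q => fderiv ℝ (ζ i j) q v) B := fun i j v =>
    (D.cont_fderiv (D.smooth_ζ i j)).clm_apply continuousOn_const
  have cξ : ∀ i v, ContinuousOn (fun q => fderiv ℝ (ξ i) q v) B := fun i v =>
    (D.cont_fderiv (D.smooth_ξ i)).clm_apply continuousOn_const
  obtain ⟨k, hjk, hik⟩ := exists_third hij
  have key := eq_zero_of_generic (f := fun q => fderiv ℝ (ζ i j) q (eh i j)
    - fderiv ℝ (ζ j i) q (eh j i) - (fderiv ℝ (ξ i) q (ex i) - fderiv ℝ (ξ j) q (ex j))) D.isOpen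
    (((cζ _ _ _).sub (cζ _ _ _)).sub ((cξ _ _).sub (cξ _ _))) (fun q hq hgen => by
      have hu := fun c (hc : Admissible c) => D.h_eps q hq c hc i j k hij hjk hik
      have h0 := (coeff_eq_zero_of_forall_admissible hgen hij hjk hik (B₁ := 0) (A₂ := 0) (B₂ := 0)
        (A₃ := 0) (B₃ := 0) (A₁ := eps i * (fderiv ℝ (ζ i j) q (eh i j)
          - fderiv ℝ (ζ j i) q (eh j i) - (fderiv ℝ (ξ i) q (ex i) - fderiv ℝ (ξ j) q (ex j))))
        (C := eps i * fderiv ℝ (ζ i j) q (baseDir (cone σ q) q.2.2 i)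
          + eps j * fderiv ℝ (ζ j i) q (baseDir (cone σ q) q.2.2 j)
          - eps k * hh q.2.2 k i * hh q.2.2 k j * fderiv ℝ (ζ j i) q (eh j i)
          + eps k * hh q.2.2 k i * hh q.2.2 k j * fderiv ℝ (ξ j) q (ex j)
          + eps k * (ζ k i q * hh q.2.2 k j + hh q.2.2 k i * ζ k j q)) ?_).1
      · have := eps_mul_self i
        refine (mul_eq_zero.1 h0).resolve_left fun h => ?_
        rw [h] at this
        norm_num at this
      intro c hc
      have h1 := hu c hc
      rw [sum_eq_of_distinct hij hjk hik, sum_eq_of_distinct hij hjk hik] at h1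
      simp only [D.fderiv_xi_jetDir _ _ hq] at h1
      rw [D.fderiv_xi i hq, D.fderiv_xi j hq, D.fderiv_xi k hq, D.fderiv_xi i hq (baseDir _ _ j),
        D.fderiv_xi j hq (baseDir _ _ j), D.fderiv_xi k hq (baseDir _ _ j),
        jetDir_eq hc _ _ hij hjk hik, jetDir_eq hc _ _ hij.symm hik hjk] at h1
      simp only [map_add, map_sub, map_smul, smul_eq_mul, D.zeta_eh hij hik.symm hq,
        D.zeta_eh hij hik hq, D.zeta_eh hij hjk hq, D.zeta_eh hij hjk.symm hq,
        D.zeta_eh hij hij.symm hq, D.zeta_eh hij.symm hik.symm hq, D.zeta_eh hij.symm hik hq,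
        D.zeta_eh hij.symm hjk hq, D.zeta_eh hij.symm hjk.symm hq, D.zeta_eh hij.symm hij hq,
        hik, hjk, hij, hij.symm, false_and, and_false, if_false, mul_zero] at h1
      simp [baseDir, hik.symm, hjk.symm, hij, hij.symm, hh_dhForm _ _ _ _ hij,
        hh_dhForm _ _ _ _ hij.symm, third_eq hij hjk hik, third_eq hij.symm hik hjk] at h1
      simp only [baseDir]
      have h2 := dhRow_add_dhRow hc q.2.2 hij hjk hik
      linear_combination h1 - (fderiv ℝ (ζ j i) q (eh j i) - fderiv ℝ (ξ j) q (ex j)) * h2)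
  exact sub_eq_zero.1 (key q hq)

/-- The equations `coeff_h_sum` and `coeff_h_eps` have opposite right-hand sides. -/
theorem fderiv_xi_ex_eq (D : Determining σ B ξ η ζ) (i j : Fin 3) {q : Coord} (hq : q ∈ B) :
    fderiv ℝ (ξ i) q (ex i) = fderiv ℝ (ξ j) q (ex j) := by
  by_cases hij : i = j
  · rw [hij]
  · linarith [D.coeff_h_sum hij hq, D.coeff_h_eps hij hq]

/-- The sum of `coeff_relation` for `(i, k, j)` and for `(j, k, i)`, as `c_{ij}` is symmetric. -/
theorem coeff_eq_neg (D : Determining σ B ξ η ζ) {i j : Fin 3} (hij : i ≠ j) {q : Coord}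
    (hq : q ∈ B) : fderiv ℝ (ζ i j) q (eh i j) = -fderiv ℝ (ξ 0) q (ex 0) := by
  obtain ⟨k, hjk, hik⟩ := exists_third hij
  have e1 := D.coeff_relation hik hjk.symm hij hq
  have e2 := D.coeff_relation hjk hik.symm hij.symm hq
  have e3 := D.coeff_h_sum hij hq
  have e4 := D.coeff_h_sum hik hq
  rw [D.fderiv_xi_ex_eq i 0 hq, D.fderiv_xi_ex_eq j 0 hq] at e3
  rw [D.fderiv_xi_ex_eq i 0 hq, D.fderiv_xi_ex_eq k 0 hq] at e4
  rw [D.fderiv_xi_ex_eq j 0 hq] at e1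
  rw [D.fderiv_xi_ex_eq i 0 hq] at e2
  linarith

theorem const_of_fderiv_eq_zero (D : Determining σ B ξ η ζ) {f : Coord → ℝ}
    (hf : DifferentiableOn ℝ f B) (h : ∀ q ∈ B, ∀ v, fderiv ℝ f q v = 0) :
    ∃ c, ∀ q ∈ B, f q = c := by
  rcases B.eq_empty_or_nonempty with rfl | ⟨q₀, hq₀⟩
  · exact ⟨0, by simp⟩
  · refine ⟨f q₀, fun q hq => ?_⟩
    have := (eq_of_fderiv_apply_eq_zero D.isOpen D.convex hf (τ := q - q₀)
      (fun p hp => h p hp _) hq₀ (by simpa using hq)).1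
    simpa using this

/-- `∂ξ_0/∂x_0` is constant: it depends on `x_0` only and equals `∂ξ_1/∂x_1`, which depends on
`x_1` only. -/
theorem dilation_const (D : Determining σ B ξ η ζ) :
    ∃ g, ∀ q ∈ B, ∀ i, fderiv ℝ (ξ i) q (ex i) = g := by
  have hG : ContDiffOn ℝ 1 (fun q => fderiv ℝ (ξ 0) q (ex 0)) B :=
    ((D.smooth_ξ 0).fderiv_of_isOpen D.isOpen (m := 1) (by norm_cast)).clm_apply contDiffOn_const
  have hGd : DifferentiableOn ℝ (fun q => fderiv ℝ (ξ 0) q (ex 0)) B :=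
    hG.differentiableOn (by simp)
  have hi : ∀ (i : Fin 3) (v : Coord), v.1 i = 0 → ∀ q ∈ B,
      fderiv ℝ (fun q => fderiv ℝ (ξ 0) q (ex 0)) q v = 0 := by
    intro i v hv q hq
    refine fderiv_apply_of_affine D.isOpen hq hGd fun t ht => ?_
    rw [D.fderiv_xi_ex_eq 0 i hq, D.fderiv_xi_ex_eq 0 i ht,
      (eq_of_fderiv_apply_eq_zero D.isOpen D.convex (D.diff_ξ i) (fun p hp => by
        rw [D.fderiv_xi i hp, Prod.smul_fst, Pi.smul_apply, hv, smul_zero, zero_mul]) hq ht).2,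
      mul_zero, add_zero]
  obtain ⟨g, hg⟩ := D.const_of_fderiv_eq_zero hGd fun q hq v => by
    have hv : v = (v - v.1 0 • ex 0) + v.1 0 • ex 0 := by abel
    rw [hv, map_add, hi 0 _ (by simp [ex]) q hq, hi 1 _ (by simp [ex]) q hq, add_zero]
  exact ⟨g, fun q hq i => (D.fderiv_xi_ex_eq i 0 hq).trans (hg q hq)⟩

theorem eta_rot (D : Determining σ B ξ η ζ) {i j : Fin 3} (hij : i ≠ j) {q : Coord} (hq : q ∈ B) :
    fderiv ℝ (η i) q (rot (cone σ q) i j) = η j q := by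
  have h1 := D.zeta_eh hij hij hq
  rw [D.coeff_eq_neg hij hq, D.fderiv_xi_ex_eq j 0 hq] at h1
  simp only [and_self, if_true] at h1
  have h2 : (fderiv ℝ (η i) q (rot (cone σ q) i j) - η j q) / cone σ q j = 0 := by linarith
  rw [div_eq_zero_iff] at h2
  exact sub_eq_zero.1 (h2.resolve_right (D.cone_ne q hq j))

/-- `η` is proportional to `l`. -/
theorem cone_mul_eta (D : Determining σ B ξ η ζ) (j k : Fin 3) {q : Coord} (hq : q ∈ B) :
    cone σ q k * η j q = cone σ q j * η k q := by
  by_cases hjk : j = k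
  · rw [hjk]
  · obtain ⟨i, hki, hji⟩ := exists_third hjk
    have h1 := congrArg (fderiv ℝ (η i) q) (rot_relation (cone σ q) hji.symm hjk hki.symm)
    simp only [map_sub, map_smul, smul_eq_mul, D.eta_rot hji.symm hq, D.eta_rot hki.symm hq,
      D.eta_rot_zero hji.symm hjk hki.symm hq, mul_zero] at h1
    linarith

theorem eta_ex_zero (D : Determining σ B ξ η ζ) (i k : Fin 3) {q : Coord} (hq : q ∈ B) :
    fderiv ℝ (η i) q (ex k) = 0 := by
  by_cases hik : i = k
  · subst hik
    obtain ⟨j, hij⟩ : ∃ j, i ≠ j := by revert i; decide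
    refine fderiv_apply_of_affine D.isOpen hq (D.diff_η i) fun t ht => ?_
    have h1 := D.cone_mul_eta i j hq
    have h2 := D.cone_mul_eta i j ht
    have hc : cone σ (q + t • ex i) = cone σ q := by simp [cone, ex]
    have hj : η j (q + t • ex i) = η j q :=
      (eq_of_fderiv_apply_eq_zero D.isOpen D.convex (D.diff_η j) (fun p hp => by
        rw [map_smul, D.eta_ex hij.symm hp, smul_zero]) hq ht).1
    rw [hc, hj, ← h1] at h2
    rw [mul_left_cancel₀ (D.cone_ne q hq j) h2, mul_zero, add_zero]
  · exact D.eta_ex hik hq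

/-- The solutions of the determining equations: translations and dilations. -/
theorem exists_eq (D : Determining σ B ξ η ζ) : ∃ (g ρ : ℝ) (v : Fin 3 → ℝ), ∀ q ∈ B,
    (∀ i, ξ i q = g * q.1 i + v i) ∧ (∀ i, η i q = ρ * cone σ q i) ∧
    ∀ i j, i ≠ j → ζ i j q = -g * hh q.2.2 i j := by
  obtain ⟨g, hg⟩ := D.dilation_const
  have hξ : ∀ i, ∃ c, ∀ q ∈ B, ξ i q - g * q.1 i = c := by
    intro i
    set L : Coord →L[ℝ] ℝ := g • (ContinuousLinearMap.proj (R := ℝ) (φ := fun _ : Fin 3 => ℝ) i).comp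
      (ContinuousLinearMap.fst ℝ Indep ((ℝ × ℝ) × (OffDiag → ℝ))) with hL
    have hd : ∀ q ∈ B, HasFDerivAt (fun q : Coord => ξ i q - g * q.1 i)
        (fderiv ℝ (ξ i) q - L) q := fun q hq =>
      ((D.diff_ξ i).differentiableAt (D.isOpen.mem_nhds hq)).hasFDerivAt.sub L.hasFDerivAt
    refine D.const_of_fderiv_eq_zero
      (fun q hq => (hd q hq).differentiableAt.differentiableWithinAt) fun q hq v => ?_
    rw [(hd q hq).fderiv, sub_apply, D.fderiv_xi i hq, hg q hq]
    simp [hL, mul_comm]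
  choose v hv using hξ
  have hη : ∃ ρ, ∀ q ∈ B, η 0 q * (q.2.1.1)⁻¹ = ρ := by
    set L : Coord →L[ℝ] ℝ := (ContinuousLinearMap.fst ℝ ℝ ℝ).comp
      ((ContinuousLinearMap.fst ℝ (ℝ × ℝ) (OffDiag → ℝ)).comp
        (ContinuousLinearMap.snd ℝ Indep ((ℝ × ℝ) × (OffDiag → ℝ)))) with hL
    have hne : ∀ q ∈ B, q.2.1.1 ≠ 0 := fun q hq => D.cone_ne q hq 0
    have hd : ∀ q ∈ B, HasFDerivAt (fun q : Coord => η 0 q * (q.2.1.1)⁻¹) _ q := fun q hq =>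
      ((D.diff_η 0).differentiableAt (D.isOpen.mem_nhds hq)).hasFDerivAt.fun_mul
        ((hasDerivAt_inv (hne q hq)).comp_hasFDerivAt q L.hasFDerivAt)
    refine D.const_of_fderiv_eq_zero
      (fun q hq => (hd q hq).differentiableAt.differentiableWithinAt) fun q hq w => ?_
    have h1 : fderiv ℝ (η 0) q w * q.2.1.1 - η 0 q * w.2.1.1 = 0 := by
      have hl : fderiv ℝ (η 0) q (0, w.2.1, 0) * q.2.1.1 = η 0 q * w.2.1.1 := by
        have := rot_span (D.cone_ne q hq 1) w.2.1.1 w.2.1.2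
        have h01 := D.cone_mul_eta 0 1 hq
        have h0 : cone σ q 0 = q.2.1.1 := rfl
        have hl1 := D.cone_ne q hq 1
        rw [show ((0, w.2.1, 0) : Coord) = (0, (w.2.1.1, w.2.1.2), 0) from rfl, this, map_add,
          map_smul, map_smul, D.eta_rot (by decide : (0 : Fin 3) ≠ 1) hq,
          D.eta_rot_zero (by decide : (0 : Fin 3) ≠ 1) (by decide : (1 : Fin 3) ≠ 2) (by decide) hq,
          smul_zero, add_zero, smul_eq_mul]
        rw [h0] at h01
        field_simp
        linear_combination (-w.2.1.1) * h01
      have h2 : fderiv ℝ (η 0) q w = fderiv ℝ (η 0) q (0, w.2.1, 0) := by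
        conv_lhs => rw [eq_sum_basis w]
        rw [map_add, map_add, linear_eh_eq_zero (fun a b hab => D.eta_eh_zero 0 hab hq), map_sum,
          Finset.sum_eq_zero (fun k _ => by rw [map_smul, D.eta_ex_zero 0 k hq, smul_zero])]
        simp
      rw [h2]; linarith
    rw [(hd q hq).fderiv]
    have hLw : L w = w.2.1.1 := rfl
    have hq0 := hne q hq
    simp only [smul_apply, add_apply, hLw, smul_eq_mul]
    field_simp
    linear_combination h1
  obtain ⟨ρ, hρ⟩ := hη
  refine ⟨g, ρ, v, fun q hq => ⟨fun i => ?_, fun i => ?_, fun i j hij => ?_⟩⟩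
  · linarith [hv i q hq]
  · have h0 : cone σ q 0 = q.2.1.1 := rfl
    have hne := D.cone_ne q hq 0
    have h1 := D.cone_mul_eta i 0 hq
    have h2 := hρ q hq
    rw [← h0] at h2
    rw [← h2]
    field_simp
    linarith
  · rw [D.zeta_eq_coeff_mul hij hq, D.coeff_eq_neg hij hq, hg q hq 0]
    ring

end Determining

/-! ### Linearization along solutions -/

/-- The linearization of the differential equations of the system at a point with value `y`, for
variations `y'` of the value and `J'` of the partial derivatives. -/
structure LinFirstOrder (y y' : Dep) (J' : Fin 3 → Dep) : Prop where
  l_off : ∀ i j : Fin 3, i ≠ j →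
    (J' j).1 i - (hh y'.2 i j * y.1 j + hh y.2 i j * y'.1 j) = 0
  l_diag : ∀ i j k : Fin 3, i ≠ j → j ≠ k → i ≠ k →
    eps i * (J' i).1 i + eps j * (hh y'.2 j i * y.1 j + hh y.2 j i * y'.1 j)
      + eps k * (hh y'.2 k i * y.1 k + hh y.2 k i * y'.1 k) = 0
  h_off : ∀ i j k : Fin 3, i ≠ j → j ≠ k → i ≠ k →
    hh (J' k).2 i j - (hh y'.2 i k * hh y.2 k j + hh y.2 i k * hh y'.2 k j) = 0
  h_sum : ∀ i j k : Fin 3, i ≠ j → j ≠ k → i ≠ k →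
    hh (J' j).2 i j + hh (J' i).2 j i
      + (hh y'.2 i k * hh y.2 j k + hh y.2 i k * hh y'.2 j k) = 0
  h_eps : ∀ i j k : Fin 3, i ≠ j → j ≠ k → i ≠ k →
    eps i * hh (J' i).2 i j + eps j * hh (J' j).2 j i
      + eps k * (hh y'.2 k i * hh y.2 k j + hh y.2 k i * hh y'.2 k j) = 0

theorem hasDerivAt_fst_apply {y : ℝ → Dep} {y' : Dep} {t : ℝ} (hy : HasDerivAt y y' t) (i : Fin 3) :
    HasDerivAt (fun s => (y s).1 i) (y'.1 i) t :=
  ((ContinuousLinearMap.proj (R := ℝ) (φ := fun _ : Fin 3 => ℝ) i).comp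
    (ContinuousLinearMap.fst ℝ (Fin 3 → ℝ) (OffDiag → ℝ))).hasFDerivAt.comp_hasDerivAt t hy

theorem hasDerivAt_hh {y : ℝ → Dep} {y' : Dep} {t : ℝ} (hy : HasDerivAt y y' t) {i j : Fin 3}
    (hij : i ≠ j) : HasDerivAt (fun s => hh (y s).2 i j) (hh y'.2 i j) t := by
  simp only [hh_of_ne _ hij]
  exact ((ContinuousLinearMap.proj (R := ℝ) (φ := fun _ : OffDiag => ℝ) ⟨(i, j), hij⟩).comp
    (ContinuousLinearMap.snd ℝ (Fin 3 → ℝ) (OffDiag → ℝ))).hasFDerivAt.comp_hasDerivAt t hy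

theorem FirstOrder.linearize {y : ℝ → Dep} {y' : Dep} {J : ℝ → Fin 3 → Dep} {J' : Fin 3 → Dep}
    (h : ∀ᶠ s in 𝓝 (0 : ℝ), FirstOrder (y s) (J s)) (hy : HasDerivAt y y' 0)
    (hJ : ∀ n, HasDerivAt (fun s => J s n) (J' n) 0) : LinFirstOrder (y 0) y' J' := by
  have key : ∀ {f : ℝ → ℝ} {f' : ℝ}, HasDerivAt f f' 0 → (∀ᶠ s in 𝓝 (0 : ℝ), f s = 0) → f' = 0 :=
    fun hf h0 => (hf.congr_of_eventuallyEq (h0.mono fun s hs => hs.symm)).unique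
      (hasDerivAt_const _ _)
  constructor
  · intro i j hij
    exact key ((hasDerivAt_fst_apply (hJ j) i).fun_sub
      ((hasDerivAt_hh hy hij).fun_mul (hasDerivAt_fst_apply hy j)))
      (h.mono fun s hs => hs.l_off i j hij)
  · intro i j k hij hjk hik
    have hd := (((hasDerivAt_fst_apply (hJ i) i).const_mul (eps i)).fun_add
      (((hasDerivAt_hh hy hij.symm).const_mul (eps j)).fun_mul (hasDerivAt_fst_apply hy j))).fun_add
      (((hasDerivAt_hh hy hik.symm).const_mul (eps k)).fun_mul (hasDerivAt_fst_apply hy k))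
    linear_combination key hd (h.mono fun s hs => hs.l_diag i j k hij hjk hik)
  · intro i j k hij hjk hik
    exact key ((hasDerivAt_hh (hJ k) hij).fun_sub
      ((hasDerivAt_hh hy hik).fun_mul (hasDerivAt_hh hy hjk.symm)))
      (h.mono fun s hs => hs.h_off i j k hij hjk hik)
  · intro i j k hij hjk hik
    exact key (((hasDerivAt_hh (hJ j) hij).fun_add (hasDerivAt_hh (hJ i) hij.symm)).fun_add
      ((hasDerivAt_hh hy hik).fun_mul (hasDerivAt_hh hy hjk)))
      (h.mono fun s hs => hs.h_sum i j k hij hjk hik)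
  · intro i j k hij hjk hik
    have hd := (((hasDerivAt_hh (hJ i) hij).const_mul (eps i)).fun_add
      ((hasDerivAt_hh (hJ j) hij.symm).const_mul (eps j))).fun_add
      (((hasDerivAt_hh hy hik.symm).const_mul (eps k)).fun_mul (hasDerivAt_hh hy hjk.symm))
    linear_combination key hd (h.mono fun s hs => hs.h_eps i j k hij hjk hik)

/-- A parametrized submanifold `x ↦ (χ x, ψ x)` is near `x₀` the graph of a smooth function if the
derivative of `χ` at `x₀` is invertible. -/
theorem exists_graphOn_eq {X Y : Type*} [NormedAddCommGroup X] [NormedSpace ℝ X] [CompleteSpace X]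
    [NormedAddCommGroup Y] [NormedSpace ℝ Y] {χ : X → X} {ψ : X → Y} {Ω : Set X} (hΩ : IsOpen Ω)
    (hχ : ContDiffOn ℝ ∞ χ Ω) (hψ : ContDiffOn ℝ ∞ ψ Ω) {x₀ : X} (hx₀ : x₀ ∈ Ω) {A : X ≃L[ℝ] X}
    (hA : fderiv ℝ χ x₀ = A) :
    ∃ Ω₁ ⊆ Ω, IsOpen Ω₁ ∧ x₀ ∈ Ω₁ ∧ ∃ (Ω' : Set X) (u' : X → Y), IsOpen Ω' ∧ ContDiffOn ℝ ∞ u' Ω' ∧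
      (fun x => (χ x, ψ x)) '' Ω₁ = Ω'.graphOn u' ∧ χ x₀ ∈ Ω' ∧ u' (χ x₀) = ψ x₀ ∧
      fderiv ℝ u' (χ x₀) = (fderiv ℝ ψ x₀).comp (A.symm : X →L[ℝ] X) := by
  have hχ₀ := hχ.contDiffAt (hΩ.mem_nhds hx₀)
  have hd : ∀ x ∈ Ω, DifferentiableAt ℝ χ x := fun x hx =>
    (hχ.contDiffAt (hΩ.mem_nhds hx)).differentiableAt (by simp)
  have hA' : HasFDerivAt χ (A : X →L[ℝ] X) x₀ := hA ▸ (hd x₀ hx₀).hasFDerivAt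
  set e := hχ₀.toOpenPartialHomeomorph χ hA' (by simp) with he
  have hes : x₀ ∈ e.source := hχ₀.mem_toOpenPartialHomeomorph_source hA' (by simp)
  have hec : (e : X → X) = χ := hχ₀.toOpenPartialHomeomorph_coe hA' (by simp)
  have hcont : ContinuousOn (fderiv ℝ χ) Ω := hχ.continuousOn_fderiv_of_isOpen hΩ (by simp)
  set Ω₁ : Set X := (Ω ∩ fderiv ℝ χ ⁻¹' range ((↑) : (X ≃L[ℝ] X) → X →L[ℝ] X)) ∩ e.source with hΩ₁
  have ho : IsOpen Ω₁ :=
    (hcont.isOpen_inter_preimage hΩ (ContinuousLinearEquiv.isOpen)).inter e.open_source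
  have h0 : x₀ ∈ Ω₁ := ⟨⟨hx₀, A, hA.symm⟩, hes⟩
  have hsub : Ω₁ ⊆ e.source := inter_subset_right
  refine ⟨Ω₁, fun x hx => hx.1.1, ho, h0, e '' Ω₁, ψ ∘ e.symm,
    e.isOpen_image_of_subset_source ho hsub, ?_, ?_, ⟨x₀, h0, by rw [hec]⟩, ?_, ?_⟩
  · rintro y ⟨x, hx, rfl⟩
    obtain ⟨⟨hxΩ, B, hB⟩, hxe⟩ := hx
    have hinv : e.symm (e x) = x := e.left_inv hxe
    have hs : ContDiffAt ℝ ∞ e.symm (e x) := by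
      refine e.contDiffAt_symm (f₀' := B) (e.map_source hxe) ?_ ?_
      · rw [hinv, hec, hB]; exact (hd x hxΩ).hasFDerivAt
      · rw [hinv, hec]; exact hχ.contDiffAt (hΩ.mem_nhds hxΩ)
    have hψx : ContDiffAt ℝ ∞ ψ (e.symm (e x)) := by
      rw [hinv]; exact hψ.contDiffAt (hΩ.mem_nhds hxΩ)
    exact (hψx.comp _ hs).contDiffWithinAt
  · ext ⟨y, z⟩
    simp only [mem_image, mem_graphOn, Prod.mk.injEq, Function.comp]
    constructor
    · rintro ⟨x, hx, rfl, rfl⟩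
      exact ⟨⟨x, hx, by rw [hec]⟩, by rw [← hec, e.left_inv (hsub hx)]⟩
    · rintro ⟨⟨x, hx, rfl⟩, rfl⟩
      exact ⟨x, hx, by rw [hec], by rw [e.left_inv (hsub hx)]⟩
  · simp only [Function.comp]
    rw [← hec, e.left_inv hes]
  · have hinv : e.symm (χ x₀) = x₀ := by rw [← hec, e.left_inv hes]
    have hs : HasFDerivAt e.symm (A.symm : X →L[ℝ] X) (χ x₀) := by
      refine e.hasFDerivAt_symm (by rw [← hec]; exact e.map_source hes) ?_
      rw [hinv, hec]; exact hA'
    have hψ₀ : HasFDerivAt ψ (fderiv ℝ ψ x₀) (e.symm (χ x₀)) := by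
      rw [hinv]
      exact ((hψ.contDiffAt (hΩ.mem_nhds hx₀)).differentiableAt (by simp)).hasFDerivAt
    exact (hψ₀.comp _ hs).fderiv

/-- The infinitesimal generator of a one-parameter family of transformations. -/
def generator (F : ℝ × Total → Total) (p : Total) : Total := fderiv ℝ F (0, p) (1, 0)

/-- If the transformations of a smooth one-parameter family through the identity map solutions to
solutions, then the first prolongation of the generator of the family is tangent to the system: it
satisfies the linearized equations at the 1-jet of every solution. -/
theorem linFirstOrder_generator {F : ℝ × Total → Total} {O : Set (ℝ × Total)} (hO : IsOpen O)
    (hF : ContDiffOn ℝ ∞ F O) (hF₀ : ∀ p, (0, p) ∈ O → F (0, p) = p)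
    (hmap : ∀ s, MapsSolutions {p | (s, p) ∈ O} fun p => F (s, p)) {Ω : Set Indep} {u : Indep → Dep}
    (hu : IsSolution Ω u) {x₀ : Indep} (hx₀ : x₀ ∈ Ω) (hm : ((0 : ℝ), (x₀, u x₀)) ∈ O) :
    LinFirstOrder (u x₀) (generator F (x₀, u x₀)).2 fun n =>
      (fderiv ℝ (generator F) (x₀, u x₀) (Pi.single n 1, fderiv ℝ u x₀ (Pi.single n 1))).2
      - fderiv ℝ u x₀ (fderiv ℝ (generator F) (x₀, u x₀)
        (Pi.single n 1, fderiv ℝ u x₀ (Pi.single n 1))).1 := by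
  set p₀ : Total := (x₀, u x₀) with hp₀
  set T := fderiv ℝ u x₀ with hT
  have hFat : ∀ z ∈ O, ContDiffAt ℝ ∞ F z := fun z hz => hF.contDiffAt (hO.mem_nhds hz)
  have hFd : ∀ z ∈ O, HasFDerivAt F (fderiv ℝ F z) z := fun z hz =>
    ((hFat z hz).differentiableAt (by simp)).hasFDerivAt
  have hud : HasFDerivAt u T x₀ := ((hu.smooth.contDiffAt (hu.isOpen.mem_nhds hx₀)).differentiableAt
    (by simp)).hasFDerivAt
  -- The second derivative of the family and its symmetry.
  have hF2 : HasFDerivAt (fderiv ℝ F) (fderiv ℝ (fderiv ℝ F) (0, p₀)) (0, p₀) :=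
    (((hFat _ hm).fderiv_right (m := 1) (by norm_cast)).differentiableAt (by simp)).hasFDerivAt
  have hsymm : ∀ v w, fderiv ℝ (fderiv ℝ F) (0, p₀) v w = fderiv ℝ (fderiv ℝ F) (0, p₀) w v :=
    ((hFat _ hm).isSymmSndFDerivAt (by simp; norm_cast)).eq
  have hgen : ∀ w, fderiv ℝ (generator F) p₀ w
      = fderiv ℝ (fderiv ℝ F) (0, p₀) (1, 0) (0, w) := by
    intro w
    have h1 : HasFDerivAt (fun p : Total => ((0 : ℝ), p)) (ContinuousLinearMap.inr ℝ ℝ Total) p₀ :=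
      (ContinuousLinearMap.inr ℝ ℝ Total).hasFDerivAt
    have h2 := (ContinuousLinearMap.apply ℝ Total ((1 : ℝ), (0 : Total))).hasFDerivAt.comp p₀
      (hF2.comp p₀ h1)
    have h3 : fderiv ℝ (generator F) p₀ = _ := h2.fderiv
    rw [h3, hsymm]
    rfl
  -- The derivatives of the transformed graph at `x₀`.
  set G : Indep →L[ℝ] ℝ × Total :=
    (ContinuousLinearMap.inr ℝ ℝ Total).comp ((ContinuousLinearMap.id ℝ Indep).prod T) with hG
  set B : ℝ → Indep →L[ℝ] Total := fun s => (fderiv ℝ F (s, p₀)).comp G with hB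
  have hline : HasDerivAt (fun s : ℝ => (s, p₀)) ((1 : ℝ), (0 : Total)) 0 :=
    (hasDerivAt_id (0 : ℝ)).prodMk (hasDerivAt_const _ _)
  have hBd : HasDerivAt B ((fderiv ℝ (fderiv ℝ F) (0, p₀) (1, 0)).comp G) 0 := by
    have h1 := hF2.comp_hasDerivAt (0 : ℝ) hline
    exact ((ContinuousLinearMap.compL ℝ Indep (ℝ × Total) Total).flip G).hasFDerivAt.comp_hasDerivAt
      (0 : ℝ) h1
  set A : ℝ → Indep →L[ℝ] Indep := fun s => (ContinuousLinearMap.fst ℝ Indep Dep).comp (B s) with hA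
  set C : ℝ → Indep →L[ℝ] Dep := fun s => (ContinuousLinearMap.snd ℝ Indep Dep).comp (B s) with hC
  set B' : Indep →L[ℝ] Total := (fderiv ℝ (fderiv ℝ F) (0, p₀) (1, 0)).comp G with hB'
  have hAd : HasDerivAt A ((ContinuousLinearMap.fst ℝ Indep Dep).comp B') 0 :=
    (ContinuousLinearMap.compL ℝ Indep Total Indep
      (ContinuousLinearMap.fst ℝ Indep Dep)).hasFDerivAt.comp_hasDerivAt (0 : ℝ) hBd
  have hCd : HasDerivAt C ((ContinuousLinearMap.snd ℝ Indep Dep).comp B') 0 :=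
    (ContinuousLinearMap.compL ℝ Indep Total Dep
      (ContinuousLinearMap.snd ℝ Indep Dep)).hasFDerivAt.comp_hasDerivAt (0 : ℝ) hBd
  have hB0 : ∀ e, B 0 e = (e, T e) := by
    intro e
    have h1 : HasFDerivAt (fun p : Total => F (0, p))
        ((fderiv ℝ F (0, p₀)).comp (ContinuousLinearMap.inr ℝ ℝ Total)) p₀ :=
      (hFd _ hm).comp p₀ (ContinuousLinearMap.inr ℝ ℝ Total).hasFDerivAt
    have h2 : (fun p : Total => F (0, p)) =ᶠ[𝓝 p₀] id := by
      have : ContinuousAt (fun p : Total => ((0 : ℝ), p)) p₀ := by fun_prop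
      filter_upwards [this.preimage_mem_nhds (hO.mem_nhds hm)] with p hp
      exact hF₀ p hp
    have h3 := h1.unique ((hasFDerivAt_id p₀).congr_of_eventuallyEq h2)
    exact congrArg (fun L : Total →L[ℝ] Total => L (e, T e)) h3
  have hA0 : A 0 = 1 := by
    ext1 e
    simp [hA, hB0]
  have hC0 : C 0 = T := by
    ext1 e
    simp [hC, hB0]
  have hinv : HasDerivAt (fun s => Ring.inverse (A s))
      (-((ContinuousLinearMap.fst ℝ Indep Dep).comp B')) 0 := by
    have h1 := hasFDerivAt_ringInverse (𝕜 := ℝ) (1 : (Indep →L[ℝ] Indep)ˣ)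
    rw [Units.val_one, ← hA0] at h1
    have h2 := h1.comp_hasDerivAt (0 : ℝ) hAd
    refine h2.congr_deriv ?_
    simp
  have hJd : ∀ e, HasDerivAt (fun s => C s (Ring.inverse (A s) e)) ((B' e).2 - T (B' e).1) 0 := by
    intro e
    have h1 := hCd.clm_apply (hinv.clm_apply (hasDerivAt_const (0 : ℝ) e))
    refine h1.congr_deriv ?_
    simp [hA0, hC0, sub_eq_add_neg]
  have hyd : HasDerivAt (fun s => (F (s, p₀)).2) (generator F p₀).2 0 :=
    (ContinuousLinearMap.snd ℝ Indep Dep).hasFDerivAt.comp_hasDerivAt (0 : ℝ)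
      ((hFd _ hm).comp_hasDerivAt (0 : ℝ) hline)
  have hev : ∀ᶠ s in 𝓝 (0 : ℝ), FirstOrder (F (s, p₀)).2
      (fun n => C s (Ring.inverse (A s) (Pi.single n 1))) := by
    have h1 : ∀ᶠ s in 𝓝 (0 : ℝ), (s, p₀) ∈ O :=
      hline.continuousAt.preimage_mem_nhds (hO.mem_nhds hm)
    have h2 : ∀ᶠ s in 𝓝 (0 : ℝ), IsUnit (A s) := by
      refine hAd.continuousAt.preimage_mem_nhds (Units.isOpen.mem_nhds ?_)
      rw [hA0]; exact isUnit_one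
    filter_upwards [h1, h2] with s hs ⟨U, hU⟩
    have hcont : ContinuousOn (fun x => (s, (x, u x))) Ω :=
      continuousOn_const.prodMk (continuousOn_id.prodMk hu.smooth.continuousOn)
    set Ω₀ := Ω ∩ (fun x => (s, (x, u x))) ⁻¹' O with hΩ₀
    have hΩ₀o : IsOpen Ω₀ := hcont.isOpen_inter_preimage hu.isOpen hO
    have hx₀' : x₀ ∈ Ω₀ := ⟨hx₀, hs⟩
    have hφ : ContDiffOn ℝ ∞ (fun x => F (s, (x, u x))) Ω₀ :=
      hF.comp (contDiffOn_const.prodMk (contDiffOn_id.prodMk (hu.smooth.mono inter_subset_left)))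
        fun x hx => hx.2
    have hφd : HasFDerivAt (fun x => F (s, (x, u x))) (B s) x₀ := by
      have h1 : HasFDerivAt (fun x => (s, (x, u x))) G x₀ := by
        have := (hasFDerivAt_const s x₀).prodMk ((hasFDerivAt_id x₀).prodMk hud)
        refine this.congr_fderiv ?_
        ext1 e
        simp [hG]
      exact (hFd _ hs).comp x₀ h1
    have hχd : HasFDerivAt (fun x => (F (s, (x, u x))).1) (A s) x₀ := hφd.fst
    have hψd : HasFDerivAt (fun x => (F (s, (x, u x))).2) (C s) x₀ := hφd.snd
    obtain ⟨Ω₁, hsub, hΩ₁, hx₁, Ω', u', hΩ', hu', himg, hmem, hval, hder⟩ :=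
      exists_graphOn_eq (A := ContinuousLinearEquiv.unitsEquiv ℝ Indep U) hΩ₀o
        (contDiff_fst.comp_contDiffOn hφ) (contDiff_snd.comp_contDiffOn hφ) hx₀'
        (by
          rw [show fderiv ℝ (Prod.fst ∘ fun x => F (s, (x, u x))) x₀ = A s from hχd.fderiv, ← hU]
          rfl)
    have hsol : IsSolution Ω' u' := by
      refine hmap s Ω₁ Ω' u u' (hu.mono hΩ₁ fun x hx => (hsub hx).1) ?_ hΩ' hu' ?_
      · rintro ⟨x, y⟩ hxy
        obtain ⟨hx, hy⟩ := mem_graphOn.1 hxy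
        have := (hsub hx).2
        rwa [mem_preimage, hy] at this
      · rw [← himg, graphOn, image_image]
        rfl
    have hfo := ((isSolution_iff.1 hsol).2.2 _ hmem).2.2
    rw [hval, hder] at hfo
    rw [show fderiv ℝ (Prod.snd ∘ fun x => F (s, (x, u x))) x₀ = C s from hψd.fderiv] at hfo
    rw [← hU, Ring.inverse_unit]
    exact hfo
  have hlin := FirstOrder.linearize hev hyd fun n => hJd (Pi.single n 1)
  have hval : (F (0, p₀)).2 = u x₀ := by rw [hF₀ p₀ hm]
  rw [hval] at hlin
  convert hlin using 2 with n
  rw [hgen]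
  rfl

/-- The point of the Guichard cone with given coordinates. -/
def conePoint (σ : ℝ) (q : Coord) : Total := (q.1, cone σ q, q.2.2)

theorem sum_eps_cone {σ : ℝ} (hσ : σ ^ 2 = 1) (q : Coord) :
    ∑ i, eps i * cone σ q i ^ 2 = 0 := by
  have h := Real.sq_sqrt (show 0 ≤ q.2.1.1 ^ 2 + q.2.1.2 ^ 2 by positivity)
  simp only [Fin.sum_univ_three, eps_zero, eps_one, eps_two, cone, Matrix.cons_val_zero,
    Matrix.cons_val_one, Matrix.cons_val, mul_pow, hσ]
  linarith

theorem contDiffAt_conePoint {σ : ℝ} {q : Coord} (hq : q.2.1.1 ≠ 0) :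
    ContDiffAt ℝ ∞ (conePoint σ) q := by
  have h0 : q.2.1.1 ^ 2 + q.2.1.2 ^ 2 ≠ 0 := by positivity
  have hs : ContDiffAt ℝ ∞ (fun q : Coord => √(q.2.1.1 ^ 2 + q.2.1.2 ^ 2)) q :=
    ContDiffAt.sqrt (by fun_prop) h0
  refine contDiffAt_fst.prodMk (ContDiffAt.prodMk ?_ (by fun_prop))
  rw [contDiffAt_pi]
  intro i
  fin_cases i
  · change ContDiffAt ℝ ∞ (fun q : Coord => q.2.1.1) q
    fun_prop
  · exact contDiffAt_const.mul hs
  · change ContDiffAt ℝ ∞ (fun q : Coord => q.2.1.2) q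
    fun_prop

/-- The direction `jetDir` in coordinates is tangent to the graph of a solution with
translation-invariant `h`. -/
theorem fderiv_conePoint_jetDir {σ : ℝ} (hσ : σ ^ 2 = 1) {q : Coord} (hq : q.2.1.1 ≠ 0)
    (c : Fin 3 → ℝ) (n : Fin 3) :
    fderiv ℝ (conePoint σ) q (jetDir c (cone σ q) q.2.2 n)
      = (Pi.single n 1, totalForm c n (cone σ q, q.2.2) (cone σ q, q.2.2)) := by
  set v := jetDir c (cone σ q) q.2.2 n with hv
  have h0 : q.2.1.1 ^ 2 + q.2.1.2 ^ 2 ≠ 0 := by positivity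
  have hpos : √(q.2.1.1 ^ 2 + q.2.1.2 ^ 2) ≠ 0 := by positivity
  have hline : HasDerivAt (fun t : ℝ => q + t • v) v 0 := by
    simpa using ((hasDerivAt_id (0 : ℝ)).smul_const v).const_add q
  have hd : HasDerivAt (fun t : ℝ => conePoint σ (q + t • v)) (fderiv ℝ (conePoint σ) q v) 0 := by
    have h1 : HasFDerivAt (conePoint σ) (fderiv ℝ (conePoint σ) q) (q + (0 : ℝ) • v) := by
      rw [zero_smul, add_zero]
      exact ((contDiffAt_conePoint hq).differentiableAt (by simp)).hasFDerivAt
    exact h1.comp_hasDerivAt (0 : ℝ) hline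
  have ha : HasDerivAt (fun t : ℝ => (q + t • v).2.1.1) v.2.1.1 0 := hline.snd.fst.fst
  have hb : HasDerivAt (fun t : ℝ => (q + t • v).2.1.2) v.2.1.2 0 := hline.snd.fst.snd
  have hroot : HasDerivAt (fun t : ℝ => √((q + t • v).2.1.1 ^ 2 + (q + t • v).2.1.2 ^ 2))
      ((q.2.1.1 * v.2.1.1 + q.2.1.2 * v.2.1.2) / √(q.2.1.1 ^ 2 + q.2.1.2 ^ 2)) 0 := by
    have h1 := ((ha.pow 2).add (hb.pow 2)).sqrt (by simpa using h0)
    refine h1.congr_deriv ?_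
    simp
    field_simp
  have hl1 : σ * ((q.2.1.1 * v.2.1.1 + q.2.1.2 * v.2.1.2) / √(q.2.1.1 ^ 2 + q.2.1.2 ^ 2))
      = dl (cone σ q) q.2.2 1 n := by
    set s := √(q.2.1.1 ^ 2 + q.2.1.2 ^ 2) with hs
    have hss : s ^ 2 = q.2.1.1 ^ 2 + q.2.1.2 ^ 2 := Real.sq_sqrt (by positivity)
    have c0 : cone σ q 0 = q.2.1.1 := rfl
    have c1 : cone σ q 1 = σ * s := rfl
    have c2 : cone σ q 2 = q.2.1.2 := rfl
    have hmul : σ * (q.2.1.1 * v.2.1.1 + q.2.1.2 * v.2.1.2) = dl (cone σ q) q.2.2 1 n * s := by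
      simp only [hv, jetDir]
      fin_cases n <;>
        simp [dl, Fin.sum_univ_three, eps_zero, eps_one, eps_two, c0, c1, c2]
      · linear_combination (q.2.1.1 * s * hh q.2.2 1 0) * hσ
      · linear_combination (q.2.1.1 * s * hh q.2.2 0 1 + q.2.1.2 * s * hh q.2.2 2 1) * hσ
      · linear_combination (q.2.1.2 * s * hh q.2.2 1 2) * hσ
    rw [← mul_div_assoc, hmul, mul_div_assoc, div_self hpos, mul_one]
  have hcone : HasDerivAt (fun t : ℝ => cone σ (q + t • v)) (fun i => dl (cone σ q) q.2.2 i n) 0 := by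
    rw [hasDerivAt_pi]
    intro i
    fin_cases i
    · exact ha
    · exact (hroot.const_mul σ).congr_deriv hl1
    · exact hb
  exact hd.unique (hline.fst.prodMk (hcone.prodMk hline.snd.snd))

theorem clm_apply_eq_sum {Y : Type*} [NormedAddCommGroup Y] [NormedSpace ℝ Y] (T : Indep →L[ℝ] Y)
    (x : Indep) : T x = ∑ m, x m • T (Pi.single m 1) := by
  have := (T : Indep →ₗ[ℝ] Y).pi_apply_eq_sum_univ x
  simp only [ContinuousLinearMap.coe_coe] at this
  rw [this]
  refine Finset.sum_congr rfl fun m _ => ?_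
  congr 2
  ext j
  simp [Pi.single_apply, eq_comm]

/-- In coordinates on the Guichard cone, the generator of a family of transformations that map
solutions to solutions satisfies the determining equations. -/
theorem determining_generator {F : ℝ × Total → Total} {O : Set (ℝ × Total)} (hO : IsOpen O)
    (hF : ContDiffOn ℝ ∞ F O) (hF₀ : ∀ p, (0, p) ∈ O → F (0, p) = p)
    (hmap : ∀ s, MapsSolutions {p | (s, p) ∈ O} fun p => F (s, p)) {σ : ℝ} (hσ : σ ^ 2 = 1)
    {B : Set Coord} (hB : IsOpen B) (hconv : Convex ℝ B) (hne : ∀ q ∈ B, ∀ i, cone σ q i ≠ 0)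
    (hBO : ∀ q ∈ B, ((0 : ℝ), conePoint σ q) ∈ O) :
    Determining σ B (fun n q => (generator F (conePoint σ q)).1 n)
      (fun i q => (generator F (conePoint σ q)).2.1 i)
      (fun i j q => hh (generator F (conePoint σ q)).2.2 i j) := by
  have hgen : ∀ q ∈ B, ContDiffAt ℝ ∞ (generator F) (conePoint σ q) := by
    intro q hq
    have h1 : ContDiffAt ℝ ∞ (fderiv ℝ F) (0, conePoint σ q) :=
      (hF.contDiffAt (hO.mem_nhds (hBO q hq))).fderiv_right (by simp)
    have h2 : ContDiffAt ℝ ∞ (fun p : Total => ((0 : ℝ), p)) (conePoint σ q) := by fun_prop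
    exact (h1.comp (conePoint σ q) h2).clm_apply contDiffAt_const
  have hV : ContDiffOn ℝ ∞ (fun q => generator F (conePoint σ q)) B := fun q hq =>
    ((hgen q hq).comp q (contDiffAt_conePoint (hne q hq 0))).contDiffWithinAt
  have hVd : ∀ q ∈ B, HasFDerivAt (fun q => generator F (conePoint σ q))
      (fderiv ℝ (fun q => generator F (conePoint σ q)) q) q := fun q hq =>
    ((hV.contDiffAt (hB.mem_nhds hq)).differentiableAt (by simp)).hasFDerivAt
  have dξ : ∀ n, ∀ q ∈ B, ∀ v, fderiv ℝ (fun q => (generator F (conePoint σ q)).1 n) q v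
      = (fderiv ℝ (fun q => generator F (conePoint σ q)) q v).1 n := by
    intro n q hq v
    have h := ((ContinuousLinearMap.proj (R := ℝ) (φ := fun _ : Fin 3 => ℝ) n).comp
      (ContinuousLinearMap.fst ℝ Indep Dep)).hasFDerivAt.comp q (hVd q hq)
    exact congrArg (fun L : Coord →L[ℝ] ℝ => L v) h.fderiv
  have dη : ∀ i, ∀ q ∈ B, ∀ v, fderiv ℝ (fun q => (generator F (conePoint σ q)).2.1 i) q v
      = (fderiv ℝ (fun q => generator F (conePoint σ q)) q v).2.1 i := by
    intro i q hq v
    have h := ((ContinuousLinearMap.proj (R := ℝ) (φ := fun _ : Fin 3 => ℝ) i).comp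
      ((ContinuousLinearMap.fst ℝ (Fin 3 → ℝ) (OffDiag → ℝ)).comp
        (ContinuousLinearMap.snd ℝ Indep Dep))).hasFDerivAt.comp q (hVd q hq)
    exact congrArg (fun L : Coord →L[ℝ] ℝ => L v) h.fderiv
  have dζ : ∀ i j, i ≠ j → ∀ q ∈ B, ∀ v,
      fderiv ℝ (fun q => hh (generator F (conePoint σ q)).2.2 i j) q v
        = hh (fderiv ℝ (fun q => generator F (conePoint σ q)) q v).2.2 i j := by
    intro i j hij q hq v
    simp only [hh_of_ne _ hij]
    have h := ((ContinuousLinearMap.proj (R := ℝ) (φ := fun _ : OffDiag => ℝ) ⟨(i, j), hij⟩).comp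
      ((ContinuousLinearMap.snd ℝ (Fin 3 → ℝ) (OffDiag → ℝ)).comp
        (ContinuousLinearMap.snd ℝ Indep Dep))).hasFDerivAt.comp q (hVd q hq)
    exact congrArg (fun L : Coord →L[ℝ] ℝ => L v) h.fderiv
  have key : ∀ q ∈ B, ∀ c, Admissible c →
      LinFirstOrder (cone σ q, q.2.2) (generator F (conePoint σ q)).2 fun n =>
        (fderiv ℝ (fun q => generator F (conePoint σ q)) q (jetDir c (cone σ q) q.2.2 n)).2
        - ∑ m, (fderiv ℝ (fun q => generator F (conePoint σ q)) q
            (jetDir c (cone σ q) q.2.2 n)).1 m • totalForm c m (cone σ q, q.2.2) (cone σ q, q.2.2) := by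
    intro q hq c hc
    obtain ⟨Ω, u, hx, hu, hval, hder⟩ :=
      exists_isSolution hc q.1 (cone σ q, q.2.2) (sum_eps_cone hσ q) (hne q hq)
    have h1 := linFirstOrder_generator hO hF hF₀ hmap hu hx (by rw [hval]; exact hBO q hq)
    rw [hval] at h1
    have h2 : ∀ n, fderiv ℝ (fun q => generator F (conePoint σ q)) q (jetDir c (cone σ q) q.2.2 n)
        = fderiv ℝ (generator F) (conePoint σ q)
          (Pi.single n 1, totalForm c n (cone σ q, q.2.2) (cone σ q, q.2.2)) := by
      intro n
      have h3 := (((hgen q hq).differentiableAt (by simp)).hasFDerivAt.comp q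
        ((contDiffAt_conePoint (hne q hq 0)).differentiableAt (by simp)).hasFDerivAt).fderiv
      rw [← fderiv_conePoint_jetDir hσ (hne q hq 0)]
      exact congrArg (fun L : Coord →L[ℝ] Total => L (jetDir c (cone σ q) q.2.2 n)) h3
    simp only [hder, clm_apply_eq_sum (fderiv ℝ u q.1)] at h1
    simp only [h2]
    exact h1
  have s1 : ∀ (y : Fin 3 → ℝ) (z : Fin 3 → Dep) (i : Fin 3),
      (∑ m, y m • z m).1 i = ∑ m, y m * (z m).1 i := by
    intro y z i; simp [Prod.fst_sum, Finset.sum_apply]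
  have s2 : ∀ (w : Dep) (y : Fin 3 → ℝ) (z : Fin 3 → Dep) (i j : Fin 3),
      hh (w - ∑ m, y m • z m).2 i j = hh w.2 i j - ∑ m, y m * hh (z m).2 i j := by
    intro w y z i j
    by_cases hij : i = j
    · subst hij; simp
    · simp [hh_of_ne _ hij, Prod.snd_sum, Finset.sum_apply]
  have p1 : ∀ (c : Fin 3 → ℝ) (m : Fin 3) (q : Coord) (i : Fin 3),
    (totalForm c m (cone σ q, q.2.2) (cone σ q, q.2.2)).1 i = dl (cone σ q) q.2.2 i m :=
      fun _ _ _ _ => rfl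
  have p2 : ∀ (c : Fin 3 → ℝ) (m : Fin 3) (q : Coord) (i j : Fin 3),
    hh (totalForm c m (cone σ q, q.2.2) (cone σ q, q.2.2)).2 i j
      = hh (dhForm c m q.2.2 q.2.2) i j := fun _ _ _ _ _ => rfl
  refine ⟨hB, hconv, ?_, ?_, ?_, hne, ?_, ?_, ?_, ?_, ?_⟩
  · exact fun n => contDiffOn_pi.1 (contDiff_fst.comp_contDiffOn hV) n
  · exact fun i => contDiffOn_pi.1 (contDiff_fst.comp_contDiffOn (contDiff_snd.comp_contDiffOn hV)) i
  · intro i j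
    by_cases hij : i = j
    · subst hij; simpa using contDiffOn_const
    · simp only [hh_of_ne _ hij]
      exact contDiffOn_pi.1 (contDiff_snd.comp_contDiffOn (contDiff_snd.comp_contDiffOn hV)) ⟨(i, j), hij⟩
  · intro q hq c hc i j hij
    have h := (key q hq c hc).l_off i j hij
    simp only [Prod.fst_sub, Pi.sub_apply, s1, p1] at h
    simp only [dξ _ q hq, dη _ q hq]
    linarith
  · intro q hq c hc i j k hij hjk hik
    have h := (key q hq c hc).l_diag i j k hij hjk hik
    simp only [Prod.fst_sub, Pi.sub_apply, s1, p1] at h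
    simp only [dξ _ q hq, dη _ q hq]
    linarith
  · intro q hq c hc i j k hij hjk hik
    have h := (key q hq c hc).h_off i j k hij hjk hik
    simp only [s2, p2] at h
    simp only [dξ _ q hq, dζ _ _ hij q hq]
    linarith
  · intro q hq c hc i j k hij hjk hik
    have h := (key q hq c hc).h_sum i j k hij hjk hik
    simp only [s2, p2] at h
    simp only [dξ _ q hq, dζ _ _ hij q hq, dζ _ _ hij.symm q hq]
    linarith
  · intro q hq c hc i j k hij hjk hik
    have h := (key q hq c hc).h_eps i j k hij hjk hik
    simp only [s2, p2] at h
    simp only [dξ _ q hq, dζ _ _ hij q hq, dζ _ _ hij.symm q hq]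
    linarith

/-- Every point of the Guichard cone has a neighbourhood in the cone that is the image of a ball in
coordinates. -/
theorem exists_conePoint_ball {M : Set Total} (hM : IsOpen M) {p₀ : Total} (hp₀ : p₀ ∈ guichardSet)
    (hpM : p₀ ∈ M) : ∃ (σ : ℝ) (B : Set Coord) (N : Set Total), σ ^ 2 = 1 ∧ IsOpen B ∧ Convex ℝ B ∧
      (∀ q ∈ B, ∀ i, cone σ q i ≠ 0) ∧ (∀ q ∈ B, conePoint σ q ∈ M) ∧ IsOpen N ∧ p₀ ∈ N ∧
      ∀ p ∈ N ∩ guichardSet, ∃ q ∈ B, conePoint σ q = p := by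
  obtain ⟨hg, hl⟩ := hp₀
  -- `σ` is the sign of `l_1`.
  obtain ⟨σ, hσ, hpos⟩ : ∃ σ : ℝ, σ ^ 2 = 1 ∧ 0 < σ * p₀.2.1 1 := by
    rcases lt_or_gt_of_ne (hl 1) with h | h
    · exact ⟨-1, by norm_num, by linarith⟩
    · exact ⟨1, by norm_num, by linarith⟩
  set π : Total → Coord := fun p => (p.1, (p.2.1 0, p.2.1 2), p.2.2) with hπ
  have hπc : Continuous π := by fun_prop
  have hback : ∀ p ∈ guichardSet, 0 < σ * p.2.1 1 → conePoint σ (π p) = p := by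
    rintro p ⟨hg, -⟩ hp
    have h1 : √(p.2.1 0 ^ 2 + p.2.1 2 ^ 2) = σ * p.2.1 1 := by
      rw [Real.sqrt_eq_iff_mul_self_eq (by positivity) hp.le]
      simp only [Fin.sum_univ_three, eps_zero, eps_one, eps_two] at hg
      linear_combination hg - (p.2.1 1) ^ 2 * hσ
    refine Prod.ext rfl (Prod.ext ?_ rfl)
    funext i
    fin_cases i
    · rfl
    · change σ * √(p.2.1 0 ^ 2 + p.2.1 2 ^ 2) = p.2.1 1
      rw [h1, ← mul_assoc, ← sq, hσ, one_mul]
    · rfl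
  have h0 : conePoint σ (π p₀) = p₀ := hback p₀ ⟨hg, hl⟩ hpos
  have hcont : Continuous (conePoint σ) := by
    have : Continuous (cone σ) := continuous_pi (continuous_cone σ)
    unfold conePoint
    fun_prop
  have hopen : IsOpen {q | conePoint σ q ∈ M ∧ ∀ i, cone σ q i ≠ 0} := by
    have h1 : IsOpen (⋂ i, {q | cone σ q i ≠ 0}) :=
      isOpen_iInter_of_finite fun i => isOpen_ne_fun (continuous_cone σ i) continuous_const
    convert (hM.preimage hcont).inter h1 using 1
    ext q
    simp
  obtain ⟨δ, hδ, hball⟩ := Metric.isOpen_iff.1 hopen (π p₀)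
    ⟨by rw [h0]; exact hpM, fun i => by
      have h1 : cone σ (π p₀) = p₀.2.1 := congrArg (fun p : Total => p.2.1) h0
      rw [h1]; exact hl i⟩
  refine ⟨σ, Metric.ball (π p₀) δ, π ⁻¹' Metric.ball (π p₀) δ ∩ {p | 0 < σ * p.2.1 1}, hσ,
    Metric.isOpen_ball, convex_ball _ _, fun q hq => (hball hq).2, fun q hq => (hball hq).1,
    (Metric.isOpen_ball.preimage hπc).inter (isOpen_lt continuous_const (by fun_prop)),
    ⟨Metric.mem_ball_self hδ, hpos⟩, ?_⟩
  rintro p ⟨⟨hp1, hp2⟩, hp⟩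
  exact ⟨π p, hp1, hback p hp hp2⟩

/-- The generators of translations and dilations. -/
def infinitesimal (v : Indep) (g ρ : ℝ) (p : Total) : Total :=
  (g • p.1 + v, ρ • p.2.1, -g • p.2.2)

theorem exists_generator_eq {F : ℝ × Total → Total} {O : Set (ℝ × Total)} (hO : IsOpen O)
    (hF : ContDiffOn ℝ ∞ F O) (hF₀ : ∀ p, (0, p) ∈ O → F (0, p) = p)
    (hmap : ∀ s, MapsSolutions {p | (s, p) ∈ O} fun p => F (s, p)) {σ : ℝ} (hσ : σ ^ 2 = 1)
    {B : Set Coord} (hB : IsOpen B) (hconv : Convex ℝ B) (hne : ∀ q ∈ B, ∀ i, cone σ q i ≠ 0)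
    (hBO : ∀ q ∈ B, ((0 : ℝ), conePoint σ q) ∈ O) :
    ∃ v g ρ, ∀ q ∈ B, generator F (conePoint σ q) = infinitesimal v g ρ (conePoint σ q) := by
  obtain ⟨g, ρ, v, h⟩ := (determining_generator hO hF hF₀ hmap hσ hB hconv hne hBO).exists_eq
  refine ⟨v, g, ρ, fun q hq => ?_⟩
  obtain ⟨h1, h2, h3⟩ := h q hq
  refine Prod.ext (funext fun i => h1 i) (Prod.ext (funext fun i => h2 i) (funext fun ij => ?_))
  obtain ⟨⟨i, j⟩, hij⟩ := ij
  have := h3 i j hij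
  rw [hh_of_ne _ hij, hh_of_ne _ hij] at this
  exact this

/-! ### Local actions in charts -/

section LocalAction

variable {E H : Type*} [NormedAddCommGroup E] [NormedSpace ℝ E] [TopologicalSpace H]
  {I : ModelWithCorners ℝ E H} {G : Type*} [TopologicalSpace G] [ChartedSpace H G]
  {M : Set Total} {W : Set (G × Total)} {Ψ : G × Total → Total}

variable (I) in
/-- The action read in the chart at `g₀`. -/
def chartAction (Ψ : G × Total → Total) (g₀ : G) (z : E × Total) : Total :=
  Ψ ((extChartAt I g₀).symm z.1, z.2)

variable (I) in
/-- The domain of the action read in the chart at `g₀`. -/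
def chartDom (W : Set (G × Total)) (g₀ : G) : Set (E × Total) :=
  {z | z.1 ∈ (extChartAt I g₀).target ∧ ((extChartAt I g₀).symm z.1, z.2) ∈ W}

theorem mem_chartDom_self {g : G} {p : Total} (h : (g, p) ∈ W) :
    (extChartAt I g g, p) ∈ chartDom I W g :=
  ⟨mem_extChartAt_target g, by simpa using h⟩

variable [Group G]

variable (I G) in
/-- The map `(g, g') ↦ g g'⁻¹` read in the chart at the identity. -/
def chartDiv (z : E × E) : E :=
  extChartAt I (1 : G) ((extChartAt I (1 : G)).symm z.1 * ((extChartAt I (1 : G)).symm z.2)⁻¹)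

variable (I G) in
/-- The domain of `chartDiv`. -/
def chartDivDom : Set (E × E) :=
  {z | (z.1 ∈ (extChartAt I (1 : G)).target ∧ z.2 ∈ (extChartAt I (1 : G)).target) ∧
    (extChartAt I (1 : G)).symm z.1 * ((extChartAt I (1 : G)).symm z.2)⁻¹
      ∈ (extChartAt I (1 : G)).source}

theorem diag_mem_chartDivDom {c : E} (hc : c ∈ (extChartAt I (1 : G)).target) :
    (c, c) ∈ chartDivDom I G := by
  refine ⟨⟨hc, hc⟩, ?_⟩
  rw [mul_inv_cancel]
  exact mem_extChartAt_source _

variable (I) in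
/-- The infinitesimal generator of the action in the direction `e` of the chart at the identity. -/
def actionGenerator (Ψ : G × Total → Total) (e : E) (p : Total) : Total :=
  fderiv ℝ (chartAction I Ψ (1 : G)) (extChartAt I (1 : G) 1, p) (e, 0)

variable [LieGroup I ∞ G]

theorem contMDiffOn_symm_prod (g₀ : G) :
    ContMDiffOn 𝓘(ℝ, E × Total) (I.prod 𝓘(ℝ, Total)) ∞
      (fun z : E × Total => ((extChartAt I g₀).symm z.1, z.2))
      {z | z.1 ∈ (extChartAt I g₀).target} := by
  refine ContMDiffOn.prodMk ?_ contDiff_snd.contMDiff.contMDiffOn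
  exact (contMDiffOn_extChartAt_symm g₀).comp contDiff_fst.contMDiff.contMDiffOn fun _ hz => hz

theorem contMDiffOn_symm_div :
    ContMDiffOn 𝓘(ℝ, E × E) I ∞
      (fun z : E × E => (extChartAt I (1 : G)).symm z.1 * ((extChartAt I (1 : G)).symm z.2)⁻¹)
      {z | z.1 ∈ (extChartAt I (1 : G)).target ∧ z.2 ∈ (extChartAt I (1 : G)).target} := by
  refine ContMDiffOn.mul ?_ (ContMDiffOn.inv ?_)
  · exact (contMDiffOn_extChartAt_symm 1).comp contDiff_fst.contMDiff.contMDiffOn fun _ hz => hz.1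
  · exact (contMDiffOn_extChartAt_symm 1).comp contDiff_snd.contMDiff.contMDiffOn fun _ hz => hz.2

theorem contDiffOn_chartAction (hA : IsLocalAction I M W Ψ) (g₀ : G) :
    ContDiffOn ℝ ∞ (chartAction I Ψ g₀) (chartDom I W g₀) :=
  (hA.smooth.comp ((contMDiffOn_symm_prod g₀).mono fun _ hz => hz.1) fun _ hz => hz.2).contDiffOn

theorem contDiffOn_chartDiv : ContDiffOn ℝ ∞ (chartDiv I G) (chartDivDom I G) := by
  have h : ContMDiffOn I 𝓘(ℝ, E) ∞ (extChartAt I (1 : G)) (extChartAt I (1 : G)).source := by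
    rw [extChartAt_source]
    exact contMDiffOn_extChartAt
  exact (h.comp (contMDiffOn_symm_div.mono fun _ hz => hz.1) fun _ hz => hz.2).contDiffOn

variable [I.Boundaryless]

theorem isOpen_chartDom (hA : IsLocalAction I M W Ψ) (g₀ : G) : IsOpen (chartDom I W g₀) :=
  (contMDiffOn_symm_prod g₀).continuousOn.isOpen_inter_preimage
    ((isOpen_extChartAt_target g₀).preimage continuous_fst) hA.isOpen_dom

/-- The transformation by a fixed group element is differentiable. -/
theorem differentiableAt_act (hA : IsLocalAction I M W Ψ) {g : G} {p : Total} (h : (g, p) ∈ W) :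
    DifferentiableAt ℝ (fun q => Ψ (g, q)) p := by
  have h1 := ((contDiffOn_chartAction hA g).contDiffAt ((isOpen_chartDom hA g).mem_nhds
    (mem_chartDom_self h))).differentiableAt (by simp)
  have h2 : DifferentiableAt ℝ (fun q : Total => (extChartAt I g g, q)) p := by fun_prop
  have h3 := h1.comp p h2
  simpa [chartAction, Function.comp_def] using h3

theorem isOpen_chartDivDom : IsOpen (chartDivDom I G) :=
  contMDiffOn_symm_div.continuousOn.isOpen_inter_preimage
    (((isOpen_extChartAt_target _).preimage continuous_fst).inter
      ((isOpen_extChartAt_target _).preimage continuous_snd)) (isOpen_extChartAt_source _)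

/-- A curve `z` that follows the generators of the action compensates the motion of a curve `γ` in
the group: `γ⁻¹ · z` is constant to first order. -/
theorem hasDerivAt_inv_act (hA : IsLocalAction I M W Ψ) {γ : ℝ → E} {κ : E} {z : ℝ → Total}
    {z' : Total} {t : ℝ} (hγ : HasDerivAt γ κ t) (hγt : γ t ∈ (extChartAt I (1 : G)).target)
    (hz : HasDerivAt z z' t) (hW : (((extChartAt I (1 : G)).symm (γ t))⁻¹, z t) ∈ W)
    (h : actionGenerator I Ψ (fderiv ℝ (chartDiv I G) (γ t, γ t) (0, κ)) (z t) + z' = 0) :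
    HasDerivAt (fun τ => Ψ (((extChartAt I (1 : G)).symm (γ τ))⁻¹, z τ)) 0 t := by
  set c : ℝ → G := fun τ => (extChartAt I (1 : G)).symm (γ τ) with hc
  have hzM : z t ∈ M := hA.dom_subset _ _ hW
  have hcc : ContinuousAt c t :=
    ContinuousAt.comp (f := γ) (((continuousOn_extChartAt_symm (1 : G)).continuousAt
      ((isOpen_extChartAt_target (1 : G)).mem_nhds hγt))) hγ.continuousAt
  have : IsTopologicalGroup G := topologicalGroup_of_lieGroup I ∞
  have hdiv : ContinuousAt (fun τ => c t * (c τ)⁻¹) t := continuousAt_const.mul hcc.inv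
  have hdivt : c t * (c t)⁻¹ = 1 := mul_inv_cancel _
  -- The curve `z` transformed by `c t * (c τ)⁻¹`.
  have hone : ((1 : G), z t) ∈ W := hA.one_mem _ hzM
  set K : ℝ → E := fun τ => chartDiv I G (γ t, γ τ) with hK
  have hKt : K t = extChartAt I (1 : G) 1 := by
    simp only [hK, chartDiv, mul_inv_cancel]
  have hdiag := diag_mem_chartDivDom hγt
  have hKd : HasDerivAt K (fderiv ℝ (chartDiv I G) (γ t, γ t) (0, κ)) t := by
    have h1 := ((contDiffOn_chartDiv.contDiffAt (isOpen_chartDivDom.mem_nhds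
      hdiag)).differentiableAt (by simp)).hasFDerivAt
    exact h1.comp_hasDerivAt (f := fun τ => (γ t, γ τ)) t ((hasDerivAt_const _ _).prodMk hγ)
  have hinner : HasDerivAt (fun τ => chartAction I Ψ (1 : G) (K τ, z τ)) 0 t := by
    have h1 : HasFDerivAt (chartAction I Ψ (1 : G))
        (fderiv ℝ (chartAction I Ψ (1 : G)) (extChartAt I (1 : G) 1, z t)) (K t, z t) := by
      rw [hKt]
      exact (((contDiffOn_chartAction hA 1).contDiffAt ((isOpen_chartDom hA 1).mem_nhds
        (mem_chartDom_self hone))).differentiableAt (by simp)).hasFDerivAt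
    have h2 := h1.comp_hasDerivAt (f := fun τ => (K τ, z τ)) t (hKd.prodMk hz)
    refine h2.congr_deriv ?_
    -- The derivative with respect to the point at the identity is the identity.
    have h3 : fderiv ℝ (chartAction I Ψ (1 : G)) (extChartAt I (1 : G) 1, z t) (0, z') = z' := by
      rw [hKt] at h1
      have h4 : HasFDerivAt (fun q : Total => (extChartAt I (1 : G) 1, q))
          (ContinuousLinearMap.inr ℝ E Total) (z t) :=
        (hasFDerivAt_const _ _).prodMk (hasFDerivAt_id _)
      have h5 := h1.comp (z t) h4
      have h6 : (chartAction I Ψ (1 : G)) ∘ (fun q : Total => (extChartAt I (1 : G) 1, q))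
          =ᶠ[𝓝 (z t)] id := by
        filter_upwards [hA.isOpen_space.mem_nhds hzM] with q hq
        simpa [chartAction] using hA.one_act q hq
      have h7 := h5.unique ((hasFDerivAt_id (z t)).congr_of_eventuallyEq h6)
      exact congrArg (fun L : Total →L[ℝ] Total => L z') h7
    rw [← h, actionGenerator]
    conv_rhs => rw [← h3]
    rw [← map_add]
    simp
  have hval : chartAction I Ψ (1 : G) (K t, z t) = z t := by
    rw [hKt]
    simpa [chartAction] using hA.one_act _ hzM
  have houter : HasFDerivAt (fun q => Ψ ((c t)⁻¹, q)) (fderiv ℝ (fun q => Ψ ((c t)⁻¹, q)) (z t))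
      (chartAction I Ψ (1 : G) (K t, z t)) := by
    rw [hval]
    exact (differentiableAt_act hA hW).hasFDerivAt
  have hcomp := houter.comp_hasDerivAt t hinner
  rw [map_zero] at hcomp
  refine hcomp.congr_of_eventuallyEq ?_
  have e1 : ∀ᶠ τ in 𝓝 t, (c t * (c τ)⁻¹, z τ) ∈ W := by
    refine (hdiv.prodMk hz.continuousAt).preimage_mem_nhds (hA.isOpen_dom.mem_nhds ?_)
    rw [hdivt]; exact hone
  have e2 : ∀ᶠ τ in 𝓝 t, ((c t)⁻¹, Ψ (c t * (c τ)⁻¹, z τ)) ∈ W := by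
    have h1 : ContinuousAt Ψ (c t * (c t)⁻¹, z t) := by
      rw [hdivt]
      exact hA.smooth.continuousOn.continuousAt (hA.isOpen_dom.mem_nhds hone)
    have h2 : ContinuousAt (fun τ => Ψ (c t * (c τ)⁻¹, z τ)) t :=
      ContinuousAt.comp (f := fun τ => (c t * (c τ)⁻¹, z τ)) h1 (hdiv.prodMk hz.continuousAt)
    have h3 : ContinuousAt (fun τ => ((c t)⁻¹, Ψ (c t * (c τ)⁻¹, z τ))) t :=
      continuousAt_const.prodMk h2
    refine h3.preimage_mem_nhds (hA.isOpen_dom.mem_nhds ?_)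
    rw [hdivt, hA.one_act _ hzM]; exact hW
  have e3 : ∀ᶠ τ in 𝓝 t, ((c τ)⁻¹, z τ) ∈ W :=
    (hcc.inv.prodMk hz.continuousAt).preimage_mem_nhds (hA.isOpen_dom.mem_nhds hW)
  have e4 : ∀ᶠ τ in 𝓝 t, c t * (c τ)⁻¹ ∈ (extChartAt I (1 : G)).source := by
    refine hdiv.preimage_mem_nhds ((isOpen_extChartAt_source (1 : G)).mem_nhds ?_)
    rw [hdivt]; exact mem_extChartAt_source _
  filter_upwards [e1, e2, e3, e4] with τ h1 h2 h3 h4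
  have h5 : chartAction I Ψ (1 : G) (K τ, z τ) = Ψ (c t * (c τ)⁻¹, z τ) := by
    have : (extChartAt I (1 : G)).symm (K τ) = c t * (c τ)⁻¹ := (extChartAt I (1 : G)).left_inv h4
    simp only [chartAction, this]
  have h6 := hA.mul_act _ _ _ h1 h2 (by simpa using h3)
  rw [inv_mul_cancel_left] at h6
  change Ψ ((c τ)⁻¹, z τ) = Ψ ((c t)⁻¹, chartAction I Ψ (1 : G) (K τ, z τ))
  rw [h5, h6]

end LocalAction

/-! ### The flow of translations and dilations -/

/-- The transformation with dilation factors `exp A`, `exp R` and translation vector `exp A • b`. -/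
def expParam (A R : ℝ) (b : Indep) : Param :=
  (Real.exp A • b, Units.mk0 (Real.exp A) (Real.exp_ne_zero A),
    Units.mk0 (Real.exp R) (Real.exp_ne_zero R))

theorem act_expParam (A R : ℝ) (b : Indep) (q : Total) : (expParam A R b).act q
    = (Real.exp A • q.1 + Real.exp A • b, Real.exp R • q.2.1, Real.exp (-A) • q.2.2) := by
  rw [Real.exp_neg]; rfl

theorem expParam_zero : expParam 0 0 0 = 1 :=
  Param.ext' (smul_zero _) (Units.ext Real.exp_zero) (Units.ext Real.exp_zero)

theorem continuous_act_expParam :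
    Continuous fun z : (ℝ × ℝ × Indep) × Total => (expParam z.1.1 z.1.2.1 z.1.2.2).act z.2 := by
  simp only [act_expParam]
  fun_prop

theorem hasDerivAt_act_expParam {A R : ℝ → ℝ} {b : ℝ → Indep} {v : Indep} {g ρ t : ℝ}
    (hA : HasDerivAt A g t) (hR : HasDerivAt R ρ t) (hb : HasDerivAt b (Real.exp (-A t) • v) t)
    (q : Total) : HasDerivAt (fun τ => (expParam (A τ) (R τ) (b τ)).act q)
      (infinitesimal v g ρ ((expParam (A t) (R t) (b t)).act q)) t := by
  simp only [act_expParam, infinitesimal]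
  have h1 := (hA.exp.smul_const q.1).fun_add (hA.exp.fun_smul hb)
  have h2 := hR.exp.smul_const q.2.1
  have h3 := hA.fun_neg.exp.smul_const q.2.2
  refine (h1.prodMk (h2.prodMk h3)).congr_deriv (Prod.ext ?_ (Prod.ext ?_ ?_))
  · simp only [smul_smul, ← Real.exp_add, add_neg_cancel, Real.exp_zero, one_smul, smul_add]
    rw [mul_comm (Real.exp (A t)) g]
    abel
  · simp only [smul_smul, mul_comm]
  · simp only [smul_smul, mul_comm, neg_mul]

/-- The flow of a small time-dependent combination of the generators. -/
theorem exists_flow {m : ℝ → Indep × ℝ × ℝ} (hm : Continuous m) {δ : ℝ} (hδ : ∀ t, ‖m t‖ ≤ δ)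
    (hδ1 : δ ≤ 1) : ∃ (A R : ℝ → ℝ) (b : ℝ → Indep), A 0 = 0 ∧ R 0 = 0 ∧ b 0 = 0 ∧
      (∀ t ∈ Icc (0 : ℝ) 1, ‖(A t, R t, b t)‖ ≤ Real.exp 1 * δ) ∧
      ∀ t q, HasDerivAt (fun τ => (expParam (A τ) (R τ) (b τ)).act q)
        (infinitesimal (m t).1 (m t).2.1 (m t).2.2 ((expParam (A t) (R t) (b t)).act q)) t := by
  have hδ0 : 0 ≤ δ := (norm_nonneg _).trans (hδ 0)
  have hv : Continuous fun t => (m t).1 := by fun_prop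
  have hg : Continuous fun t => (m t).2.1 := by fun_prop
  have hρ : Continuous fun t => (m t).2.2 := by fun_prop
  have nv : ∀ t, ‖(m t).1‖ ≤ δ := fun t => (norm_fst_le _).trans (hδ t)
  have ng : ∀ t, ‖(m t).2.1‖ ≤ δ := fun t =>
    (norm_fst_le _).trans ((norm_snd_le _).trans (hδ t))
  have nρ : ∀ t, ‖(m t).2.2‖ ≤ δ := fun t =>
    (norm_snd_le _).trans ((norm_snd_le _).trans (hδ t))
  set A : ℝ → ℝ := fun t => ∫ s in (0 : ℝ)..t, (m s).2.1 with hA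
  set R : ℝ → ℝ := fun t => ∫ s in (0 : ℝ)..t, (m s).2.2 with hR
  have dA : ∀ t, HasDerivAt A (m t).2.1 t := fun t =>
    (hg.integral_hasStrictDerivAt 0 t).hasDerivAt
  have dR : ∀ t, HasDerivAt R (m t).2.2 t := fun t =>
    (hρ.integral_hasStrictDerivAt 0 t).hasDerivAt
  have cA : Continuous A := continuous_iff_continuousAt.2 fun t => (dA t).continuousAt
  have hw : Continuous fun s => Real.exp (-A s) • (m s).1 := by fun_prop
  set b : ℝ → Indep := fun t => ∫ s in (0 : ℝ)..t, Real.exp (-A s) • (m s).1 with hb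
  have db : ∀ t, HasDerivAt b (Real.exp (-A t) • (m t).1) t := fun t =>
    (hw.integral_hasStrictDerivAt 0 t).hasDerivAt
  have bA : ∀ t ∈ Icc (0 : ℝ) 1, ‖A t‖ ≤ δ := fun t ht => by
    have h1 := intervalIntegral.norm_integral_le_of_norm_le_const (a := 0) (b := t) fun s _ => ng s
    rw [sub_zero, abs_of_nonneg ht.1] at h1
    exact h1.trans (mul_le_of_le_one_right hδ0 ht.2)
  have bR : ∀ t ∈ Icc (0 : ℝ) 1, ‖R t‖ ≤ δ := fun t ht => by
    have h1 := intervalIntegral.norm_integral_le_of_norm_le_const (a := 0) (b := t) fun s _ => nρ s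
    rw [sub_zero, abs_of_nonneg ht.1] at h1
    exact h1.trans (mul_le_of_le_one_right hδ0 ht.2)
  have bb : ∀ t ∈ Icc (0 : ℝ) 1, ‖b t‖ ≤ Real.exp 1 * δ := fun t ht => by
    have h1 : ‖b t‖ ≤ Real.exp 1 * δ * |t - 0| := by
      refine intervalIntegral.norm_integral_le_of_norm_le_const fun s hs => ?_
      rw [uIoc_of_le ht.1] at hs
      rw [norm_smul, Real.norm_eq_abs, Real.abs_exp]
      refine mul_le_mul (Real.exp_le_exp.2 ?_) (nv s) (norm_nonneg _) (Real.exp_pos _).le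
      have := bA s ⟨hs.1.le, hs.2.trans ht.2⟩
      exact ((neg_le_abs _).trans this).trans hδ1
    rw [sub_zero, abs_of_nonneg ht.1] at h1
    exact h1.trans (mul_le_of_le_one_right (by positivity) ht.2)
  have hδe : δ ≤ Real.exp 1 * δ := le_mul_of_one_le_left hδ0 (Real.one_le_exp zero_le_one)
  refine ⟨A, R, b, intervalIntegral.integral_same, intervalIntegral.integral_same,
    intervalIntegral.integral_same, fun t ht => ?_,
    fun t q => hasDerivAt_act_expParam (dA t) (dR t) (db t) q⟩
  exact max_le ((bA t ht).trans hδe) (max_le ((bR t ht).trans hδe) (bb t ht))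

/-- A point of the Guichard cone stays in the cone under translations of `x`. -/
theorem add_mem_guichardSet {p : Total} (hp : p ∈ guichardSet) (w : Indep) :
    (p.1 + w, p.2) ∈ guichardSet := hp

theorem act_mem_guichardSet {p : Total} (hp : p ∈ guichardSet) (s : Param) :
    s.act p ∈ guichardSet := by
  obtain ⟨hg, hl⟩ := hp
  refine ⟨?_, fun i => mul_ne_zero s.r.ne_zero (hl i)⟩
  have h : ∀ i, (s.act p).2.1 i = (s.r : ℝ) * p.2.1 i := fun i => rfl
  simp only [h, Fin.sum_univ_three] at hg ⊢
  linear_combination (s.r : ℝ) ^ 2 * hg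

/-- Near a point of the Guichard cone there is a second point of the cone with a different `x_0`. -/
theorem exists_add_single_mem {p : Total} {N : Set Total} (hN : N ∈ 𝓝 p) :
    ∃ t : ℝ, t ≠ 0 ∧ (p.1 + Pi.single 0 t, p.2) ∈ N := by
  have hc : Continuous fun t : ℝ => ((p.1 + Pi.single 0 t, p.2) : Total) := by
    have hs : Continuous fun t : ℝ => (Pi.single 0 t : Indep) := continuous_single (A := fun _ : Fin 3 => ℝ) 0
    fun_prop
  have h0 : ((p.1 + Pi.single 0 (0 : ℝ), p.2) : Total) = p := by simp
  have h1 : ∀ᶠ t in 𝓝 (0 : ℝ), ((p.1 + Pi.single 0 t, p.2) : Total) ∈ N :=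
    hc.continuousAt.preimage_mem_nhds (by rw [h0]; exact hN)
  obtain ⟨t, ht, htne⟩ := ((h1.filter_mono nhdsWithin_le_nhds).and
    (self_mem_nhdsWithin (s := {(0 : ℝ)}ᶜ))).exists
  exact ⟨t, htne, ht⟩

/-- The generators of translations and dilations are linearly independent on every open piece of
the Guichard cone. -/
theorem infinitesimal_inj {p : Total} (hp : p ∈ guichardSet) {N : Set Total} (hN : N ∈ 𝓝 p)
    {v v' : Indep} {g g' ρ ρ' : ℝ}
    (h : ∀ q ∈ N ∩ guichardSet, infinitesimal v g ρ q = infinitesimal v' g' ρ' q) :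
    v = v' ∧ g = g' ∧ ρ = ρ' := by
  obtain ⟨t, ht, hmem⟩ := exists_add_single_mem hN
  have h1 := h p ⟨mem_of_mem_nhds hN, hp⟩
  have h2 := h _ ⟨hmem, add_mem_guichardSet hp _⟩
  have hρ : ρ = ρ' := mul_right_cancel₀ (hp.2 0) (congrFun (congrArg (fun q : Total => q.2.1) h1) 0)
  have e1 := congrFun (congrArg Prod.fst h1) 0
  have e2 := congrFun (congrArg Prod.fst h2) 0
  simp only [infinitesimal, Pi.add_apply, Pi.smul_apply, smul_eq_mul, Pi.single_eq_same] at e1 e2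
  have hg : g = g' := mul_right_cancel₀ ht (by linarith)
  have e3 : g • p.1 + v = g' • p.1 + v' := congrArg Prod.fst h1
  rw [hg] at e3
  exact ⟨add_left_cancel e3, hg, hρ⟩

/-- The translations and dilations act faithfully on every open piece of the Guichard cone. -/
theorem act_inj {p : Total} (hp : p ∈ guichardSet) {s s' : Param}
    (h : ∀ᶠ q in 𝓝[guichardSet] p, s.act q = s'.act q) : s = s' := by
  rw [eventually_nhdsWithin_iff] at h
  obtain ⟨t, ht, hmem⟩ := exists_add_single_mem h
  have h1 := mem_of_mem_nhds h hp
  have h2 := hmem (add_mem_guichardSet hp _)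
  have hρ : (s.r : ℝ) = s'.r :=
    mul_right_cancel₀ (hp.2 0) (congrFun (congrArg (fun q : Total => q.2.1) h1) 0)
  have e1 := congrFun (congrArg Prod.fst h1) 0
  have e2 := congrFun (congrArg Prod.fst h2) 0
  simp only [Param.act, translate, dilateIndep, dilateDep, Pi.add_apply, Pi.smul_apply, smul_eq_mul,
    Pi.single_eq_same] at e1 e2
  have hg : (s.a : ℝ) = s'.a := mul_right_cancel₀ ht (by linarith)
  have e3 : (s.a : ℝ) • p.1 + s.v = (s'.a : ℝ) • p.1 + s'.v := congrArg Prod.fst h1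
  rw [hg] at e3
  exact Param.ext' (add_left_cancel e3) (Units.ext hg) (Units.ext hρ)

section LocalAction

variable {E H : Type*} [NormedAddCommGroup E] [NormedSpace ℝ E]
  [TopologicalSpace H] {I : ModelWithCorners ℝ E H} {G : Type*} [TopologicalSpace G]
  [ChartedSpace H G] [Group G] [LieGroup I ∞ G] [I.Boundaryless]
  {M : Set Total} {W : Set (G × Total)} {Ψ : G × Total → Total}

/-- On the Guichard cone the generators of a symmetry group are generators of translations and
dilations. -/
theorem exists_actionGenerator_eq [FiniteDimensional ℝ E] (hS : IsSymmetryGroup I M W Ψ)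
    {p₀ : Total} (hp₀ : p₀ ∈ guichardSet)
    (hpM : p₀ ∈ M) : ∃ (N : Set Total) (L : E →L[ℝ] Indep × ℝ × ℝ), IsOpen N ∧ p₀ ∈ N ∧
      ∀ p ∈ N ∩ guichardSet, ∀ e, actionGenerator I Ψ e p
        = infinitesimal (L e).1 (L e).2.1 (L e).2.2 p := by
  have hA := hS.toIsLocalAction
  obtain ⟨σ, B, N, hσ, hB, hconv, hne, hBM, hN, hpN, hcov⟩ :=
    exists_conePoint_ball hA.isOpen_space hp₀ hpM
  set c₀ : E := extChartAt I (1 : G) 1 with hc₀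
  have hmem : ∀ p ∈ M, (c₀, p) ∈ chartDom I W (1 : G) := fun p hp =>
    mem_chartDom_self (hA.one_mem p hp)
  have key : ∀ e : E, ∃ m : Indep × ℝ × ℝ, ∀ p ∈ N ∩ guichardSet,
      actionGenerator I Ψ e p = infinitesimal m.1 m.2.1 m.2.2 p := by
    intro e
    set ι : ℝ × Total → E × Total := fun z => (c₀ + z.1 • e, z.2) with hι
    have hιs : ContDiff ℝ ∞ ι := by fun_prop
    have hι0 : ∀ p, ι (0, p) = (c₀, p) := fun p => by simp [hι]
    obtain ⟨v, g, ρ, h⟩ := exists_generator_eq (F := chartAction I Ψ (1 : G) ∘ ι)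
      (O := ι ⁻¹' chartDom I W (1 : G)) ((isOpen_chartDom hA 1).preimage hιs.continuous)
      ((contDiffOn_chartAction hA 1).comp hιs.contDiffOn fun z hz => hz)
      (fun p hp => by
        have hpW : (c₀, p) ∈ chartDom I W (1 : G) := by rw [← hι0]; exact hp
        rw [Function.comp, hι0]
        simpa [chartAction, hc₀] using hA.one_act p (hA.dom_subset _ _ hpW.2))
      (fun s Ω Ω' u u' hu hsub => hS.mapsSolutions ((extChartAt I (1 : G)).symm (c₀ + s • e))
        Ω Ω' u u' hu (hsub.trans fun p hp => hp.2))
      hσ hB hconv hne (fun q hq => by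
        rw [mem_preimage, hι0]
        exact hmem _ (hBM q hq))
    refine ⟨(v, g, ρ), fun p hp => ?_⟩
    obtain ⟨q, hq, rfl⟩ := hcov p hp
    rw [← h q hq]
    have h1 : HasFDerivAt (chartAction I Ψ (1 : G))
        (fderiv ℝ (chartAction I Ψ (1 : G)) (c₀, conePoint σ q)) (ι (0, conePoint σ q)) := by
      rw [hι0]
      exact (((contDiffOn_chartAction hA 1).contDiffAt ((isOpen_chartDom hA 1).mem_nhds
        (hmem _ (hBM q hq)))).differentiableAt (by simp)).hasFDerivAt
    have h2 : HasFDerivAt ι (((ContinuousLinearMap.fst ℝ ℝ Total).smulRight e).prod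
        (ContinuousLinearMap.snd ℝ ℝ Total)) (0, conePoint σ q) :=
      (((ContinuousLinearMap.fst ℝ ℝ Total).smulRight e).hasFDerivAt.const_add c₀).prodMk
        (ContinuousLinearMap.snd ℝ ℝ Total).hasFDerivAt
    rw [generator, (h1.comp _ h2).fderiv, actionGenerator]
    simp [hc₀]
  choose m hm using key
  have hadd : ∀ e e', m (e + e') = m e + m e' := by
    intro e e'
    have h := infinitesimal_inj (v := (m (e + e')).1) (v' := (m e + m e').1) (g := (m (e + e')).2.1)
      (g' := (m e + m e').2.1) (ρ := (m (e + e')).2.2) (ρ' := (m e + m e').2.2) hp₀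
      (hN.mem_nhds hpN) fun q hq => by
        rw [← hm _ q hq]
        have h1 : actionGenerator I Ψ (e + e') q
            = actionGenerator I Ψ e q + actionGenerator I Ψ e' q := by
          simp only [actionGenerator]
          rw [← map_add]
          simp
        rw [h1, hm _ q hq, hm _ q hq]
        simp only [infinitesimal, Prod.fst_add, Prod.snd_add, Prod.mk_add_mk, add_smul, neg_add]
        congr 1
        abel
    exact Prod.ext h.1 (Prod.ext h.2.1 h.2.2)
  have hsmul : ∀ (a : ℝ) e, m (a • e) = a • m e := by
    intro a e
    have h := infinitesimal_inj (v := (m (a • e)).1) (v' := (a • m e).1) (g := (m (a • e)).2.1)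
      (g' := (a • m e).2.1) (ρ := (m (a • e)).2.2) (ρ' := (a • m e).2.2) hp₀
      (hN.mem_nhds hpN) fun q hq => by
        rw [← hm _ q hq]
        have h1 : actionGenerator I Ψ (a • e) q = a • actionGenerator I Ψ e q := by
          simp only [actionGenerator]
          rw [← map_smul]
          simp
        rw [h1, hm _ q hq]
        simp [infinitesimal, smul_smul]
    exact Prod.ext h.1 (Prod.ext h.2.1 h.2.2)
  exact ⟨N, LinearMap.toContinuousLinearMap { toFun := m, map_add' := hadd, map_smul' := hsmul },
    hN, hpN, fun p hp e => hm e p hp⟩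

end LocalAction

section LocalAction

variable {E H : Type*} [NormedAddCommGroup E] [NormedSpace ℝ E]
  [TopologicalSpace H] {I : ModelWithCorners ℝ E H} {G : Type*} [TopologicalSpace G]
  [ChartedSpace H G] [Group G] [LieGroup I ∞ G] [I.Boundaryless]
  {M : Set Total} {W : Set (G × Total)} {Ψ : G × Total → Total}

/-- Near a point of the Guichard cone, the elements of a symmetry group that are close to the
identity act on the cone by translations and dilations. -/
theorem exists_local_act [FiniteDimensional ℝ E] (hS : IsSymmetryGroup I M W Ψ) {p₀ : Total}
    (hp₀ : p₀ ∈ guichardSet) (hpM : p₀ ∈ M) : ∃ U ∈ 𝓝 (1 : G), ∃ N ∈ 𝓝 p₀, ∀ g ∈ U, ∃ s : Param,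
      0 < (s.a : ℝ) ∧ 0 < (s.r : ℝ) ∧
      ∀ q ∈ N ∩ guichardSet, (g, q) ∈ W ∧ Ψ (g, q) = s.act q := by
  have hA := hS.toIsLocalAction
  obtain ⟨N₀, L, hN₀, hpN₀, hL⟩ := exists_actionGenerator_eq hS hp₀ hpM
  set φ := extChartAt I (1 : G) with hφ
  set c₀ : E := φ 1 with hc₀
  have hc₀t : c₀ ∈ φ.target := mem_extChartAt_target (1 : G)
  have htarget : φ.target ∈ 𝓝 c₀ := (isOpen_extChartAt_target (1 : G)).mem_nhds hc₀t
  have : IsTopologicalGroup G := topologicalGroup_of_lieGroup I ∞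
  -- The coefficients of the velocity of `γ` in the group at time `t` are `D (γ t) (γ' t)`.
  set D : E → E →L[ℝ] Indep × ℝ × ℝ := fun c =>
    -(L.comp ((fderiv ℝ (chartDiv I G) (c, c)).comp (ContinuousLinearMap.inr ℝ E E))) with hD
  have hDcont : ContinuousOn D φ.target := by
    have h1 : ContinuousOn (fun c : E => fderiv ℝ (chartDiv I G) (c, c)) φ.target :=
      (contDiffOn_chartDiv.continuousOn_fderiv_of_isOpen isOpen_chartDivDom (by simp)).comp
        (continuous_id.prodMk continuous_id).continuousOn fun c hc => diag_mem_chartDivDom hc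
    exact (continuousOn_const.clm_comp (h1.clm_comp continuousOn_const)).neg
  set C : ℝ := ‖D c₀‖ + 1 with hC
  have hCpos : 0 < C := by positivity
  have hDC : ∀ᶠ c in 𝓝 c₀, ‖D c‖ < C :=
    (hDcont.continuousAt htarget).norm.eventually_lt_const (lt_add_one _)
  -- A neighbourhood in which the flow remains in the domain of the action.
  have hstay : ∀ᶠ z in 𝓝 (c₀, ((0 : ℝ), (0 : ℝ), (0 : Indep)), p₀),
      ((φ.symm z.1)⁻¹, (expParam z.2.1.1 z.2.1.2.1 z.2.1.2.2).act z.2.2) ∈ W ∧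
      (expParam z.2.1.1 z.2.1.2.1 z.2.1.2.2).act z.2.2 ∈ N₀ := by
    have h1 : ContinuousAt (fun z : E × (ℝ × ℝ × Indep) × Total =>
        (expParam z.2.1.1 z.2.1.2.1 z.2.1.2.2).act z.2.2) (c₀, (0, 0, 0), p₀) :=
      (continuous_act_expParam.comp continuous_snd).continuousAt
    have h2 : ContinuousAt (fun z : E × (ℝ × ℝ × Indep) × Total => (φ.symm z.1)⁻¹)
        (c₀, (0, 0, 0), p₀) :=
      (ContinuousAt.comp (f := Prod.fst) (g := φ.symm)
        ((continuousOn_extChartAt_symm (1 : G)).continuousAt htarget) continuousAt_fst).inv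
    have h3 : (expParam 0 0 0).act p₀ = p₀ := by rw [expParam_zero, Param.act_one]
    refine Filter.Eventually.and
      ((h2.prodMk h1).preimage_mem_nhds (hA.isOpen_dom.mem_nhds ?_))
      (h1.preimage_mem_nhds (hN₀.mem_nhds ?_))
    · simp only [h3, hc₀, hφ, extChartAt_to_inv, inv_one]
      exact hA.one_mem _ hpM
    · simp only [h3]
      exact hpN₀
  obtain ⟨ε, hε, hball⟩ := Metric.eventually_nhds_iff_ball.1 hstay
  obtain ⟨ε', hε', hball'⟩ := Metric.eventually_nhds_iff_ball.1 (hDC.and htarget)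
  set η : ℝ := min (min ε ε') (min (1 / C) (ε / (Real.exp 1 * C))) with hη
  have hηpos : 0 < η := by positivity
  have hφc : ContinuousAt φ 1 := continuousAt_extChartAt (1 : G)
  refine ⟨φ.source ∩ φ ⁻¹' Metric.ball c₀ η, inter_mem (extChartAt_source_mem_nhds _)
    (hφc.preimage_mem_nhds (Metric.ball_mem_nhds _ hηpos)), Metric.ball p₀ ε,
    Metric.ball_mem_nhds _ hε, ?_⟩
  rintro g ⟨hgs, hgb⟩
  set κ : E := φ g - c₀ with hκ
  have hκη : ‖κ‖ < η := by rwa [← dist_eq_norm]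
  set γ : ℝ → E := fun t => c₀ + t • κ with hγ
  have hγd : ∀ t, HasDerivAt γ κ t := fun t =>
    (((hasDerivAt_id t).smul_const κ).const_add c₀).congr_deriv (one_smul ℝ κ)
  have hγb : ∀ t ∈ Icc (0 : ℝ) 1, dist (γ t) c₀ < η := fun t ht => by
    rw [dist_eq_norm, hγ, add_sub_cancel_left, norm_smul, Real.norm_of_nonneg ht.1]
    exact (mul_le_of_le_one_left (norm_nonneg _) ht.2).trans_lt hκη
  have hγ1 : γ 1 = φ g := by simp [hγ, hκ]
  have hγ0 : γ 0 = c₀ := by simp [hγ]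
  have hγt : ∀ t ∈ Icc (0 : ℝ) 1, ‖D (γ t)‖ < C ∧ γ t ∈ φ.target := fun t ht =>
    hball' _ ((hγb t ht).trans_le ((min_le_left _ _).trans (min_le_right _ _)))
  -- The coefficients are extended by constants outside the unit interval.
  set m : ℝ → Indep × ℝ × ℝ := fun t => D (γ (projIcc 0 1 zero_le_one t)) κ with hm
  have hmc : Continuous m := by
    have h1 : ContinuousOn (fun t => D (γ t) κ) (Icc 0 1) :=
      ((hDcont.comp (continuous_iff_continuousAt.2 fun t => (hγd t).continuousAt).continuousOn
        fun t ht => (hγt t ht).2)).clm_apply continuousOn_const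
    exact (continuousOn_iff_continuous_domRestrict.1 h1).comp continuous_projIcc
  have hmeq : ∀ t ∈ Icc (0 : ℝ) 1, m t = D (γ t) κ := fun t ht => by
    simp only [hm, projIcc_of_mem zero_le_one ht]
  have hmb : ∀ t, ‖m t‖ ≤ C * ‖κ‖ := fun t =>
    (ContinuousLinearMap.le_opNorm _ _).trans (mul_le_mul_of_nonneg_right
      (hγt _ (projIcc 0 1 zero_le_one t).2).1.le (norm_nonneg _))
  have hCκ : C * ‖κ‖ ≤ 1 := by
    have h1 : ‖κ‖ ≤ 1 / C := hκη.le.trans ((min_le_right _ _).trans (min_le_left _ _))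
    rwa [le_div_iff₀ hCpos, mul_comm] at h1
  have hCκ' : Real.exp 1 * (C * ‖κ‖) < ε := by
    have h1 : ‖κ‖ < ε / (Real.exp 1 * C) :=
      hκη.trans_le ((min_le_right _ _).trans (min_le_right _ _))
    rwa [lt_div_iff₀ (by positivity), mul_comm, mul_assoc] at h1
  obtain ⟨A, R, b, hA0, hR0, hb0, hbound, hflow⟩ := exists_flow hmc hmb hCκ
  refine ⟨expParam (A 1) (R 1) (b 1), Real.exp_pos _, Real.exp_pos _, ?_⟩
  rintro q ⟨hqb, hqg⟩
  have hin : ∀ t ∈ Icc (0 : ℝ) 1,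
      ((φ.symm (γ t))⁻¹, (expParam (A t) (R t) (b t)).act q) ∈ W ∧
      (expParam (A t) (R t) (b t)).act q ∈ N₀ := fun t ht => by
    refine hball (γ t, (A t, R t, b t), q) ?_
    rw [Metric.mem_ball, Prod.dist_eq, Prod.dist_eq]
    refine max_lt ((hγb t ht).trans_le ((min_le_left _ _).trans (min_le_left _ _)))
      (max_lt ?_ hqb)
    rw [show ((0 : ℝ), (0 : ℝ), (0 : Indep)) = 0 from rfl, dist_zero_right]
    exact (hbound t ht).trans_lt hCκ'
  have hzero : ∀ t ∈ Icc (0 : ℝ) 1, HasDerivAt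
      (fun τ => Ψ ((φ.symm (γ τ))⁻¹, (expParam (A τ) (R τ) (b τ)).act q)) 0 t := by
    intro t ht
    refine hasDerivAt_inv_act hA (hγd t) (hγt t ht).2 (hflow t q) (hin t ht).1 ?_
    rw [hL _ ⟨(hin t ht).2, act_mem_guichardSet hqg _⟩, hmeq t ht]
    have h1 : D (γ t) κ = -(L (fderiv ℝ (chartDiv I G) (γ t, γ t) (0, κ))) := rfl
    rw [h1]
    simp only [infinitesimal, Prod.fst_neg, Prod.snd_neg, Prod.mk_add_mk]
    refine Prod.ext ?_ (Prod.ext ?_ ?_)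
    · simp only [neg_smul]
      abel_nf
      simp
    · simp
    · simp
  have hconst := constant_of_has_deriv_right_zero (f := fun τ =>
    Ψ ((φ.symm (γ τ))⁻¹, (expParam (A τ) (R τ) (b τ)).act q)) (a := 0) (b := 1)
    (fun t ht => (hzero t ht).continuousAt.continuousWithinAt)
    (fun t ht => (hzero t ⟨ht.1, ht.2.le⟩).hasDerivWithinAt) 1 (right_mem_Icc.2 zero_le_one)
  have hqM : q ∈ M := by
    have h1 := (hin 0 (left_mem_Icc.2 zero_le_one)).1
    rw [hA0, hR0, hb0, expParam_zero, Param.act_one] at h1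
    exact hA.dom_subset _ _ h1
  have hend := (hin 1 (right_mem_Icc.2 zero_le_one)).1
  simp only [hγ1, hγ0, hA0, hR0, hb0, expParam_zero, Param.act_one] at hconst hend
  rw [show φ.symm (φ g) = g from φ.left_inv hgs] at hconst hend
  rw [show φ.symm c₀ = 1 from extChartAt_to_inv (1 : G), inv_one, hA.one_act _ hqM] at hconst
  have h1 := hA.inv_mem _ _ hend
  have h2 := hA.inv_act _ _ hend
  rw [hconst, inv_inv] at h1 h2
  exact ⟨h1, h2⟩

end LocalAction

/-! ### Connected symmetry groups -/

section LocalAction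

variable {E H : Type*} [NormedAddCommGroup E] [NormedSpace ℝ E]
  [TopologicalSpace H] {I : ModelWithCorners ℝ E H} {G : Type*} [TopologicalSpace G]
  [ChartedSpace H G] [Group G] {M : Set Total} {W : Set (G × Total)} {Ψ : G × Total → Total}

/-- The transformation by `g` agrees near `p` on the Guichard cone with a composite of a translation
and dilations with positive ratios. -/
def ActsByParam (Ψ : G × Total → Total) (p : Total) (g : G) : Prop :=
  ∃ s : Param, 0 < (s.a : ℝ) ∧ 0 < (s.r : ℝ) ∧ ∀ᶠ q in 𝓝[guichardSet] p, Ψ (g, q) = s.act q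

theorem continuousAt_act (hA : IsLocalAction I M W Ψ) {g : G} {p : Total} (h : (g, p) ∈ W) :
    ContinuousAt Ψ (g, p) :=
  hA.smooth.continuousOn.continuousAt (hA.isOpen_dom.mem_nhds h)

theorem ActsByParam.mul (hA : IsLocalAction I M W Ψ) {p : Total} {g k : G} (hg : (g, p) ∈ W)
    (hkg : (k * g, p) ∈ W) (h : ActsByParam Ψ p g) {N : Set Total} (hN : N ∈ 𝓝 (Ψ (g, p)))
    (hk : ∃ s : Param, 0 < (s.a : ℝ) ∧ 0 < (s.r : ℝ) ∧
      ∀ q ∈ N ∩ guichardSet, (k, q) ∈ W ∧ Ψ (k, q) = s.act q) :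
    ActsByParam Ψ p (k * g) := by
  obtain ⟨s, ha, hr, hs⟩ := h
  obtain ⟨s', ha', hr', hs'⟩ := hk
  have hc : ∀ k : G, ContinuousAt (fun q : Total => (k, q)) p := fun k => by fun_prop
  have e1 : ∀ᶠ q in 𝓝 p, (g, q) ∈ W := (hc g).preimage_mem_nhds (hA.isOpen_dom.mem_nhds hg)
  have e2 : ∀ᶠ q in 𝓝 p, (k * g, q) ∈ W :=
    (hc (k * g)).preimage_mem_nhds (hA.isOpen_dom.mem_nhds hkg)
  have e3 : ∀ᶠ q in 𝓝 p, Ψ (g, q) ∈ N :=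
    (ContinuousAt.comp (f := fun q : Total => (g, q)) (continuousAt_act hA hg)
      (hc g)).preimage_mem_nhds hN
  refine ⟨s' * s, ?_, ?_, ?_⟩
  · rw [Param.mul_a, Units.val_mul]; exact mul_pos ha' ha
  · rw [Param.mul_r, Units.val_mul]; exact mul_pos hr' hr
  · filter_upwards [hs, self_mem_nhdsWithin, nhdsWithin_le_nhds e1, nhdsWithin_le_nhds e2,
      nhdsWithin_le_nhds e3] with q h1 hq h2 h3 h4
    have hmem : Ψ (g, q) ∈ guichardSet := h1 ▸ act_mem_guichardSet hq s
    obtain ⟨h5, h6⟩ := hs' _ ⟨h4, hmem⟩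
    rw [← hA.mul_act k g q h2 h5 h3, h6, h1, Param.act_mul]

theorem eq_zero_of_frequently {X Y : Type*} [TopologicalSpace X] [TopologicalSpace Y] [T1Space Y]
    [Zero Y] {f : X → Y} {x : X} (hf : ContinuousAt f x) (h : ∃ᶠ y in 𝓝 x, f y = 0) : f x = 0 := by
  by_contra hne
  exact h (hf.eventually_ne hne)

variable [LieGroup I ∞ G] [I.Boundaryless]

theorem continuousAt_fderiv_act (hA : IsLocalAction I M W Ψ) {g : G} {p : Total}
    (h : (g, p) ∈ W) (w : Total) :
    ContinuousAt (fun k : G => fderiv ℝ (fun q => Ψ (k, q)) p w) g := by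
  have hfd : ContinuousAt (fun k : G => fderiv ℝ (chartAction I Ψ g) (extChartAt I g k, p) (0, w))
      g := by
    have h1 : ContinuousAt (fderiv ℝ (chartAction I Ψ g)) (extChartAt I g g, p) :=
      ((contDiffOn_chartAction hA g).continuousOn_fderiv_of_isOpen (isOpen_chartDom hA g)
        (by simp)).continuousAt ((isOpen_chartDom hA g).mem_nhds (mem_chartDom_self h))
    have h2 : ContinuousAt (fun k : G => (extChartAt I g k, p)) g :=
      (continuousAt_extChartAt g).prodMk continuousAt_const
    exact (ContinuousAt.comp (f := fun k : G => (extChartAt I g k, p)) h1 h2).clm_apply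
      continuousAt_const
  refine hfd.congr ?_
  have e1 : ∀ᶠ k in 𝓝 g, (k, p) ∈ W :=
    (show ContinuousAt (fun k : G => (k, p)) g by fun_prop).preimage_mem_nhds
      (hA.isOpen_dom.mem_nhds h)
  filter_upwards [e1, extChartAt_source_mem_nhds (I := I) g] with k hk hks
  have hinv : (extChartAt I g).symm (extChartAt I g k) = k := (extChartAt I g).left_inv hks
  have hmem : (extChartAt I g k, p) ∈ chartDom I W g :=
    ⟨(extChartAt I g).map_source hks, by simp only [hinv]; exact hk⟩
  have h1 := (((contDiffOn_chartAction hA g).contDiffAt ((isOpen_chartDom hA g).mem_nhds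
    hmem)).differentiableAt (by simp)).hasFDerivAt
  have h2 : HasFDerivAt (fun q : Total => (extChartAt I g k, q))
      (ContinuousLinearMap.inr ℝ E Total) p := (hasFDerivAt_const _ _).prodMk (hasFDerivAt_id _)
  have h3 := (h1.comp p h2).fderiv
  have h4 : chartAction I Ψ g ∘ (fun q : Total => (extChartAt I g k, q)) = fun q => Ψ (k, q) := by
    funext q
    simp only [Function.comp, chartAction, hinv]
  rw [h4] at h3
  rw [h3]
  rfl

/-- The limit of transformations that act on the Guichard cone near `p` by translations and
dilations maps `p` to the cone: the ratio of the dilation of `l` cannot tend to zero, because it is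
an eigenvalue of the derivative of the transformation. -/
theorem mem_guichardSet_of_frequently (hA : IsLocalAction I M W Ψ) {p : Total}
    (hp : p ∈ guichardSet) {g₀ : G} (hg₀ : (g₀, p) ∈ W)
    (h : ∃ᶠ g in 𝓝 g₀, ActsByParam Ψ p g) : Ψ (g₀, p) ∈ guichardSet := by
  have hc : ContinuousAt (fun g : G => Ψ (g, p)) g₀ :=
    ContinuousAt.comp (f := fun g : G => (g, p)) (continuousAt_act hA hg₀) (by fun_prop)
  have hcl : ∀ i, ContinuousAt (fun g : G => (Ψ (g, p)).2.1 i) g₀ := fun i =>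
    ContinuousAt.comp (g := fun q : Total => q.2.1 i) (by fun_prop) hc
  have e1 : ∀ᶠ g in 𝓝 g₀, (g, p) ∈ W :=
    (show ContinuousAt (fun g : G => (g, p)) g₀ by fun_prop).preimage_mem_nhds
      (hA.isOpen_dom.mem_nhds hg₀)
  have hval : ∀ g, ActsByParam Ψ p g → ∃ s : Param, Ψ (g, p) = s.act p := fun g ⟨s, _, _, hs⟩ =>
    ⟨s, hs.self_of_nhdsWithin hp⟩
  have hcone : ∑ i, eps i * (Ψ (g₀, p)).2.1 i ^ 2 = 0 := by
    refine eq_zero_of_frequently (f := fun g : G => ∑ i, eps i * (Ψ (g, p)).2.1 i ^ 2)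
      (by fun_prop) (h.mono fun g hg => ?_)
    obtain ⟨s, hs⟩ := hval g hg
    rw [hs]
    exact (act_mem_guichardSet hp s).1
  have hprop : ∀ i, (Ψ (g₀, p)).2.1 i * p.2.1 0 - (Ψ (g₀, p)).2.1 0 * p.2.1 i = 0 := fun i => by
    refine eq_zero_of_frequently
      (f := fun g : G => (Ψ (g, p)).2.1 i * p.2.1 0 - (Ψ (g, p)).2.1 0 * p.2.1 i)
      (by fun_prop) (h.mono fun g hg => ?_)
    obtain ⟨s, hs⟩ := hval g hg
    rw [hs]
    change (s.r : ℝ) * p.2.1 i * p.2.1 0 - (s.r : ℝ) * p.2.1 0 * p.2.1 i = 0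
    ring
  -- The derivative in the direction of the dilation of `l`.
  set w : Total := (0, p.2.1, 0) with hw
  have hder : fderiv ℝ (fun q => Ψ (g₀, q)) p w - (0, (Ψ (g₀, p)).2.1, 0) = 0 := by
    refine eq_zero_of_frequently
      (f := fun g : G => fderiv ℝ (fun q => Ψ (g, q)) p w - ((0, (Ψ (g, p)).2.1, 0) : Total))
      ((continuousAt_fderiv_act hA hg₀ w).sub (by fun_prop))
      ((h.and_eventually e1).mono fun g hg => ?_)
    obtain ⟨⟨s, _, _, hs⟩, hgW⟩ := hg
    have hline : HasDerivAt (fun t : ℝ => p + t • w) w 0 :=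
      (((hasDerivAt_id (0 : ℝ)).smul_const w).const_add p).congr_deriv (one_smul ℝ w)
    have h1 : HasDerivAt (fun t : ℝ => Ψ (g, p + t • w)) (fderiv ℝ (fun q => Ψ (g, q)) p w) 0 := by
      have h2 : HasFDerivAt (fun q => Ψ (g, q)) (fderiv ℝ (fun q => Ψ (g, q)) p)
          (p + (0 : ℝ) • w) := by
        rw [zero_smul, add_zero]
        exact (differentiableAt_act hA hgW).hasFDerivAt
      exact h2.comp_hasDerivAt (0 : ℝ) hline
    have hline0 : Tendsto (fun t : ℝ => p + t • w) (𝓝 0) (𝓝 p) := by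
      simpa using hline.continuousAt.tendsto
    have hmem : ∀ᶠ t : ℝ in 𝓝 0, p + t • w ∈ guichardSet := by
      have hone : ∀ᶠ t : ℝ in 𝓝 0, 1 + t ≠ 0 :=
        (show ContinuousAt (fun t : ℝ => 1 + t) 0 by fun_prop).eventually_ne (by simp)
      filter_upwards [hone] with t ht
      have hl : ∀ i, (p + t • w).2.1 i = (1 + t) * p.2.1 i := fun i => by
        simp [hw]; ring
      refine ⟨?_, fun i => by rw [hl]; exact mul_ne_zero ht (hp.2 i)⟩
      have := hp.1
      simp only [hl, Fin.sum_univ_three] at this ⊢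
      linear_combination (1 + t) ^ 2 * this
    have hs2 : ∀ᶠ t : ℝ in 𝓝 0, Ψ (g, p + t • w) = s.act (p + t • w) :=
      (tendsto_nhdsWithin_iff.2 ⟨hline0, hmem⟩).eventually hs
    have h3 : HasDerivAt (fun t : ℝ => s.act (p + t • w)) (0, (s.r : ℝ) • p.2.1, 0) 0 := by
      have h4 : HasDerivAt (fun t : ℝ => s.act p + t • ((0, (s.r : ℝ) • p.2.1, 0) : Total))
          (0, (s.r : ℝ) • p.2.1, 0) 0 :=
        (((hasDerivAt_id (0 : ℝ)).smul_const _).const_add _).congr_deriv (one_smul ℝ _)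
      refine h4.congr_of_eventuallyEq (Eventually.of_forall fun t => ?_)
      simp only [Param.act, translate, dilateIndep, dilateDep, hw]
      refine Prod.ext ?_ (Prod.ext ?_ ?_)
      · simp
      · simp [smul_smul, mul_comm]
      · simp
    rw [h1.unique (h3.congr_of_eventuallyEq hs2), hs.self_of_nhdsWithin hp, sub_eq_zero]
    rfl
  refine ⟨hcone, fun i hi => ?_⟩
  have h0 : (Ψ (g₀, p)).2.1 0 = 0 := by
    have h1 := hprop i
    rw [hi, zero_mul, zero_sub, neg_eq_zero] at h1
    exact (mul_eq_zero.1 h1).resolve_right (hp.2 i)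
  have hl0 : (Ψ (g₀, p)).2.1 = 0 := by
    funext j
    have h1 := hprop j
    rw [h0, zero_mul, sub_zero] at h1
    exact (mul_eq_zero.1 h1).resolve_right (hp.2 0)
  rw [hl0, sub_eq_zero] at hder
  have h1 : HasFDerivAt (fun q => Ψ (g₀⁻¹, Ψ (g₀, q)))
      ((fderiv ℝ (fun q => Ψ (g₀⁻¹, q)) (Ψ (g₀, p))).comp (fderiv ℝ (fun q => Ψ (g₀, q)) p)) p :=
    HasFDerivAt.comp (g := fun q => Ψ (g₀⁻¹, q)) (f := fun q => Ψ (g₀, q)) p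
      (differentiableAt_act hA (hA.inv_mem _ _ hg₀)).hasFDerivAt
      (differentiableAt_act hA hg₀).hasFDerivAt
  have e2 : (fun q => Ψ (g₀⁻¹, Ψ (g₀, q))) =ᶠ[𝓝 p] id := by
    filter_upwards [(show ContinuousAt (fun q : Total => (g₀, q)) p by
      fun_prop).preimage_mem_nhds (hA.isOpen_dom.mem_nhds hg₀)] with q hq
    exact hA.inv_act _ _ hq
  have h2 := congrArg (fun T : Total →L[ℝ] Total => T w)
    (h1.unique ((hasFDerivAt_id p).congr_of_eventuallyEq e2))
  rw [ContinuousLinearMap.comp_apply, hder] at h2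
  have h3 : w = 0 := h2.symm.trans (map_zero _)
  exact hp.2 0 (congrFun (congrArg (fun q : Total => q.2.1) h3) 0)

/-- If the set of group elements that are defined at `p` is connected, all of them act near `p` on
the Guichard cone by translations and dilations. -/
theorem actsByParam [FiniteDimensional ℝ E] (hS : IsSymmetryGroup I M W Ψ) {p : Total}
    (hp : p ∈ guichardSet) (hpM : p ∈ M) (hconn : IsPreconnected {g : G | (g, p) ∈ W}) {g : G}
    (hg : (g, p) ∈ W) : ActsByParam Ψ p g := by
  have hA := hS.toIsLocalAction
  have : IsTopologicalGroup G := topologicalGroup_of_lieGroup I ∞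
  have hone : ActsByParam Ψ p (1 : G) := by
    refine ⟨1, by simp, by simp, ?_⟩
    filter_upwards [nhdsWithin_le_nhds (hA.isOpen_space.mem_nhds hpM)] with q hq
    rw [hA.one_act q hq, Param.act_one]
  refine (hconn.induction₂ (fun g g' => ActsByParam Ψ p g ↔ ActsByParam Ψ p g') ?_
    (fun _ _ _ _ _ _ h h' => h.trans h') (fun _ _ _ _ h => h.symm) (hA.one_mem p hpM) hg).1 hone
  intro g₀ hg₀
  have hc : ContinuousAt (fun g : G => Ψ (g, p)) g₀ :=
    ContinuousAt.comp (f := fun g : G => (g, p)) (continuousAt_act hA hg₀) (by fun_prop)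
  by_cases hmem : Ψ (g₀, p) ∈ guichardSet
  · obtain ⟨U, hU, N, hN, hloc⟩ := exists_local_act hS hmem (hA.mapsTo _ _ hg₀)
    have e1 : ∀ᶠ g in 𝓝 g₀, g * g₀⁻¹ ∈ U :=
      (show ContinuousAt (fun g : G => g * g₀⁻¹) g₀ by fun_prop).preimage_mem_nhds
        (by simpa using hU)
    have e2 : ∀ᶠ g in 𝓝 g₀, g₀ * g⁻¹ ∈ U :=
      (show ContinuousAt (fun g : G => g₀ * g⁻¹) g₀ by fun_prop).preimage_mem_nhds
        (by simpa using hU)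
    have e3 : ∀ᶠ g in 𝓝 g₀, N ∈ 𝓝 (Ψ (g, p)) := hc.eventually (eventually_mem_nhds_iff.2 hN)
    filter_upwards [self_mem_nhdsWithin, nhdsWithin_le_nhds e1, nhdsWithin_le_nhds e2,
      nhdsWithin_le_nhds e3] with g hg h1 h2 h3
    constructor
    · intro h
      have := h.mul hA (k := g * g₀⁻¹) hg₀ (by simpa using hg) hN (hloc _ h1)
      simpa using this
    · intro h
      have := h.mul hA (k := g₀ * g⁻¹) hg (by simpa using hg₀) h3 (hloc _ h2)
      simpa using this
  · have hnot : ∀ᶠ g in 𝓝 g₀, ¬ ActsByParam Ψ p g := by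
      by_contra hfr
      exact hmem (mem_guichardSet_of_frequently hA hp hg₀ hfr)
    filter_upwards [nhdsWithin_le_nhds hnot] with g h
    exact iff_of_false hnot.self_of_nhds h

end LocalAction

/-! ### Translations and dilations are symmetries -/

theorem mapsSolutions_act (s : Param) : MapsSolutions univ s.act := by
  intro Ω Ω' u u' hu _ hΩ' hu' himg
  obtain ⟨hΩ, hus, hsol⟩ := isSolution_iff.1 hu
  have ha := s.a.ne_zero
  set T : Dep →L[ℝ] Dep := ((s.r : ℝ) • ContinuousLinearMap.fst ℝ (Fin 3 → ℝ) (OffDiag → ℝ)).prod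
    ((s.a : ℝ)⁻¹ • ContinuousLinearMap.snd ℝ (Fin 3 → ℝ) (OffDiag → ℝ)) with hT
  set τ : Indep → Indep := fun x => (s.a : ℝ)⁻¹ • (x - s.v) with hτ
  have hback : ∀ x ∈ Ω', τ x ∈ Ω ∧ u' x = T (u (τ x)) := by
    intro x hx
    have h1 : (x, u' x) ∈ s.act '' Ω.graphOn u := by
      rw [himg]; exact mem_graphOn.2 ⟨hx, rfl⟩
    obtain ⟨⟨y, z⟩, hyz, h2⟩ := h1
    obtain ⟨hy, hz⟩ := mem_graphOn.1 hyz
    have h3 : (s.a : ℝ) • y + s.v = x := congrArg Prod.fst h2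
    have h4 : τ x = y := by simp [hτ, ← h3, smul_smul, ha]
    rw [h4]
    refine ⟨hy, ?_⟩
    have h5 : u y = z := hz
    rw [h5]
    exact (congrArg Prod.snd h2).symm
  refine isSolution_iff.2 ⟨hΩ', hu', fun x hx => ?_⟩
  obtain ⟨hxΩ, hval⟩ := hback x hx
  obtain ⟨hne, hg, hfo⟩ := hsol _ hxΩ
  have hder : ∀ n, fderiv ℝ u' x (Pi.single n 1)
      = (s.a : ℝ)⁻¹ • T (fderiv ℝ u (τ x) (Pi.single n 1)) := by
    intro n
    have h1 : HasFDerivAt τ ((s.a : ℝ)⁻¹ • ContinuousLinearMap.id ℝ Indep) x :=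
      ((hasFDerivAt_id x).sub_const s.v).fun_const_smul _
    have h2 := ((hus.contDiffAt (hΩ.mem_nhds hxΩ)).differentiableAt (by simp)).hasFDerivAt
    have h3 := (T.hasFDerivAt.comp x (h2.comp x h1)).congr_of_eventuallyEq
      (f₁ := u') ((hΩ'.eventually_mem hx).mono fun y hy => (hback y hy).2)
    rw [h3.fderiv]
    simp
  have hl : ∀ y : Dep, ∀ i, (T y).1 i = s.r * y.1 i := fun _ _ => rfl
  have hh' : ∀ y : Dep, ∀ i j, hh (T y).2 i j = (s.a : ℝ)⁻¹ * hh y.2 i j := fun y i j =>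
    hh_smul _ _ _ _
  refine ⟨fun i => ?_, ?_, ?_⟩
  · rw [hval, hl]
    exact mul_ne_zero s.r.ne_zero (hne i)
  · rw [hval]
    simp only [hl, Fin.sum_univ_three] at hg ⊢
    linear_combination (s.r : ℝ) ^ 2 * hg
  · simp only [hder, hval]
    constructor
    · intro i j hij
      simp only [Prod.smul_fst, Pi.smul_apply, smul_eq_mul, hl, hh']
      linear_combination ((s.a : ℝ)⁻¹ * s.r) * hfo.l_off i j hij
    · intro i j k hij hjk hik
      simp only [Prod.smul_fst, Pi.smul_apply, smul_eq_mul, hl, hh']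
      linear_combination ((s.a : ℝ)⁻¹ * s.r) * hfo.l_diag i j k hij hjk hik
    · intro i j k hij hjk hik
      simp only [Prod.smul_snd, hh_smul, hh']
      linear_combination ((s.a : ℝ)⁻¹) ^ 2 * hfo.h_off i j k hij hjk hik
    · intro i j k hij hjk hik
      simp only [Prod.smul_snd, hh_smul, hh']
      linear_combination ((s.a : ℝ)⁻¹) ^ 2 * hfo.h_sum i j k hij hjk hik
    · intro i j k hij hjk hik
      simp only [Prod.smul_snd, hh_smul, hh']
      linear_combination ((s.a : ℝ)⁻¹) ^ 2 * hfo.h_eps i j k hij hjk hik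

theorem contMDiff_act : ContMDiff (Param.model.prod 𝓘(ℝ, Total)) 𝓘(ℝ, Total) ∞
    fun q : Param × Total => q.1.act q.2 := by
  have hv : ContMDiff Param.model 𝓘(ℝ, Indep) ∞ Param.v :=
    (contMDiff_fst : ContMDiff Param.model 𝓘(ℝ, Indep) ∞ (Prod.fst : Indep × ℝˣ × ℝˣ → Indep))
  have hs : ContMDiff Param.model (𝓘(ℝ, ℝ).prod 𝓘(ℝ, ℝ)) ∞ (fun s : Param => (s.a, s.r)) :=
    (contMDiff_snd : ContMDiff Param.model (𝓘(ℝ, ℝ).prod 𝓘(ℝ, ℝ)) ∞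
      (Prod.snd : Indep × ℝˣ × ℝˣ → ℝˣ × ℝˣ))
  have ha : ContMDiff Param.model 𝓘(ℝ, ℝ) ∞ Param.a := contMDiff_fst.comp hs
  have hr : ContMDiff Param.model 𝓘(ℝ, ℝ) ∞ Param.r := contMDiff_snd.comp hs
  have hval : ContMDiff 𝓘(ℝ, ℝ) 𝓘(ℝ, ℝ) ∞ (Units.val : ℝˣ → ℝ) := Units.contMDiff_val
  have hx : ContMDiff (Param.model.prod 𝓘(ℝ, Total)) 𝓘(ℝ, Indep) ∞
      (fun q : Param × Total => q.2.1) := contDiff_fst.contMDiff.comp contMDiff_snd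
  have hl : ContMDiff (Param.model.prod 𝓘(ℝ, Total)) 𝓘(ℝ, Fin 3 → ℝ) ∞
      (fun q : Param × Total => q.2.2.1) :=
    (contDiff_fst.comp contDiff_snd).contMDiff.comp contMDiff_snd
  have hh₀ : ContMDiff (Param.model.prod 𝓘(ℝ, Total)) 𝓘(ℝ, OffDiag → ℝ) ∞
      (fun q : Param × Total => q.2.2.2) :=
    (contDiff_snd.comp contDiff_snd).contMDiff.comp contMDiff_snd
  have h : ContMDiff (Param.model.prod 𝓘(ℝ, Total)) 𝓘(ℝ, Total) ∞
      (fun q : Param × Total => (((q.1.a : ℝ) • q.2.1 + q.1.v, (q.1.r : ℝ) • q.2.2.1,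
        ((q.1.a⁻¹ : ℝˣ) : ℝ) • q.2.2.2) : Total)) :=
    (((hval.comp (ha.comp contMDiff_fst)).smul hx).add (hv.comp contMDiff_fst)).prodMk_space
      (((hval.comp (hr.comp contMDiff_fst)).smul hl).prodMk_space
        ((hval.comp (ha.inv.comp contMDiff_fst)).smul hh₀))
  refine h.congr fun q => ?_
  rw [Units.val_inv_eq_inv_val]
  rfl

/-- Translations and dilations form a symmetry group of the system. -/
theorem isSymmetryGroup_param : IsSymmetryGroup Param.model (G := Param) univ univ
    (fun q : Param × Total => q.1.act q.2) where
  isOpen_space := isOpen_univ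
  isOpen_dom := isOpen_univ
  dom_subset _ _ _ := mem_univ _
  one_mem _ _ := mem_univ _
  mapsTo _ _ _ := mem_univ _
  smooth := contMDiff_act.contMDiffOn
  one_act p _ := Param.act_one p
  mul_act g g' p _ _ _ := (Param.act_mul g g' p).symm
  inv_mem _ _ _ := mem_univ _
  inv_act g p _ := by rw [← Param.act_mul, inv_mul_cancel, Param.act_one]
  mapsSolutions g Ω Ω' u u' hu _ := mapsSolutions_act g Ω Ω' u u' hu (subset_univ _)

end Lame

end

theorem corollary3p2 :
    -- The group generated by the translations and dilations (with nonzero real ratios) acts as a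
    -- symmetry group of the system on the whole space of independent and dependent variables.
    Lame.IsSymmetryGroup Lame.Param.model (G := Lame.Param) univ univ
        (fun q : Lame.Param × Lame.Total => q.1.act q.2) ∧
    -- Every connected symmetry group acts through these transformations.
    (∀ (E H G : Type*) [NormedAddCommGroup E] [NormedSpace ℝ E]
        [FiniteDimensional ℝ E] [TopologicalSpace H] (I : ModelWithCorners ℝ E H)
        [I.Boundaryless] [TopologicalSpace G] [ChartedSpace H G] [Group G] [LieGroup I ∞ G]
        (M : Set Lame.Total) (W : Set (G × Lame.Total)) (Ψ : G × Lame.Total → Lame.Total),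
      Lame.IsSymmetryGroup I M W Ψ → Lame.ConnectedDomains M W →
      ∀ (g : G) (S : Set Lame.Total), S ⊆ Lame.guichardSet → IsPreconnected S →
        (∀ p ∈ S, (g, p) ∈ W) →
        ∃ (v : Lame.Indep) (a r : ℝˣ), 0 < (a : ℝ) ∧ 0 < (r : ℝ) ∧
          ∀ p ∈ S, Ψ (g, p) =
            Lame.translate v (Lame.dilateIndep a (Lame.dilateDep r p))) := by
  refine ⟨Lame.isSymmetryGroup_param, ?_⟩
  intro E H G _ _ _ _ I _ _ _ _ _ M W Ψ hS hconn g S hSG hpre hSW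
  have key : ∀ p ∈ S, Lame.ActsByParam Ψ p g := fun p hp =>
    have hpM := hS.dom_subset _ _ (hSW p hp)
    Lame.actsByParam hS (hSG hp) hpM (hconn p hpM).isPreconnected (hSW p hp)
  rcases S.eq_empty_or_nonempty with rfl | ⟨p₀, hp₀⟩
  · exact ⟨0, 1, 1, by simp, by simp, by simp⟩
  choose! s ha hr hs using key
  -- The parameters are locally constant on `S`.
  have hloc : ∀ p ∈ S, s p₀ = s p := fun p hp => by
    refine hpre.induction₂ (fun p q => s p = s q) (fun p hp => ?_)
      (fun _ _ _ _ _ _ h h' => h.trans h') (fun _ _ _ _ h => h.symm) hp₀ hp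
    have h1 := nhdsWithin_mono p hSG (eventually_eventually_nhdsWithin.2 (hs p hp))
    filter_upwards [h1, self_mem_nhdsWithin] with q hq hqS
    refine Lame.act_inj (hSG hqS) ?_
    filter_upwards [hq, hs q hqS] with y h2 h3
    rw [← h2, h3]
  refine ⟨(s p₀).v, (s p₀).a, (s p₀).r, ha p₀ hp₀, hr p₀ hp₀, fun p hp => ?_⟩
  rw [(hs p hp).self_of_nhdsWithin (hSG hp), ← hloc p hp]
  rfl
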